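/- **Setting.** Let $\mathcal S,\mathcal A$ be finite non-empty sets, $S=|\mathcal S|$, $A=|\mathcal A|$, let $H,L,K\ge 1$, $\sigma>0$, $\delta\in(0,1)$, and let $\mathcal M^c=(H,\mathcal S,\mathcal A,\mathbb P^c,r)$ be an episodic (nominal) MDP with deterministic rewards $r_h(s,a)\in[0,1]$. For a probability vector $p$ on $\mathcal S$ let $\mathcal U^\sigma(p)=\{q\in\Delta(\mathcal S):\mathrm{KL}(q\|p)\le\sigma\}$, and let $\mathcal R$ be the set of MDPs with reward $r$ and transitions $\mathbb P^\sigma_h(\cdot|s,a)\in\mathcal U^\sigma(\mathbb P^c_h(\cdot|s,a))$ for all $(s,a,h)$. The robust values of a policy $\pi$ are $V^{\pi,\mathcal R}_h(s)=\inf_{\mathcal M^\sigma\in\mathcal R}V^{\pi,\mathcal M^\sigma}_h(s)$ and $V^{\pi,\mathcal R}_1(\xi)=\mathbb E_{s\sim\xi}V^{\pi,\mathcal R}_1(s)$. Let $\pi^*$ be a deterministic policy that maximizes all $V^{\pi,\mathcal R}_h(s)$, and put $\mathrm{RGap}(\hat\pi)=V_1^{\pi^*,\mathcal R}(\xi)-V_1^{\hat\pi,\mathcal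 R}(\xi)$ for a fixed initial distribution $\xi$. Write $d^{\pi,\mathcal M}_h(s,a;\xi)$ for the probability that $(s_h,a_h)=(s,a)$ under $\pi$, $\mathcal M$ and $s_1\sim\xi$. **Data.** The sources $\mathcal M_l$, $l\in[L]$, are random: the pairs $(r_{h,l},\mathbb P_{h,l})$ are independent over $(l,h)$ with law $g_h$, where $g_h$ is a law on pairs of $[0,1]$-valued rewards and transition kernels with mean $(r_h,\mathbb P^c_h)$ such that almost surely $T_l\,\mathbb P^c_h(s'|s,a)\le \mathbb P_{h,l}(s'|s,a)\le T_u\,\mathbb P^c_h(s'|s,a)$ for constants $0<T_l<1<T_u$. Given the sources, $\mathcal D_l$ consists of $K$ independent trajectories $(s_1,a_1,\dots,s_H,a_H,s_{H+1})$, with rewards, from $\mathcal M_l$ under a fixed behavior policy $\rho_l$ and a fixed initial distribution $\xi_l$. **Algorithm HetPEVI-Robust with parameter $c$.** *Two-fold subsampling:* for each $l$, the first $\lfloor K/2\rfloor$ trajectories form the main half, the others the auxiliary half. For each $(l,h,s)$, independently, keep a uniformly random set of $\min\{N^{\rm main}_{h,l}(s),\lfloor\max(N^{\rm aux}_{h,l}(s)-10\sqrt{N^{\rm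 aux}_{h,l}(s)\log(HSL/\delta)},0)\rfloor\}$ of the main-half transitions out of $s$ at step $h$, where $N^{\rm main}_{h,l}(s),N^{\rm aux}_{h,l}(s)$ count the visits of $s$ at step $h$ in the two halves. Let $N_{h,l}(s,a)$, $N_{h,l}(s,a,s')$ be the counts in the kept data, $\hat{\mathcal L}_h(s,a)=\{l:N_{h,l}(s,a)>0\}$, $\hat L_h(s,a)=|\hat{\mathcal L}_h(s,a)|$. Let $\hat r_h(s,a)$ and $\hat{\mathbb P}_h(s'|s,a)$ be the averages over $l\in\hat{\mathcal L}_h(s,a)$ of $r_{h,l}(s,a)$ and $N_{h,l}(s,a,s')/N_{h,l}(s,a)$, and $\hat{\mathbb P}^{\min}_h(s,a)$ the smallest positive $\hat{\mathbb P}_h(s'|s,a)$. With $\iota=\log(SAH/\delta)$ put $$\Gamma^\sigma_h(s,a)=\min\Big\{H,\ \tfrac{c}{\sigma\hat{\mathbb P}^{\min}_h(s,a)}\sqrt{\sum_{l\in\hat{\mathcal L}_h(s,a)}\tfrac{H^2\iota}{\hat L_h(s,a)^2N_{h,l}(s,a)}}+\tfrac{c}{\sigma\hat{\mathbb P}^{\min}_h(s,a)}\sqrt{\tfrac{H^2\iota}{\hat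 L_h(s,a)}}+c\sqrt{\tfrac{\iota}{\hat L_h(s,a)}}\Big\}.$$ Starting from $\hat V_{H+1}=0$, for $h=H,\dots,1$ put $\hat Q_h(s,a)=\max\{\hat r_h(s,a)+\inf_{q\in\mathcal U^\sigma(\hat{\mathbb P}_h(\cdot|s,a))}\sum_{s'}q(s')\hat V_{h+1}(s')-\Gamma^\sigma_h(s,a),0\}$ if $\hat L_h(s,a)>0$, and $\hat Q_h(s,a)=0$ otherwise; $\hat\pi_h(s)\in\arg\max_a\hat Q_h(s,a)$ (ties broken in any way) and $\hat V_h(s)=\max_a\hat Q_h(s,a)$. The output is $\hat\pi$. **Coverage quantities.** Let $d^l_h(s,a)=d^{\rho_l,\mathcal M_l}_h(s,a;\xi_l)$ and $\mathcal L_h(s,a)=\{l:d^l_h(s,a)>0\}$, and - $L^\dagger_\sigma=\min\{|\mathcal L_h(s,a)|:\exists\mathcal M^\sigma\in\mathcal R,\ d^{\pi^*,\mathcal M^\sigma}_h(s,a;\xi)>0\}$, - $C^\dagger_\sigma=\max_{(s,a,h)}\max_{\mathcal M^\sigma\in\mathcal R}\sum_{l\in\mathcal L_h(s,a)}\dfrac{\min\{d^{\pi^*,\mathcal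 M^\sigma}_h(s,a;\xi),1/S\}}{|\mathcal L_h(s,a)|\,d^l_h(s,a)}$, - $L^{\min}_\sigma=\min\{|\mathcal L_h(s,a)|:|\mathcal L_h(s,a)|>0\}$ and $d^{\min}_\sigma=\min\{d^l_h(s,a):d^l_h(s,a)>0\}$, - $\mathbb P^{\min}_*=\min\{\mathbb P^c_h(s'|s,a)>0:d^{\pi^*,\mathcal M^c}_h(s,a;\xi)>0\}$ and $\mathbb P^{\min}_\sigma=\min\{\mathbb P^c_h(s'|s,a)>0:\mathcal L_h(s,a)\ne\emptyset\}$. **Theorem 4.** There are absolute constants $c_0,c_1>0$ such that for every $c\ge c_0$ there are $C>0$ and $p\in\mathbb N$, depending only on $c$, such that in every setting as above, with probability at least $1-\delta$ over the sources, the data and the subsampling, the following holds. If $L^\dagger_\sigma>0$, $$K\ \ge\ \frac{c_1\log(KHSAL/\delta)}{d^{\min}_\sigma(\mathbb P^{\min}_\sigma)^2}\qquad\text{and}\qquad L^{\min}_\sigma\ \ge\ \frac{c_1\log(KHSAL/\delta)}{(\mathbb P^{\min}_\sigma)^2},$$ then every output $\hat\pi$ of HetPEVI-Robust with parameter $c$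 satisfies $$\mathrm{RGap}(\hat\pi)\ \le\ C\,\log^p\!\Big(\frac{KHSAL}{\delta}\Big)\left(\frac{\sqrt{C^\dagger_\sigma H^4S}}{\sigma\,\mathbb P^{\min}_*\sqrt{L^\dagger_\sigma K}}+\frac{H+H^2/(\sigma\,\mathbb P^{\min}_*)}{\sqrt{L^\dagger_\sigma}}\right).$$ -/

import Mathlib

open MeasureTheory
open scoped ENNReal

noncomputable section

namespace RobustRL

/-! ## Episodic MDPs with `H` steps, finite state space `S` and finite action space `A`.
Steps are numbered `0, …, H - 1`. Probability vectors are elements of `stdSimplex`. -/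

/-- Transition probabilities: `P h s a s'` is the probability of moving from `s` to `s'` when
`a` is taken at step `h`. -/
abbrev Transition (H : ℕ) (S A : Type*) := Fin H → S → A → S → ℝ

/-- Deterministic rewards `r h s a`. -/
abbrev Reward (H : ℕ) (S A : Type*) := Fin H → S → A → ℝ

/-- An episodic MDP on fixed `H`, `S`, `A`. -/
structure EpisodicMDP (H : ℕ) (S A : Type*) [Fintype S] where
  P : Transition H S A
  r : Reward H S A
  P_mem : ∀ h s a, P h s a ∈ stdSimplex ℝ S
  r_mem : ∀ h s a, r h s a ∈ Set.Icc (0 : ℝ) 1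

/-- A (randomized) policy: `prob h s` is a distribution over actions. -/
structure Policy (H : ℕ) (S A : Type*) [Fintype A] where
  prob : Fin H → S → A → ℝ
  prob_mem : ∀ h s, prob h s ∈ stdSimplex ℝ A

/-- A deterministic policy. -/
abbrev DetPolicy (H : ℕ) (S A : Type*) := Fin H → S → A

/-- A deterministic policy as a policy. -/
def DetPolicy.toPolicy {H : ℕ} {S A : Type*} [Fintype A] [DecidableEq A]
    (π : DetPolicy H S A) : Policy H S A where
  prob h s := Pi.single (π h s) 1
  prob_mem h s := single_mem_stdSimplex ℝ (π h s)

section Model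

variable {H : ℕ} {S A : Type*} [Fintype S] [DecidableEq S] [Fintype A] [DecidableEq A]

/-- The value function: the expected sum of the rewards from step `h` on, started in `s` at
step `h`, under `π` and the transitions `P`. It is the iterated expectation over
`a_h, s_{h+1}, a_{h+1}, …`, and it is `0` after the last step. -/
def value (P : Transition H S A) (r : Reward H S A) (π : Policy H S A) (h : ℕ) (s : S) : ℝ :=
  if hh : h < H then
    ∑ a, π.prob ⟨h, hh⟩ s a *
      (r ⟨h, hh⟩ s a + ∑ s', P ⟨h, hh⟩ s a s' * value P r π (h + 1) s')
  else 0
termination_by H - h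

/-- A trajectory `s_0, a_0, s_1, …, a_{H-1}, s_H`: the states and the actions. -/
abbrev Trajectory (H : ℕ) (S A : Type*) := (Fin (H + 1) → S) × (Fin H → A)

/-- The probability of a trajectory with initial distribution `ξ`, policy `π` and
transitions `P`. -/
def trajProb (ξ : S → ℝ) (π : Policy H S A) (P : Transition H S A)
    (τ : Trajectory H S A) : ℝ :=
  ξ (τ.1 0) * ∏ h : Fin H, π.prob h (τ.1 h.castSucc) (τ.2 h) *
    P h (τ.1 h.castSucc) (τ.2 h) (τ.1 h.succ)

/-- The occupancy distribution `d_h(s, a; ξ)`: the probability that `s_h = s` and `a_h = a`. -/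
def occupancy (ξ : S → ℝ) (π : Policy H S A) (P : Transition H S A)
    (h : Fin H) (s : S) (a : A) : ℝ :=
  ∑ τ : Trajectory H S A, if τ.1 h.castSucc = s ∧ τ.2 h = a then trajProb ξ π P τ else 0

/-! ## KL uncertainty sets and robust values -/

/-- The distributions `q` on `S` with `KL(q ‖ p) ≤ σ`. A finite divergence forces `q` to be
absolutely continuous with respect to `p`; terms with `q s = 0` contribute `0`. -/
def klBall (σ : ℝ) (p : S → ℝ) : Set (S → ℝ) :=
  {q | q ∈ stdSimplex ℝ S ∧ (∀ s, p s = 0 → q s = 0) ∧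
    ∑ s, q s * Real.log (q s / p s) ≤ σ}

/-- The uncertainty set: the product of the KL balls over all `(h, s, a)`. -/
def uncertaintySet (σ : ℝ) (P : Transition H S A) : Set (Transition H S A) :=
  {P' | ∀ h s a, P' h s a ∈ klBall σ (P h s a)}

/-- The robust value function: the infimum of the values over the uncertainty set. -/
def robustValue (M : EpisodicMDP H S A) (σ : ℝ) (π : Policy H S A) (h : ℕ) (s : S) : ℝ :=
  sInf {v | ∃ P' ∈ uncertaintySet σ M.P, v = value P' M.r π h s}

/-- The robust value at the first step, averaged over the initial distribution `ξ`. -/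
def robustInitialValue (M : EpisodicMDP H S A) (σ : ℝ) (ξ : S → ℝ) (π : Policy H S A) : ℝ :=
  ∑ s, ξ s * robustValue M σ π 0 s

/-- `π` is a deterministic policy that maximizes all robust value functions, among all
(randomized) policies. -/
def IsRobustOptimal (M : EpisodicMDP H S A) (σ : ℝ) (π : DetPolicy H S A) : Prop :=
  ∀ (π' : Policy H S A) (h : Fin H) (s : S),
    robustValue M σ π' h s ≤ robustValue M σ π.toPolicy h s

/-- The robust gap of `π'` with respect to the optimal policy `πstar`. -/
def robustGap (M : EpisodicMDP H S A) (σ : ℝ) (ξ : S → ℝ) (πstar π' : DetPolicy H S A) : ℝ :=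
  robustInitialValue M σ ξ πstar.toPolicy - robustInitialValue M σ ξ π'.toPolicy

/-! ## Randomly perturbed data sources -/

/-- The rewards and the transitions of one step. -/
abbrev StepModel (S A : Type*) := (S → A → ℝ) × (S → A → S → ℝ)

/-- The laws `g h` generate perturbations of `M`: a sample of `g h` consists of rewards in
`[0, 1]` and of transition distributions that lie between `Tl` and `Tu` times those of `M`, and
its expectation is the reward and the transition of `M` at step `h`. -/
structure IsTaskSourceLaw (M : EpisodicMDP H S A) (g : Fin H → Measure (StepModel S A))
    (Tl Tu : ℝ) : Prop where
  isProbabilityMeasure : ∀ h, IsProbabilityMeasure (g h)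
  reward_mem : ∀ h, ∀ᵐ x ∂(g h), ∀ s a, x.1 s a ∈ Set.Icc (0 : ℝ) 1
  transition_mem : ∀ h, ∀ᵐ x ∂(g h), ∀ s a, x.2 s a ∈ stdSimplex ℝ S
  transition_bounds : ∀ h, ∀ᵐ x ∂(g h), ∀ s a s',
    x.2 s a s' ∈ Set.Icc (Tl * M.P h s a s') (Tu * M.P h s a s')
  reward_mean : ∀ h s a, ∫ x, x.1 s a ∂(g h) = M.r h s a
  transition_mean : ∀ h s a s', ∫ x, x.2 s a s' ∂(g h) = M.P h s a s'

/-- The rewards and transitions of the `L` sources. -/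
abbrev Sources (L H : ℕ) (S A : Type*) := Fin L → Fin H → StepModel S A

/-- The transitions of source `l`. -/
def Sources.transition {L : ℕ} (θ : Sources L H S A) (l : Fin L) : Transition H S A :=
  fun h => (θ l h).2

/-- The rewards of source `l`. -/
def Sources.reward {L : ℕ} (θ : Sources L H S A) (l : Fin L) : Reward H S A :=
  fun h => (θ l h).1

/-- The law of the sources: independent over `(l, h)`, with law `g h` at `(l, h)`. -/
def sourceLaw (L : ℕ) (g : Fin H → Measure (StepModel S A)) : Measure (Sources L H S A) :=
  Measure.pi fun _ : Fin L => Measure.pi fun h : Fin H => g h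

/-! ## Datasets and their two-fold subsampling -/

/-- `K` trajectories from each of the `L` sources. -/
abbrev Dataset (L K H : ℕ) (S A : Type*) := Fin L → Fin K → Trajectory H S A

/-- The probability of a dataset, given the sources: all trajectories are independent, and
source `l` is sampled with initial distribution `ξs l` and behavior policy `ρ l`. -/
def datasetProb {L K : ℕ} (ξs : Fin L → S → ℝ) (ρ : Fin L → Policy H S A)
    (θ : Sources L H S A) (D : Dataset L K H S A) : ℝ :=
  ∏ l, ∏ k, trajProb (ξs l) (ρ l) (θ.transition l) (D l k)

/-- The trajectories of source `l` in the first (main) half that visit `s` at step `h`. -/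
def mainVisits {L K : ℕ} (D : Dataset L K H S A) (l : Fin L) (h : Fin H) (s : S) :
    Finset (Fin K) :=
  {k | (k : ℕ) < K / 2 ∧ (D l k).1 h.castSucc = s}

/-- The trajectories of source `l` in the second (auxiliary) half that visit `s` at step `h`. -/
def auxVisits {L K : ℕ} (D : Dataset L K H S A) (l : Fin L) (h : Fin H) (s : S) :
    Finset (Fin K) :=
  {k | ¬ (k : ℕ) < K / 2 ∧ (D l k).1 h.castSucc = s}

/-- The number of transitions out of `s` at step `h` that are kept for source `l`: the minimum
of the main count `N` and of `max (n - 10 √(n log (H S L / δ))) 0`, rounded down, where `n` is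
the auxiliary count. -/
def trimCount {L K : ℕ} (δ : ℝ) (D : Dataset L K H S A) (l : Fin L) (h : Fin H) (s : S) : ℕ :=
  min ⌊((auxVisits D l h s).card : ℝ) - 10 * √(((auxVisits D l h s).card : ℝ) *
      Real.log ((H : ℝ) * Fintype.card S * L / δ))⌋₊
    (mainVisits D l h s).card

/-- A selection of the trajectories whose transitions out of `s` at step `h` are kept, for each
source `l`. -/
abbrev Selection (L K H : ℕ) (S : Type*) := Fin L → Fin H → S → Finset (Fin K)

/-- The probability of a selection, given the dataset: independently over `(l, h, s)`, a subset
of `mainVisits D l h s` of size `trimCount δ D l h s` is drawn uniformly. -/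
def selectionProb {L K : ℕ} (δ : ℝ) (D : Dataset L K H S A) (B : Selection L K H S) : ℝ :=
  ∏ l, ∏ h, ∏ s,
    if B l h s ∈ (mainVisits D l h s).powersetCard (trimCount δ D l h s) then
      (((mainVisits D l h s).card.choose (trimCount δ D l h s) : ℕ) : ℝ)⁻¹
    else 0

/-- The outcome of data collection and subsampling: the dataset and the selection. -/
def Sample (L K H : ℕ) (S A : Type*) := Dataset L K H S A × Selection L K H S

instance {L K : ℕ} : Fintype (Sample L K H S A) :=
  inferInstanceAs (Fintype (Dataset L K H S A × Selection L K H S))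

instance {L K : ℕ} : MeasurableSpace (Sample L K H S A) := ⊤

/-- The joint law of the sources, the dataset and the selection: the sources have law
`sourceLaw L g`, and given the sources the sample has the probability
`datasetProb * selectionProb`. -/
def experimentLaw {L : ℕ} (K : ℕ) (δ : ℝ) (g : Fin H → Measure (StepModel S A))
    (ξs : Fin L → S → ℝ) (ρ : Fin L → Policy H S A) :
    Measure (Sources L H S A × Sample L K H S A) :=
  ∑ x : Sample L K H S A,
    ((sourceLaw L g).withDensity fun θ =>
      ENNReal.ofReal (datasetProb ξs ρ θ x.1 * selectionProb δ x.1 x.2)).map fun θ => (θ, x)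

/-! ## The algorithm HetPEVI-Robust -/

/-- `N_{h,l}(s, a)`: visits of `(s, a)` at step `h` in the subsampled data of source `l`. -/
def count {L K : ℕ} (x : Sample L K H S A) (l : Fin L) (h : Fin H) (s : S) (a : A) : ℕ :=
  ((x.2 l h s).filter fun k => (x.1 l k).2 h = a).card

/-- `N_{h,l}(s, a, s')`: visits of `(s, a, s')` at step `h` in the subsampled data of source
`l`. -/
def countNext {L K : ℕ} (x : Sample L K H S A) (l : Fin L) (h : Fin H) (s : S) (a : A)
    (s' : S) : ℕ :=
  ((x.2 l h s).filter fun k => (x.1 l k).2 h = a ∧ (x.1 l k).1 h.succ = s').card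

/-- The sources with at least one visit of `(s, a)` at step `h` in the subsampled data. -/
def seenSources {L K : ℕ} (x : Sample L K H S A) (h : Fin H) (s : S) (a : A) :
    Finset (Fin L) :=
  {l | 0 < count x l h s a}

/-- The aggregated reward estimate. Rewards are deterministic, so that a visit of `(s, a)` at
step `h` in source `l` reveals `θ.reward l h s a`; only the rewards of such sources are used. -/
def rewardEst {L K : ℕ} (θ : Sources L H S A) (x : Sample L K H S A)
    (h : Fin H) (s : S) (a : A) : ℝ :=
  (∑ l ∈ seenSources x h s a, θ.reward l h s a) / max ((seenSources x h s a).card : ℝ) 1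

/-- The aggregated transition estimate: the average of the empirical transitions. -/
def transitionEst {L K : ℕ} (x : Sample L K H S A) : Transition H S A := fun h s a s' =>
  (∑ l ∈ seenSources x h s a, (countNext x l h s a s' : ℝ) / (count x l h s a : ℝ)) /
    max ((seenSources x h s a).card : ℝ) 1

/-- The smallest positive entry of a vector. -/
def minPos (p : S → ℝ) : ℝ := sInf {x | ∃ s, 0 < p s ∧ x = p s}

/-- The penalty. A tuple without any visit has the largest penalty, `H` (the other argument of
the minimum is infinite there). -/
def penalty {L K : ℕ} (c σ δ : ℝ) (x : Sample L K H S A) (h : Fin H) (s : S) (a : A) : ℝ :=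
  if seenSources x h s a = ∅ then (H : ℝ) else
    min (H : ℝ)
      (c / (σ * minPos (transitionEst x h s a)) *
          √(∑ l ∈ seenSources x h s a,
            (H : ℝ) ^ 2 * Real.log ((Fintype.card S : ℝ) * Fintype.card A * H / δ) /
              (((seenSources x h s a).card : ℝ) ^ 2 * (count x l h s a : ℝ)))
        + c / (σ * minPos (transitionEst x h s a)) *
          √((H : ℝ) ^ 2 * Real.log ((Fintype.card S : ℝ) * Fintype.card A * H / δ) /
            ((seenSources x h s a).card : ℝ))
        + c * √(Real.log ((Fintype.card S : ℝ) * Fintype.card A * H / δ) /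
            ((seenSources x h s a).card : ℝ)))

/-- The worst-case expectation of `V` over the KL ball around `p`. For the zero vector `p` of a
tuple without any visit the ball is empty and the value is `0`. -/
def worstCaseExp (σ : ℝ) (p V : S → ℝ) : ℝ :=
  sInf {v | ∃ q ∈ klBall σ p, v = ∑ s', q s' * V s'}

/-- One step of the pessimistic robust value iteration: the estimated `Q`-function at step `h`
from the estimated value function `V` of the next step. A tuple without any visit gets `0`, as
there the reward estimate and the worst-case expectation are `0` and the penalty is `H`. -/
def qStep {L K : ℕ} (c σ δ : ℝ) (θ : Sources L H S A) (x : Sample L K H S A) (V : S → ℝ)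
    (h : Fin H) (s : S) (a : A) : ℝ :=
  max (rewardEst θ x h s a + worstCaseExp σ (transitionEst x h s a) V - penalty c σ δ x h s a) 0

/-- The estimated value functions, by backward iteration from `0` after the last step. -/
def valueEst {L K : ℕ} (c σ δ : ℝ) (θ : Sources L H S A) (x : Sample L K H S A)
    (h : ℕ) (s : S) : ℝ :=
  if hh : h < H then ⨆ a, qStep c σ δ θ x (valueEst c σ δ θ x (h + 1)) ⟨h, hh⟩ s a else 0
termination_by H - h

/-- `π` is an output of HetPEVI-Robust: it is greedy for the estimated `Q`-functions, with ties
broken in any way. -/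
def IsOutput {L K : ℕ} (c σ δ : ℝ) (θ : Sources L H S A) (x : Sample L K H S A)
    (π : DetPolicy H S A) : Prop :=
  ∀ (h : Fin H) (s : S) (a : A),
    qStep c σ δ θ x (valueEst c σ δ θ x (h + 1)) h s a ≤
      qStep c σ δ θ x (valueEst c σ δ θ x (h + 1)) h s (π h s)

/-! ## Coverage quantities -/

/-- The sources whose behavior policy visits `(s, a)` at step `h` with positive probability. -/
def coveringSources {L : ℕ} (ξs : Fin L → S → ℝ) (ρ : Fin L → Policy H S A)
    (θ : Sources L H S A) (h : Fin H) (s : S) (a : A) : Finset (Fin L) :=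
  {l | 0 < occupancy (ξs l) (ρ l) (θ.transition l) h s a}

/-- The minimal number of covering sources over the tuples that the optimal policy visits in
some MDP of the uncertainty set. -/
def Ldagger {L : ℕ} (M : EpisodicMDP H S A) (σ : ℝ) (ξ : S → ℝ) (πstar : DetPolicy H S A)
    (ξs : Fin L → S → ℝ) (ρ : Fin L → Policy H S A) (θ : Sources L H S A) : ℕ :=
  sInf {n | ∃ h s a, (∃ P' ∈ uncertaintySet σ M.P, 0 < occupancy ξ πstar.toPolicy P' h s a) ∧
    n = (coveringSources ξs ρ θ h s a).card}

/-- The collective robust coverage parameter. -/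
def Cdagger {L : ℕ} (M : EpisodicMDP H S A) (σ : ℝ) (ξ : S → ℝ) (πstar : DetPolicy H S A)
    (ξs : Fin L → S → ℝ) (ρ : Fin L → Policy H S A) (θ : Sources L H S A) : ℝ :=
  sSup {x | ∃ h s a, ∃ P' ∈ uncertaintySet σ M.P,
    x = ∑ l ∈ coveringSources ξs ρ θ h s a,
      min (occupancy ξ πstar.toPolicy P' h s a) (1 / (Fintype.card S : ℝ)) /
        (((coveringSources ξs ρ θ h s a).card : ℝ) *
          occupancy (ξs l) (ρ l) (θ.transition l) h s a)}

/-- The minimal positive number of covering sources. -/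
def Lmin {L : ℕ} (ξs : Fin L → S → ℝ) (ρ : Fin L → Policy H S A) (θ : Sources L H S A) : ℕ :=
  sInf {n | 0 < n ∧ ∃ h s a, n = (coveringSources ξs ρ θ h s a).card}

/-- The minimal positive occupancy over all sources and tuples. -/
def dmin {L : ℕ} (ξs : Fin L → S → ℝ) (ρ : Fin L → Policy H S A) (θ : Sources L H S A) : ℝ :=
  sInf {x | 0 < x ∧ ∃ l h s a, x = occupancy (ξs l) (ρ l) (θ.transition l) h s a}

/-- The minimal positive nominal transition probability over the tuples that the optimal policy
visits in the nominal MDP. -/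
def Pminstar (M : EpisodicMDP H S A) (ξ : S → ℝ) (πstar : DetPolicy H S A) : ℝ :=
  sInf {x | 0 < x ∧ ∃ h s a s', 0 < occupancy ξ πstar.toPolicy M.P h s a ∧ x = M.P h s a s'}

/-- The minimal positive nominal transition probability over the tuples that some source
visits. -/
def Pminsigma {L : ℕ} (M : EpisodicMDP H S A) (ξs : Fin L → S → ℝ) (ρ : Fin L → Policy H S A)
    (θ : Sources L H S A) : ℝ :=
  sInf {x | 0 < x ∧ ∃ h s a s',
    (∃ l, 0 < occupancy (ξs l) (ρ l) (θ.transition l) h s a) ∧ x = M.P h s a s'}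

/-- The logarithmic factor `log (K H S A L / δ)`. -/
def logFactor (S A : Type*) [Fintype S] [Fintype A] (H L K : ℕ) (δ : ℝ) : ℝ :=
  Real.log ((K : ℝ) * H * Fintype.card S * Fintype.card A * L / δ)

/-- The burn-in conditions on `K` and on the minimal number of covering sources. -/
def BurnIn {L : ℕ} (c₁ δ : ℝ) (K : ℕ) (M : EpisodicMDP H S A) (ξs : Fin L → S → ℝ)
    (ρ : Fin L → Policy H S A) (θ : Sources L H S A) : Prop :=
  c₁ / (dmin ξs ρ θ * Pminsigma M ξs ρ θ ^ 2) * logFactor S A H L K δ ≤ (K : ℝ) ∧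
  c₁ / Pminsigma M ξs ρ θ ^ 2 * logFactor S A H L K δ ≤ (Lmin ξs ρ θ : ℝ)

/-- The rate of the performance bound, without its logarithmic factors. -/
def rate {L : ℕ} (K : ℕ) (M : EpisodicMDP H S A) (σ : ℝ) (ξ : S → ℝ) (πstar : DetPolicy H S A)
    (ξs : Fin L → S → ℝ) (ρ : Fin L → Policy H S A) (θ : Sources L H S A) : ℝ :=
  √(Cdagger M σ ξ πstar ξs ρ θ * (H : ℝ) ^ 4 * Fintype.card S) /
      (σ * Pminstar M ξ πstar * √((Ldagger M σ ξ πstar ξs ρ θ : ℝ) * K)) +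
    ((H : ℝ) + (H : ℝ) ^ 2 / (σ * Pminstar M ξ πstar)) /
      √(Ldagger M σ ξ πstar ξs ρ θ : ℝ)

end Model

end RobustRL

end

set_option linter.unusedSectionVars false

namespace RobustRL

/-! ### Kullback-Leibler balls and worst-case expectations over them. -/

section KL

variable {S : Type*} [Fintype S]

/-! A deterministic argument on good outcomes is combined with a union bound for the others.

Pessimism. Suppose that at every tuple in the data the empirical robust backup differs from the
nominal one by at most the bonus. Subtracting the penalty makes the estimated values a subsolution
of the robust Bellman equation of the output, hence a lower bound on its robust values
(`le_robustValue`). Along the comparator they fall short of a solution by at most twice the bonus.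
As the uncertainty set is a product, worst-case kernels for the estimated values form a single model
`P'`, and telescoping in it bounds the gap by the bonuses averaged over the visits of the comparator
under `P'` (`exists_robustGap_le_bonus`).

Backups. A likelihood ratio of at most `1 + ε` between two centers raises divergences by at most
`ε`, and by convexity mixing in the new center with weight at most `ε / σ` restores the radius
(`worstCaseExp_le_add`). An entrywise error `e` is a relative error of order `e / minPos`, which
explains the factor `1 / (σ * minPos)` of the penalty. Burn-in makes these errors small and the
counts proportional to the occupancies (`IsTypical.isAccurate`).

Rate. The sampling part of the bonus is controlled by the clipped coverage parameter
(`mul_sqrt_le_of_min_mul_le`); summation over the states then costs `√S` (`sum_sqrt_add_le`).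

Probability. All tails come from exponential moments and Markov's inequality. Given the states and
the kept sets at one step, the actions and then the next states are independent draws, so
data-dependent scales can be treated as constants. The states at step `h` involve only the models of
earlier steps, and the actions come from fixed behavior policies; hence the random set of seen
sources is independent of the models of step `h`, whose average over this set concentrates
(`experimentLaw_sourceDev_le`). -/

theorem kl_term_eq (x y : ℝ) :
    x * Real.log (x / y) = y * ((x / y) * Real.log (x / y)) := by
  rcases eq_or_ne y 0 with rfl | hy
  · simp
  · field_simp

/-- In the form of `kl_term_eq` each summand is a constant times `x log x` at the ratio, and this
function is continuous at `0` too. -/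
theorem continuous_kl (p : S → ℝ) :
    Continuous fun q : S → ℝ => ∑ s, q s * Real.log (q s / p s) := by
  refine continuous_finsetSum _ fun s _ => ?_
  simp_rw [kl_term_eq]
  have h : Continuous fun q : S → ℝ => q s / p s := by fun_prop
  exact continuous_const.mul (Real.continuous_mul_log.comp h)

/-- Compactness provides minimizers, which later form a worst-case model. The support condition is a
closed condition of its own: with `log 0 = 0` the divergence bound alone does not force `q` to
vanish where `p` does. -/
theorem isCompact_klBall [DecidableEq S] (σ : ℝ) (p : S → ℝ) : IsCompact (klBall σ p) := by
  have h : klBall σ p = stdSimplex ℝ S ∩ ((⋂ s, {q : S → ℝ | p s = 0 → q s = 0}) ∩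
      {q | ∑ s, q s * Real.log (q s / p s) ≤ σ}) := by
    ext q
    simp only [klBall, Set.mem_inter_iff, Set.mem_iInter, Set.mem_ofPred_eq]
  rw [h]
  refine (isCompact_stdSimplex ℝ S).inter_right (IsClosed.inter ?_ ?_)
  · refine isClosed_iInter fun s => ?_
    by_cases hs : p s = 0
    · simpa [hs] using isClosed_eq (continuous_apply s) continuous_const
    · simp [hs]
  · exact isClosed_le (continuous_kl p) continuous_const

theorem self_mem_klBall {σ : ℝ} (hσ : 0 ≤ σ) {p : S → ℝ} (hp : p ∈ stdSimplex ℝ S) :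
    p ∈ klBall σ p := by
  refine ⟨hp, fun _ h => h, ?_⟩
  refine le_trans (le_of_eq (Finset.sum_eq_zero fun s _ => ?_)) hσ
  rcases eq_or_ne (p s) 0 with h | h <;> simp [h]

theorem sum_mul_nonneg_of_stdSimplex {q V : S → ℝ} (hq : q ∈ stdSimplex ℝ S)
    (hV : ∀ s, 0 ≤ V s) : 0 ≤ ∑ s, q s * V s :=
  Finset.sum_nonneg fun s _ => mul_nonneg (hq.1 s) (hV s)

theorem sum_mul_le_of_stdSimplex {q V : S → ℝ} {B : ℝ} (hq : q ∈ stdSimplex ℝ S)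
    (hV : ∀ s, V s ≤ B) : ∑ s, q s * V s ≤ B := by
  calc ∑ s, q s * V s ≤ ∑ s, q s * B :=
        Finset.sum_le_sum fun s _ => mul_le_mul_of_nonneg_left (hV s) (hq.1 s)
    _ = B := by rw [← Finset.sum_mul, hq.2, one_mul]

theorem worstCaseExp_le {σ : ℝ} {p V q : S → ℝ} (hV : ∀ s, 0 ≤ V s) (hq : q ∈ klBall σ p) :
    worstCaseExp σ p V ≤ ∑ s, q s * V s := by
  refine csInf_le ⟨0, ?_⟩ ⟨q, hq, rfl⟩
  rintro _ ⟨q', hq', rfl⟩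
  exact sum_mul_nonneg_of_stdSimplex hq'.1 hV

theorem exists_worstCaseExp_eq [DecidableEq S] {σ : ℝ} (hσ : 0 ≤ σ) {p : S → ℝ}
    (hp : p ∈ stdSimplex ℝ S) {V : S → ℝ} (hV : ∀ s, 0 ≤ V s) :
    ∃ q ∈ klBall σ p, worstCaseExp σ p V = ∑ s, q s * V s := by
  obtain ⟨q, hq, hmin⟩ := (isCompact_klBall σ p).exists_isMinOn ⟨p, self_mem_klBall hσ hp⟩
    (f := fun q => ∑ s, q s * V s) (by fun_prop)
  refine ⟨q, hq, le_antisymm (worstCaseExp_le hV hq) (le_csInf ⟨_, q, hq, rfl⟩ ?_)⟩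
  rintro _ ⟨q', hq', rfl⟩
  exact hmin hq'

/-- The divergence to a reference point that dominates another one up to a factor. -/
theorem kl_le_add_of_le {ε : ℝ} {p p' q : S → ℝ} (hp : ∀ s, 0 ≤ p s)
    (hp' : ∀ s, 0 ≤ p' s) (hq : q ∈ stdSimplex ℝ S) (hac : ∀ s, p s = 0 → q s = 0)
    (h : ∀ s, p s ≤ (1 + ε) * p' s) :
    ∑ s, q s * Real.log (q s / p' s) ≤ (∑ s, q s * Real.log (q s / p s)) + ε := by
  have hterm : ∀ s, q s * Real.log (q s / p' s) ≤ q s * Real.log (q s / p s) + q s * ε := by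
    intro s
    rcases (hq.1 s).eq_or_lt with h0 | h0
    · simp [← h0]
    have hps : 0 < p s := (hp s).lt_of_ne' fun h1 => h0.ne' (hac s h1)
    have hps' : 0 < p' s := by
      refine (hp' s).lt_of_ne' fun h1 => ?_
      have := h s
      rw [h1] at this
      linarith
    have hlog : Real.log (q s / p' s) = Real.log (q s / p s) + Real.log (p s / p' s) := by
      rw [← Real.log_mul (by positivity) (by positivity)]
      congr 1
      field_simp
    -- Only this log-ratio is added when the center changes, and `log y ≤ y - 1`.
    have hle : Real.log (p s / p' s) ≤ ε := by
      refine (Real.log_le_sub_one_of_pos (by positivity)).trans ?_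
      have : p s / p' s ≤ 1 + ε := (div_le_iff₀ hps').2 (h s)
      linarith
    rw [hlog, mul_add]
    gcongr
  calc _ ≤ ∑ s, (q s * Real.log (q s / p s) + q s * ε) := Finset.sum_le_sum fun s _ => hterm s
    _ = _ := by rw [Finset.sum_add_distrib, ← Finset.sum_mul, hq.2, one_mul]

/-- Convexity of `x log x`, which vanishes at `1`: the divergence is convex in its first argument
and `p` has divergence `0` from itself. -/
theorem kl_mix_le {t : ℝ} (ht0 : 0 ≤ t) (ht1 : t ≤ 1) {p q : S → ℝ} (hp : ∀ s, 0 ≤ p s)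
    (hq : ∀ s, 0 ≤ q s) :
    ∑ s, ((1 - t) * q s + t * p s) * Real.log (((1 - t) * q s + t * p s) / p s) ≤
      (1 - t) * ∑ s, q s * Real.log (q s / p s) := by
  rw [Finset.mul_sum]
  refine Finset.sum_le_sum fun s _ => ?_
  rw [kl_term_eq, kl_term_eq (q s)]
  rcases (hp s).eq_or_lt with h0 | h0
  · simp [← h0]
  have hc := Real.convexOn_mul_log.2 (x := q s / p s) (y := 1)
    (Set.mem_Ici.2 (div_nonneg (hq s) (hp s))) (Set.mem_Ici.2 zero_le_one)
    (sub_nonneg.2 ht1) ht0 (by ring)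
  have he : ((1 - t) * q s + t * p s) / p s = (1 - t) * (q s / p s) + t * 1 := by
    field_simp
  simp only [smul_eq_mul, Real.log_one, mul_zero, add_zero] at hc
  rw [he, mul_left_comm (1 - t) (p s)]
  exact mul_le_mul_of_nonneg_left hc h0.le

/-- Worst-case expectations over KL balls with nearby centers. -/
theorem worstCaseExp_le_add {σ ε B : ℝ} (hσ : 0 < σ) (hε : 0 ≤ ε) {p p' V : S → ℝ}
    (hp : p ∈ stdSimplex ℝ S) (hp' : p' ∈ stdSimplex ℝ S)
    (h : ∀ s, p s ≤ (1 + ε) * p' s) (hV0 : ∀ s, 0 ≤ V s) (hVB : ∀ s, V s ≤ B) :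
    worstCaseExp σ p' V ≤ worstCaseExp σ p V + B * ε / σ := by
  rw [← sub_le_iff_le_add]
  refine le_csInf ⟨_, p, self_mem_klBall hσ.le hp, rfl⟩ ?_
  rintro _ ⟨q, hq, rfl⟩
  rw [sub_le_iff_le_add]
  have hσε : 0 < σ + ε := by positivity
  -- Relative to the center `p'` the divergence of `q` is at most `σ + ε`; this weight of `p'`
  -- solves `(1 - t) * (σ + ε) = σ`.
  set t : ℝ := ε / (σ + ε) with ht
  have ht0 : 0 ≤ t := by positivity
  have ht1 : t ≤ 1 := (div_le_one hσε).2 (by linarith)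
  have htσ : t ≤ ε / σ := div_le_div_of_nonneg_left hε hσ (by linarith)
  have hmem : (fun s => (1 - t) * q s + t * p' s) ∈ klBall σ p' := by
    refine ⟨?_, ?_, ?_⟩
    · exact convex_stdSimplex ℝ S hq.1 hp' (sub_nonneg.2 ht1) ht0 (by ring)
    -- The one-sided bound `h` also transports supports: `p' s = 0` forces `p s = 0`, hence `q s =
    -- 0`.
    · intro s hs
      have h1 := h s
      rw [hs, mul_zero] at h1
      have h2 := hq.2.1 s (le_antisymm h1 (hp.1 s))
      simp [hs, h2]
    · refine (kl_mix_le ht0 ht1 hp'.1 hq.1.1).trans ?_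
      have h1 := (kl_le_add_of_le hp.1 hp'.1 hq.1 hq.2.1 h).trans
        (add_le_add_left hq.2.2 ε)
      calc _ ≤ (1 - t) * (σ + ε) := mul_le_mul_of_nonneg_left h1 (sub_nonneg.2 ht1)
        _ = σ := by rw [ht]; field_simp; ring
  refine (worstCaseExp_le hV0 hmem).trans ?_
  have hsplit : ∑ s, ((1 - t) * q s + t * p' s) * V s =
      (1 - t) * ∑ s, q s * V s + t * ∑ s, p' s * V s := by
    rw [Finset.mul_sum, Finset.mul_sum, ← Finset.sum_add_distrib]
    exact Finset.sum_congr rfl fun s _ => by ring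
  rw [hsplit]
  have h1 := sum_mul_nonneg_of_stdSimplex hq.1 hV0
  have h2 := sum_mul_le_of_stdSimplex hp' hVB
  have h3 := sum_mul_nonneg_of_stdSimplex hp' hV0
  have hB : 0 ≤ B := h3.trans h2
  have h4 : t * ∑ s, p' s * V s ≤ ε / σ * B := mul_le_mul htσ h2 h3 (by positivity)
  have h5 : B * ε / σ = ε / σ * B := by ring
  nlinarith [mul_nonneg ht0 h1]

theorem worstCaseExp_nonneg {σ : ℝ} {p V : S → ℝ} (hV : ∀ s, 0 ≤ V s) :
    0 ≤ worstCaseExp σ p V := by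
  refine Real.sInf_nonneg ?_
  rintro _ ⟨q, hq, rfl⟩
  exact sum_mul_nonneg_of_stdSimplex hq.1 hV

theorem worstCaseExp_le_of_le {σ B : ℝ} (hσ : 0 ≤ σ) {p V : S → ℝ}
    (hp : p ∈ stdSimplex ℝ S) (hV : ∀ s, 0 ≤ V s) (hB : ∀ s, V s ≤ B) :
    worstCaseExp σ p V ≤ B :=
  (worstCaseExp_le hV (self_mem_klBall hσ hp)).trans (sum_mul_le_of_stdSimplex hp hB)

/-- The infimum runs over a finite set, nonempty because the entries sum to one, so it is attained.
-/
theorem exists_minPos_eq {p : S → ℝ} (hp : p ∈ stdSimplex ℝ S) :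
    ∃ s, 0 < p s ∧ minPos p = p s := by
  have hne : {x | ∃ s, 0 < p s ∧ x = p s}.Nonempty := by
    by_contra hcon
    have h0 : ∀ s, p s = 0 := fun s =>
      le_antisymm (not_lt.1 fun hs => hcon ⟨p s, s, hs, rfl⟩) (hp.1 s)
    have := hp.2
    simp [h0] at this
  have hfin : {x | ∃ s, 0 < p s ∧ x = p s}.Finite :=
    (Set.finite_range p).subset (by rintro _ ⟨s, -, rfl⟩; exact ⟨s, rfl⟩)
  exact hne.csInf_mem hfin

end KL

theorem minPos_le {S : Type*} {p : S → ℝ} {s : S} (hs : 0 < p s) : minPos p ≤ p s :=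
  csInf_le ⟨0, by rintro _ ⟨s, h, rfl⟩; exact h.le⟩ ⟨s, hs, rfl⟩

/-! ### Trajectory probabilities and state distributions. -/

section Trajectories

variable {H : ℕ} {S A : Type*} [Fintype A]

/-- The policy of the steps after the first one. -/
def Policy.tail (π : Policy (H + 1) S A) : Policy H S A where
  prob h := π.prob h.succ
  prob_mem h := π.prob_mem h.succ

/-- Removing the first step turns its probability into an initial weight of the rest. This weight is
not normalized, so the inductions over the horizon allow arbitrary `ξ`. -/
theorem trajProb_cons (ξ : S → ℝ) (π : Policy (H + 1) S A) (P : Transition (H + 1) S A)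
    (s : S) (a : A) (τ : Trajectory H S A) :
    trajProb ξ π P (Fin.cons s τ.1, Fin.cons a τ.2) =
      trajProb (fun s' => ξ s * π.prob 0 s a * P 0 s a s') π.tail (fun h => P h.succ) τ := by
  simp only [trajProb, Fin.prod_univ_succ (n := H), Policy.tail, Fin.castSucc_zero,
    Fin.cons_zero, Fin.cons_succ, ← Fin.succ_castSucc]
  ring

/-- Trajectories of positive probability only make transitions of positive probability. -/
theorem transition_pos_of_trajProb_pos {ξ : S → ℝ} {π : Policy H S A} {P : Transition H S A}
    (hP : ∀ h s a s', 0 ≤ P h s a s') {τ : Trajectory H S A} (hτ : 0 < trajProb ξ π P τ)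
    (h : Fin H) : 0 < P h (τ.1 h.castSucc) (τ.2 h) (τ.1 h.succ) := by
  refine (hP _ _ _ _).lt_of_ne' fun h0 => hτ.ne' ?_
  rw [trajProb, Finset.prod_eq_zero (Finset.mem_univ h) (by rw [h0, mul_zero]), mul_zero]

theorem trajProb_nonneg {ξ : S → ℝ} (hξ : ∀ s, 0 ≤ ξ s) (π : Policy H S A)
    {P : Transition H S A} (hP : ∀ h s a s', 0 ≤ P h s a s') (τ : Trajectory H S A) :
    0 ≤ trajProb ξ π P τ :=
  mul_nonneg (hξ _) (Finset.prod_nonneg fun _ _ => mul_nonneg ((π.prob_mem _ _).1 _) (hP _ _ _ _))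

variable [Fintype S]

/-- The distribution of the state at step `n`. It only involves the transitions of the earlier
steps. -/
noncomputable def stateDist (ξ : S → ℝ) (π : Policy H S A) (P : Transition H S A) : ℕ → S → ℝ
  | 0 => ξ
  | n + 1 => fun s' => if hn : n < H then
      ∑ s, ∑ a, stateDist ξ π P n s * π.prob ⟨n, hn⟩ s a * P ⟨n, hn⟩ s a s' else 0

theorem stateDist_succ (ξ : S → ℝ) (π : Policy H S A) (P : Transition H S A) (n : ℕ) (s' : S) :
    stateDist ξ π P (n + 1) s' = if hn : n < H then
      ∑ s, ∑ a, stateDist ξ π P n s * π.prob ⟨n, hn⟩ s a * P ⟨n, hn⟩ s a s' else 0 :=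
  rfl

theorem stateDist_succ_tail (ξ : S → ℝ) (π : Policy (H + 1) S A) (P : Transition (H + 1) S A)
    (n : ℕ) :
    stateDist ξ π P (n + 1) =
      stateDist (stateDist ξ π P 1) π.tail (fun h => P h.succ) n := by
  induction n with
  | zero => rfl
  | succ n ih =>
    funext s'
    rw [stateDist_succ _ _ _ (n + 1), stateDist_succ _ _ _ n, ih]
    by_cases hn : n < H
    · simp [hn, Policy.tail]
    · simp [hn]

/-- The origin of independence later on: redrawing the model of step `h` leaves the law of the
states at step `h` unchanged. -/
theorem stateDist_congr (ξ : S → ℝ) (π : Policy H S A) {P P' : Transition H S A} {n : ℕ}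
    (h : ∀ i : Fin H, (i : ℕ) < n → P i = P' i) : stateDist ξ π P n = stateDist ξ π P' n := by
  induction n with
  | zero => rfl
  | succ n ih =>
    funext s'
    rw [stateDist_succ, stateDist_succ, ih fun i hi => h i (hi.trans n.lt_succ_self)]
    by_cases hn : n < H
    · simp [hn, h ⟨n, hn⟩ n.lt_succ_self]
    · simp [hn]

theorem stateDist_nonneg {ξ : S → ℝ} (hξ : ∀ s, 0 ≤ ξ s) (π : Policy H S A)
    {P : Transition H S A} (hP : ∀ h s a s', 0 ≤ P h s a s') (n : ℕ) (s : S) :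
    0 ≤ stateDist ξ π P n s := by
  induction n generalizing s with
  | zero => exact hξ s
  | succ n ih =>
    rw [stateDist]
    split_ifs with hn
    · exact Finset.sum_nonneg fun s _ => Finset.sum_nonneg fun a _ =>
        mul_nonneg (mul_nonneg (ih s) ((π.prob_mem _ s).1 a)) (hP _ _ _ _)
    · rfl

theorem sum_stateDist_succ_mul (ξ : S → ℝ) (π : Policy H S A) (P : Transition H S A) {n : ℕ}
    (hn : n < H) (f : S → ℝ) :
    ∑ s', stateDist ξ π P (n + 1) s' * f s' =
      ∑ s, stateDist ξ π P n s *
        ∑ a, π.prob ⟨n, hn⟩ s a * ∑ s', P ⟨n, hn⟩ s a s' * f s' := by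
  simp only [stateDist, hn, dif_pos, Finset.sum_mul, Finset.mul_sum]
  rw [Finset.sum_comm]
  refine Finset.sum_congr rfl fun s _ => ?_
  rw [Finset.sum_comm]
  exact Finset.sum_congr rfl fun a _ => Finset.sum_congr rfl fun s' _ => by ring

theorem sum_stateDist {ξ : S → ℝ} (hξ : ξ ∈ stdSimplex ℝ S) (π : Policy H S A)
    {P : Transition H S A} (hP : ∀ h s a, P h s a ∈ stdSimplex ℝ S) {n : ℕ} (hn : n ≤ H) :
    ∑ s, stateDist ξ π P n s = 1 := by
  induction n with
  | zero => exact hξ.2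
  | succ n ih =>
    have h := sum_stateDist_succ_mul ξ π P (Nat.lt_of_succ_le hn) fun _ => 1
    simp only [mul_one, (hP _ _ _).2, (π.prob_mem _ _).2] at h
    rw [h, ih (Nat.le_of_succ_le hn)]

theorem stateDist_mem {ξ : S → ℝ} (hξ : ξ ∈ stdSimplex ℝ S) (π : Policy H S A)
    {P : Transition H S A} (hP : ∀ h s a, P h s a ∈ stdSimplex ℝ S) {n : ℕ} (hn : n ≤ H) :
    stateDist ξ π P n ∈ stdSimplex ℝ S :=
  ⟨stateDist_nonneg hξ.1 π (fun h s a => (hP h s a).1) n, sum_stateDist hξ π hP hn⟩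

/-- A trajectory of `H + 1` steps splits into its first state, its first action and the rest. -/
def trajectorySuccEquiv : Trajectory (H + 1) S A ≃ (S × A) × Trajectory H S A :=
  ((Fin.consEquiv fun _ : Fin (H + 2) => S).symm.prodCongr
    (Fin.consEquiv fun _ : Fin (H + 1) => A).symm).trans (Equiv.prodProdProdComm _ _ _ _)

theorem sum_trajectory_succ (f : Trajectory (H + 1) S A → ℝ) :
    ∑ τ, f τ = ∑ s : S, ∑ a : A, ∑ τ : Trajectory H S A, f (Fin.cons s τ.1, Fin.cons a τ.2) := by
  rw [← (trajectorySuccEquiv (H := H) (S := S) (A := A)).symm.sum_comp, Fintype.sum_prod_type,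
    Fintype.sum_prod_type]
  rfl

theorem sum_trajProb (ξ : S → ℝ) (π : Policy H S A) {P : Transition H S A}
    (hP : ∀ h s a, P h s a ∈ stdSimplex ℝ S) :
    ∑ τ, trajProb ξ π P τ = ∑ s, ξ s := by
  induction H generalizing ξ with
  | zero =>
    rw [Fintype.sum_prod_type, ← (Equiv.funUnique (Fin 1) S).symm.sum_comp]
    simp [trajProb]
  | succ H ih =>
    rw [sum_trajectory_succ]
    simp only [trajProb_cons]
    simp only [ih _ π.tail fun h s a => hP h.succ s a, ← Finset.mul_sum, (hP _ _ _).2, mul_one,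
      (π.prob_mem _ _).2]

/-- The joint distribution of the state, the action and the next state at step `h`. -/
theorem sum_trajProb_mul (ξ : S → ℝ) (π : Policy H S A) {P : Transition H S A}
    (hP : ∀ h s a, P h s a ∈ stdSimplex ℝ S) (h : Fin H) (f : S → A → S → ℝ) :
    ∑ τ : Trajectory H S A, trajProb ξ π P τ * f (τ.1 h.castSucc) (τ.2 h) (τ.1 h.succ) =
      ∑ s, ∑ a, ∑ s', stateDist ξ π P h s * π.prob h s a * P h s a s' * f s a s' := by
  induction H generalizing ξ with
  | zero => exact h.elim0
  | succ H ih =>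
    rw [sum_trajectory_succ]
    simp only [trajProb_cons]
    have hP' : ∀ (h : Fin H) s a, P h.succ s a ∈ stdSimplex ℝ S := fun h s a => hP h.succ s a
    induction h using Fin.cases with
    | zero =>
      refine Finset.sum_congr rfl fun s _ => Finset.sum_congr rfl fun a _ => ?_
      simp only [Fin.castSucc_zero, Fin.cons_zero, Fin.cons_succ]
      -- The test function is absorbed into the initial weight of the remaining trajectory, whose
      -- total mass is given by `sum_trajProb`.
      refine Eq.trans ?_
        (sum_trajProb (fun s' => ξ s * π.prob 0 s a * P 0 s a s' * f s a s') π.tail hP')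
      refine Finset.sum_congr rfl fun τ _ => ?_
      simp only [trajProb]
      ring
    | succ h =>
      simp only [← Fin.succ_castSucc, Fin.cons_succ, Fin.val_succ]
      -- Summed over the first state and action, the initial weights give the state distribution
      -- after one step, from which the induction hypothesis starts.
      rw [stateDist_succ_tail]
      refine Eq.trans ?_ (ih (stateDist ξ π P 1) π.tail hP' h)
      have hcomm : ∀ F : S → A → Trajectory H S A → ℝ,
          ∑ s, ∑ a, ∑ τ, F s a τ = ∑ τ, ∑ s, ∑ a, F s a τ := fun F => by
        refine (Finset.sum_congr rfl fun s _ => Finset.sum_comm).trans Finset.sum_comm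
      rw [hcomm]
      refine Finset.sum_congr rfl fun τ _ => ?_
      simp only [trajProb, stateDist_succ, Nat.zero_lt_succ, dif_pos, Finset.sum_mul]
      rfl

variable [DecidableEq S] [DecidableEq A]

theorem occupancy_eq (ξ : S → ℝ) (π : Policy H S A) {P : Transition H S A}
    (hP : ∀ h s a, P h s a ∈ stdSimplex ℝ S) (h : Fin H) (s : S) (a : A) :
    occupancy ξ π P h s a = stateDist ξ π P h s * π.prob h s a := by
  have key := sum_trajProb_mul ξ π hP h fun x b _ => if x = s ∧ b = a then 1 else 0
  simp only [mul_ite, mul_one, mul_zero, ite_and] at key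
  simp only [occupancy, ite_and]
  rw [key]
  simp only [Finset.sum_ite_irrel, Finset.sum_const_zero, Finset.sum_ite_eq', Finset.mem_univ,
    if_true, ← Finset.mul_sum, (hP _ _ _).2, mul_one]

theorem occupancy_pos_of_trajProb_pos {ξ : S → ℝ} (hξ : ∀ s, 0 ≤ ξ s) {π : Policy H S A}
    {P : Transition H S A} (hP : ∀ h s a s', 0 ≤ P h s a s') {τ : Trajectory H S A}
    (hτ : 0 < trajProb ξ π P τ) (h : Fin H) :
    0 < occupancy ξ π P h (τ.1 h.castSucc) (τ.2 h) := by
  refine hτ.trans_le ?_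
  have := Finset.single_le_sum (f := fun τ' : Trajectory H S A =>
    if τ'.1 h.castSucc = τ.1 h.castSucc ∧ τ'.2 h = τ.2 h then trajProb ξ π P τ' else 0)
    (fun τ' _ => by
      split_ifs
      exacts [trajProb_nonneg hξ π hP τ', le_rfl]) (Finset.mem_univ τ)
  simpa [occupancy] using this

theorem occupancy_nonneg {ξ : S → ℝ} (hξ : ∀ s, 0 ≤ ξ s) (π : Policy H S A)
    {P : Transition H S A} (hP : ∀ h s a s', 0 ≤ P h s a s') (h : Fin H) (s : S) (a : A) :
    0 ≤ occupancy ξ π P h s a :=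
  Finset.sum_nonneg fun τ _ => by
    split_ifs
    exacts [trajProb_nonneg hξ π hP τ, le_rfl]

end Trajectories

/-! ### Robust values, pessimism and the telescoping bound on the gap. -/

section Values

variable {H : ℕ} {S A : Type*} [Fintype S] [DecidableEq S] [Fintype A] [DecidableEq A]

theorem value_of_le (P : Transition H S A) (r : Reward H S A) (π : Policy H S A) {n : ℕ}
    (hn : H ≤ n) (s : S) : value P r π n s = 0 := by
  rw [value, dif_neg hn.not_gt]

theorem value_toPolicy (P : Transition H S A) (r : Reward H S A) (π : DetPolicy H S A) {n : ℕ}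
    (hn : n < H) (s : S) :
    value P r π.toPolicy n s = r ⟨n, hn⟩ s (π ⟨n, hn⟩ s) +
      ∑ s', P ⟨n, hn⟩ s (π ⟨n, hn⟩ s) s' * value P r π.toPolicy (n + 1) s' := by
  rw [value, dif_pos hn]
  simp [DetPolicy.toPolicy, Pi.single_apply]

theorem value_nonneg {P : Transition H S A} (hP : ∀ h s a, P h s a ∈ stdSimplex ℝ S)
    {r : Reward H S A} (hr : ∀ h s a, 0 ≤ r h s a) (π : Policy H S A) (n : ℕ) (s : S) :
    0 ≤ value P r π n s := by
  induction h : H - n generalizing n s with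
  | zero => rw [value_of_le _ _ _ (Nat.sub_eq_zero_iff_le.1 h)]
  | succ m ih =>
    have hn : n < H := by omega
    rw [value, dif_pos hn]
    exact Finset.sum_nonneg fun a _ => mul_nonneg ((π.prob_mem _ _).1 a)
      (add_nonneg (hr _ _ _) (sum_mul_nonneg_of_stdSimplex (hP _ _ _)
        fun s' => ih (n + 1) s' (by omega)))

theorem mem_uncertaintySet_self {σ : ℝ} (hσ : 0 ≤ σ) (M : EpisodicMDP H S A) :
    M.P ∈ uncertaintySet σ M.P := fun h s a => self_mem_klBall hσ (M.P_mem h s a)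

theorem robustValue_le {M : EpisodicMDP H S A} {σ : ℝ} {P' : Transition H S A}
    (hP' : P' ∈ uncertaintySet σ M.P) (π : Policy H S A) (n : ℕ) (s : S) :
    robustValue M σ π n s ≤ value P' M.r π n s := by
  refine csInf_le ⟨0, ?_⟩ ⟨P', hP', rfl⟩
  rintro _ ⟨P'', hP'', rfl⟩
  exact value_nonneg (fun h s a => (hP'' h s a).1) (fun h s a => (M.r_mem h s a).1) π n s

/-- A subsolution of the robust Bellman equation of a policy is a lower bound on its robust
values. -/
theorem le_robustValue {M : EpisodicMDP H S A} {σ : ℝ} (hσ : 0 ≤ σ) {V : ℕ → S → ℝ}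
    (hV0 : ∀ n s, 0 ≤ V n s) (hVH : ∀ s, V H s = 0) {π : DetPolicy H S A}
    (hV : ∀ (h : Fin H) s, V h s ≤
      M.r h s (π h s) + worstCaseExp σ (M.P h s (π h s)) (V (h + 1)))
    {n : ℕ} (hn : n ≤ H) (s : S) : V n s ≤ robustValue M σ π.toPolicy n s := by
  refine le_csInf ⟨_, M.P, mem_uncertaintySet_self hσ M, rfl⟩ ?_
  rintro _ ⟨P', hP', rfl⟩
  induction hn using Nat.decreasingInduction generalizing s with
  | self => rw [hVH, value_of_le _ _ _ le_rfl]
  | of_succ n hn ih =>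
    rw [value_toPolicy _ _ _ hn]
    refine (hV ⟨n, hn⟩ s).trans (add_le_add_right ?_ _)
    refine (worstCaseExp_le (hV0 _) (hP' ⟨n, hn⟩ s _)).trans ?_
    exact Finset.sum_le_sum fun s' _ =>
      mul_le_mul_of_nonneg_left (ih s') ((hP' ⟨n, hn⟩ s _).1.1 s')

theorem sum_stateDist_toPolicy_succ_mul (ξ : S → ℝ) (π : DetPolicy H S A)
    (P : Transition H S A) {n : ℕ} (hn : n < H) (f : S → ℝ) :
    ∑ s', stateDist ξ π.toPolicy P (n + 1) s' * f s' =
      ∑ s, stateDist ξ π.toPolicy P n s * ∑ s', P ⟨n, hn⟩ s (π ⟨n, hn⟩ s) s' * f s' := by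
  rw [sum_stateDist_succ_mul _ _ _ hn]
  simp [DetPolicy.toPolicy, Pi.single_apply]

/-- If `V` is a supersolution of the robust Bellman equation of `π` up to errors `β`, then, in
some model of the uncertainty set, the values of `π` exceed `V` at most by the accumulated
errors. -/
theorem exists_robustInitialValue_le {M : EpisodicMDP H S A} {σ : ℝ} (hσ : 0 ≤ σ) {ξ : S → ℝ}
    (hξ : ∀ s, 0 ≤ ξ s) {V : ℕ → S → ℝ} (hV0 : ∀ n s, 0 ≤ V n s) {π : DetPolicy H S A}
    {β : Fin H → S → ℝ}
    (hV : ∀ (h : Fin H) s,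
      (∃ P' ∈ uncertaintySet σ M.P, 0 < stateDist ξ π.toPolicy P' h s) →
      M.r h s (π h s) + worstCaseExp σ (M.P h s (π h s)) (V (h + 1)) ≤ V h s + β h s) :
    ∃ P' ∈ uncertaintySet σ M.P, robustInitialValue M σ ξ π.toPolicy ≤
      ∑ s, ξ s * V 0 s + ∑ h : Fin H, ∑ s, stateDist ξ π.toPolicy P' h s * β h s := by
  -- The uncertainty set is a product, so minimizers chosen separately at each tuple form one of its
  -- models. They minimize against `V`, not against the values of `π`, so that they match the
  -- recursion assumed for `V`.
  choose P' hP' hP'eq using fun (h : Fin H) s a =>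
    exists_worstCaseExp_eq hσ (M.P_mem h s a) (hV0 (h + 1))
  have hmem : P' ∈ uncertaintySet σ M.P := hP'
  refine ⟨P', hmem, ?_⟩
  set d := stateDist ξ π.toPolicy P' with hd
  have hd0 : ∀ n s, 0 ≤ d n s :=
    stateDist_nonneg hξ _ fun h s a => (hP' h s a).1.1
  set W : ℕ → S → ℝ := value P' M.r π.toPolicy with hW
  -- Unrolling `n` steps: the difference `W - V` is carried forward by the state distribution, and
  -- each step adds its error. At `n = H` the difference is nonpositive.
  have hmain : ∀ n ≤ H, ∑ s, ξ s * W 0 s ≤ ∑ s, ξ s * V 0 s +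
      (∑ s, d n s * (W n s - V n s) +
        ∑ h ∈ Finset.univ.filter (fun h : Fin H => (h : ℕ) < n), ∑ s, d h s * β h s) := by
    intro n
    induction n with
    | zero =>
      intro _
      have h0 : d 0 = ξ := rfl
      simp [h0, mul_sub]
    | succ n ih =>
      intro hn
      have hn' : n < H := hn
      refine (ih hn'.le).trans (add_le_add_right ?_ _)
      have hfilter : (Finset.univ.filter fun h : Fin H => (h : ℕ) < n + 1) =
          insert ⟨n, hn'⟩ (Finset.univ.filter fun h : Fin H => (h : ℕ) < n) := by
        ext h
        simp only [Finset.mem_filter, Finset.mem_univ, true_and, Finset.mem_insert, Fin.ext_iff]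
        omega
      rw [hfilter, Finset.sum_insert (by simp), ← add_assoc]
      refine add_le_add_left ?_ _
      rw [hd, sum_stateDist_toPolicy_succ_mul _ _ _ hn', ← hd, ← Finset.sum_add_distrib]
      refine Finset.sum_le_sum fun s _ => ?_
      -- The recursion for `V` is only available at states that some model reaches; elsewhere the
      -- weight is `0`.
      rcases (hd0 n s).eq_or_lt with h0 | h0
      · simp [← h0]
      rw [← mul_add]
      refine mul_le_mul_of_nonneg_left ?_ h0.le
      have h1 := hV ⟨n, hn'⟩ s ⟨P', hmem, h0⟩
      rw [hP'eq] at h1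
      have h2 : W n s = _ := value_toPolicy P' M.r π hn' s
      rw [h2]
      simp only [mul_sub, Finset.sum_sub_distrib]
      linarith
  have h1 := hmain H le_rfl
  have h2 : ∑ s, d H s * (W H s - V H s) ≤ 0 := Finset.sum_nonpos fun s _ => by
    rw [hW, value_of_le _ _ _ le_rfl]
    nlinarith [mul_nonneg (hd0 H s) (hV0 H s)]
  have h3 : robustInitialValue M σ ξ π.toPolicy ≤ ∑ s, ξ s * W 0 s :=
    Finset.sum_le_sum fun s _ => mul_le_mul_of_nonneg_left (robustValue_le hmem _ _ _) (hξ s)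
  have h4 : (Finset.univ.filter fun h : Fin H => (h : ℕ) < H) = Finset.univ := by
    ext h
    simp
  rw [h4] at h1
  linarith

/-- The robust gap is at most the accumulated errors of a pessimistic approximate solution of
the robust optimality equation. -/
theorem exists_robustGap_le {M : EpisodicMDP H S A} {σ : ℝ} (hσ : 0 ≤ σ) {ξ : S → ℝ}
    (hξ : ∀ s, 0 ≤ ξ s) {V : ℕ → S → ℝ} (hV0 : ∀ n s, 0 ≤ V n s) (hVH : ∀ s, V H s = 0)
    {π π' : DetPolicy H S A} {β : Fin H → S → ℝ}
    (hV' : ∀ (h : Fin H) s, V h s ≤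
      M.r h s (π' h s) + worstCaseExp σ (M.P h s (π' h s)) (V (h + 1)))
    (hV : ∀ (h : Fin H) s,
      (∃ P' ∈ uncertaintySet σ M.P, 0 < stateDist ξ π.toPolicy P' h s) →
      M.r h s (π h s) + worstCaseExp σ (M.P h s (π h s)) (V (h + 1)) ≤ V h s + β h s) :
    ∃ P' ∈ uncertaintySet σ M.P,
      robustGap M σ ξ π π' ≤ ∑ h : Fin H, ∑ s, stateDist ξ π.toPolicy P' h s * β h s := by
  obtain ⟨P', hP', hle⟩ := exists_robustInitialValue_le hσ hξ hV0 hV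
  refine ⟨P', hP', ?_⟩
  have h1 : ∑ s, ξ s * V 0 s ≤ robustInitialValue M σ ξ π'.toPolicy :=
    Finset.sum_le_sum fun s _ =>
      mul_le_mul_of_nonneg_left (le_robustValue hσ hV0 hVH hV' (Nat.zero_le H) s) (hξ s)
  rw [robustGap]
  linarith

end Values

/-! ### Sensitivity of worst-case expectations to entrywise errors. -/

section WorstCase

variable {S : Type*} [Fintype S]

/-- Estimates with a small relative error have comparable worst-case expectations. The error is
measured by the smallest positive entry of the estimate. -/
theorem abs_worstCaseExp_sub_le {σ e B : ℝ} (hσ : 0 < σ) (he : 0 ≤ e) {p p' V : S → ℝ}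
    (hp : p ∈ stdSimplex ℝ S) (hp' : p' ∈ stdSimplex ℝ S) (hac : ∀ s, p s = 0 → p' s = 0)
    (hdev : ∀ s, |p' s - p s| ≤ e) (hsmall : ∀ s, 0 < p s → e ≤ p s / 3)
    (hV0 : ∀ s, 0 ≤ V s) (hVB : ∀ s, V s ≤ B) :
    |worstCaseExp σ p' V - worstCaseExp σ p V| ≤ B * (3 / 2 * e / minPos p') / σ := by
  obtain ⟨s₀, hs₀, hs₀min⟩ := exists_minPos_eq hp'
  have hmin : 0 < minPos p' := hs₀min ▸ hs₀
  have hε : 0 ≤ 3 / 2 * e / minPos p' := by positivity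
  -- An error of at most a third of `p s` keeps `p' s` positive and of comparable size; with `hac`
  -- the supports agree.
  have key : ∀ s, 0 < p s → minPos p' ≤ p' s ∧ p' s ≤ 4 / 3 * p s ∧ 2 / 3 * p s ≤ p' s := by
    intro s hs
    have h1 := abs_le.1 (hdev s)
    have h2 := hsmall s hs
    exact ⟨minPos_le (by linarith), by linarith, by linarith⟩
  have hA : ∀ s, p s ≤ (1 + 3 / 2 * e / minPos p') * p' s := by
    intro s
    rcases (hp.1 s).eq_or_lt with h0 | h0
    · rw [← h0]
      exact mul_nonneg (by positivity) (hp'.1 s)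
    obtain ⟨h1, -, -⟩ := key s h0
    have h2 := abs_le.1 (hdev s)
    have h3 : e ≤ e / minPos p' * p' s := by
      rw [div_mul_eq_mul_div, le_div_iff₀ hmin]
      exact mul_le_mul_of_nonneg_left h1 he
    have h4 : 3 / 2 * e / minPos p' * p' s = 3 / 2 * (e / minPos p' * p' s) := by ring
    have h5 : 0 ≤ e / minPos p' * p' s := he.trans h3
    rw [add_mul, one_mul, h4]
    linarith
  have hB : ∀ s, p' s ≤ (1 + 3 / 2 * e / minPos p') * p s := by
    intro s
    rcases (hp.1 s).eq_or_lt with h0 | h0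
    · rw [← h0, hac s h0.symm, mul_zero]
    obtain ⟨h1, h1', -⟩ := key s h0
    have h2 := abs_le.1 (hdev s)
    -- Here the error is taken relative to `p s`, and passing from `p' s` to it costs `4 / 3`; the
    -- factor `3 / 2` in `ε` leaves room for this.
    have h3 : e ≤ e / minPos p' * (4 / 3 * p s) := by
      rw [div_mul_eq_mul_div, le_div_iff₀ hmin]
      exact mul_le_mul_of_nonneg_left (h1.trans h1') he
    have h4 : 3 / 2 * e / minPos p' * p s = 9 / 8 * (e / minPos p' * (4 / 3 * p s)) := by ring
    have h5 : 0 ≤ e / minPos p' * (4 / 3 * p s) := he.trans h3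
    rw [add_mul, one_mul, h4]
    linarith
  have h1 := worstCaseExp_le_add hσ hε hp hp' hA hV0 hVB
  have h2 := worstCaseExp_le_add hσ hε hp' hp hB hV0 hVB
  rw [abs_le]
  constructor <;> linarith

/-- A positive entry of `p'` lies over a positive entry of `p` and has lost at most a third of it.
This exchanges the empirical minimum in the bonus for a nominal one. -/
theorem le_minPos_of_abs_sub_le {e q : ℝ} {p p' : S → ℝ} (hp : p ∈ stdSimplex ℝ S)
    (hp' : p' ∈ stdSimplex ℝ S) (hac : ∀ s, p s = 0 → p' s = 0)
    (hdev : ∀ s, |p' s - p s| ≤ e) (hsmall : ∀ s, 0 < p s → e ≤ p s / 3)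
    (hq : ∀ s, 0 < p s → q ≤ p s) : 2 / 3 * q ≤ minPos p' := by
  obtain ⟨s, hs, hsmin⟩ := exists_minPos_eq hp'
  have h0 : 0 < p s := (hp.1 s).lt_of_ne' fun h => hs.ne' (hac s h)
  have h1 := abs_le.1 (hdev s)
  have h2 := hsmall s h0
  have h3 := hq s h0
  rw [hsmin]
  linarith

end WorstCase

/-! ### The estimates, the bonus and the pessimistic value iteration. -/

section Estimates

variable {L K H : ℕ} {S A : Type*} [Fintype S] [DecidableEq S] [Fintype A] [DecidableEq A]

/-- The logarithmic factor `log (S A H / δ)` of the penalty. -/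
noncomputable def tupleLog (S A : Type*) [Fintype S] [Fintype A] (H : ℕ) (δ : ℝ) : ℝ :=
  Real.log ((Fintype.card S : ℝ) * Fintype.card A * H / δ)

/-- The squared scale of the error that comes from sampling the sources. -/
noncomputable def samplingVar (δ : ℝ) (x : Sample L K H S A) (h : Fin H) (s : S) (a : A) : ℝ :=
  ∑ l ∈ seenSources x h s a, tupleLog S A H δ /
    (((seenSources x h s a).card : ℝ) ^ 2 * (count x l h s a : ℝ))

/-- The squared scale of the error that comes from the randomness of the sources. -/
noncomputable def sourceVar (δ : ℝ) (x : Sample L K H S A) (h : Fin H) (s : S) (a : A) : ℝ :=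
  tupleLog S A H δ / ((seenSources x h s a).card : ℝ)

/-- The penalty before the truncation at `H`. -/
noncomputable def bonus (c σ δ : ℝ) (x : Sample L K H S A) (h : Fin H) (s : S) (a : A) : ℝ :=
  c / (σ * minPos (transitionEst x h s a)) * (H * √(samplingVar δ x h s a)) +
    c / (σ * minPos (transitionEst x h s a)) * (H * √(sourceVar δ x h s a)) +
    c * √(sourceVar δ x h s a)

theorem penalty_eq (c σ δ : ℝ) {x : Sample L K H S A} {h : Fin H} {s : S} {a : A}
    (hx : (seenSources x h s a).Nonempty) :
    penalty c σ δ x h s a = min (H : ℝ) (bonus c σ δ x h s a) := by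
  have hsq : ∀ y : ℝ, √((H : ℝ) ^ 2 * y) = H * √y := fun y => by
    rw [Real.sqrt_mul (by positivity), Real.sqrt_sq (Nat.cast_nonneg H)]
  rw [penalty, if_neg hx.ne_empty, bonus, samplingVar, sourceVar, ← hsq, ← hsq, Finset.mul_sum]
  simp only [tupleLog, mul_div_assoc]

theorem sum_countNext (x : Sample L K H S A) (l : Fin L) (h : Fin H) (s : S) (a : A) :
    ∑ s', countNext x l h s a s' = count x l h s a := by
  rw [count, Finset.card_eq_sum_card_fiberwise (f := fun k => (x.1 l k).1 h.succ)
    (t := Finset.univ) (fun _ _ => Finset.mem_coe.2 (Finset.mem_univ _))]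
  simp only [countNext, Finset.filter_filter]

theorem transitionEst_of_nonempty {x : Sample L K H S A} {h : Fin H} {s : S} {a : A}
    (hx : (seenSources x h s a).Nonempty) (s' : S) :
    transitionEst x h s a s' =
      (∑ l ∈ seenSources x h s a, (countNext x l h s a s' : ℝ) / (count x l h s a : ℝ)) /
        ((seenSources x h s a).card : ℝ) := by
  rw [transitionEst, max_eq_left]
  exact_mod_cast hx.card_pos

theorem transitionEst_mem {x : Sample L K H S A} {h : Fin H} {s : S} {a : A}
    (hx : (seenSources x h s a).Nonempty) : transitionEst x h s a ∈ stdSimplex ℝ S := by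
  refine ⟨fun s' => ?_, ?_⟩
  · rw [transitionEst_of_nonempty hx]
    positivity
  · simp only [transitionEst_of_nonempty hx, ← Finset.sum_div]
    rw [Finset.sum_comm, div_eq_one_iff_eq (by exact_mod_cast hx.card_pos.ne')]
    have : ∀ l ∈ seenSources x h s a,
        ∑ s', (countNext x l h s a s' : ℝ) / (count x l h s a : ℝ) = 1 := fun l hl => by
      rw [← Finset.sum_div, ← Nat.cast_sum, sum_countNext, div_self]
      exact_mod_cast (Finset.mem_filter.1 hl).2.ne'
    rw [Finset.sum_congr rfl this]
    simp

theorem rewardEst_mem {θ : Sources L H S A}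
    (hθ : ∀ l h s a, θ.reward l h s a ∈ Set.Icc (0 : ℝ) 1) (x : Sample L K H S A) (h : Fin H)
    (s : S) (a : A) : rewardEst θ x h s a ∈ Set.Icc (0 : ℝ) 1 := by
  have h1 : ∑ l ∈ seenSources x h s a, θ.reward l h s a ≤ ((seenSources x h s a).card : ℝ) := by
    simpa using Finset.sum_le_card_nsmul _ _ 1 fun l (_ : l ∈ seenSources x h s a) =>
      (hθ l h s a).2
  refine ⟨div_nonneg (Finset.sum_nonneg fun l _ => (hθ l h s a).1) (by positivity), ?_⟩
  exact (div_le_one (by positivity)).2 (h1.trans (le_max_left _ _))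

theorem qStep_nonneg (c σ δ : ℝ) (θ : Sources L H S A) (x : Sample L K H S A) (V : S → ℝ)
    (h : Fin H) (s : S) (a : A) : 0 ≤ qStep c σ δ θ x V h s a :=
  le_max_right _ _

/-- The zero vector has an empty ball, since a member would vanish everywhere, and the infimum of
the empty set is `0`. Only minus the penalty `H` remains, and it is truncated. -/
theorem qStep_of_seenSources_eq_empty {c σ δ : ℝ} {θ : Sources L H S A} {x : Sample L K H S A}
    {V : S → ℝ} {h : Fin H} {s : S} {a : A} (hx : seenSources x h s a = ∅) :
    qStep c σ δ θ x V h s a = 0 := by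
  have h1 : transitionEst x h s a = 0 := by
    funext s'
    simp [transitionEst, hx]
  have h2 : klBall σ (0 : S → ℝ) = ∅ := by
    refine Set.eq_empty_of_forall_notMem fun q hq => ?_
    have := hq.1.2
    simp [hq.2.1] at this
  simp [qStep, rewardEst, penalty, worstCaseExp, hx, h1, h2]

/-- A sample whose estimates at a tuple are accurate. -/
structure IsAccurate (M : EpisodicMDP H S A) (δ : ℝ) (θ : Sources L H S A)
    (x : Sample L K H S A) (h : Fin H) (s : S) (a : A) : Prop where
  nonempty : (seenSources x h s a).Nonempty
  rewardEst_le : rewardEst θ x h s a ≤ 1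
  ac : ∀ s', M.P h s a s' = 0 → transitionEst x h s a s' = 0
  transition_dev : ∀ s', |transitionEst x h s a s' - M.P h s a s'| ≤
    6 * √(samplingVar δ x h s a) + 6 * √(sourceVar δ x h s a)
  reward_dev : |rewardEst θ x h s a - M.r h s a| ≤ 6 * √(sourceVar δ x h s a)
  small : ∀ s', 0 < M.P h s a s' →
    6 * √(samplingVar δ x h s a) + 6 * √(sourceVar δ x h s a) ≤ M.P h s a s' / 3

namespace IsAccurate

variable {M : EpisodicMDP H S A} {c σ δ : ℝ} {θ : Sources L H S A} {x : Sample L K H S A}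
  {h : Fin H} {s : S} {a : A} {V : S → ℝ}

theorem minPos_pos (hx : IsAccurate M δ θ x h s a) : 0 < minPos (transitionEst x h s a) := by
  obtain ⟨s', h1, h2⟩ := exists_minPos_eq (transitionEst_mem hx.nonempty)
  exact h2 ▸ h1

/-- The constant `9` is `3 / 2 * 6`: the factor of `abs_worstCaseExp_sub_le` times the deviation
constant of `IsAccurate`. The reward error is covered by the last term of the bonus. -/
theorem abs_sub_le_bonus (hx : IsAccurate M δ θ x h s a) (hσ : 0 < σ) (hc : 9 ≤ c)
    (hV0 : ∀ s, 0 ≤ V s) (hVH : ∀ s, V s ≤ H) :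
    |rewardEst θ x h s a + worstCaseExp σ (transitionEst x h s a) V -
      (M.r h s a + worstCaseExp σ (M.P h s a) V)| ≤ bonus c σ δ x h s a := by
  have h1 := abs_worstCaseExp_sub_le hσ (by positivity) (M.P_mem h s a)
    (transitionEst_mem hx.nonempty) hx.ac hx.transition_dev hx.small hV0 hVH
  have h2 := hx.reward_dev
  have hmin := hx.minPos_pos
  have h3 : (H : ℝ) * (3 / 2 * (6 * √(samplingVar δ x h s a) + 6 * √(sourceVar δ x h s a)) /
      minPos (transitionEst x h s a)) / σ + 6 * √(sourceVar δ x h s a) ≤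
      bonus c σ δ x h s a := by
    have h4 : (H : ℝ) * (3 / 2 * (6 * √(samplingVar δ x h s a) + 6 * √(sourceVar δ x h s a)) /
      minPos (transitionEst x h s a)) / σ = 9 / (σ * minPos (transitionEst x h s a)) *
        (H * √(samplingVar δ x h s a)) + 9 / (σ * minPos (transitionEst x h s a)) *
        (H * √(sourceVar δ x h s a)) := by
      field_simp
      ring
    rw [h4, bonus]
    gcongr
    linarith
  rw [abs_le] at h1 h2 ⊢
  constructor <;> linarith

/-- If the penalty is the bonus, it dominates the error of the backup. If it is `H`, the untruncated
value is at most `1 + (H - 1) - H = 0`, which is why `V ≤ H - 1` is required. Truncation at `0` is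
harmless since the exact backup is nonnegative. -/
theorem qStep_le (hx : IsAccurate M δ θ x h s a) (hσ : 0 < σ) (hc : 9 ≤ c)
    (hV0 : ∀ s, 0 ≤ V s) (hVH : ∀ s, V s ≤ H - 1) :
    qStep c σ δ θ x V h s a ≤ M.r h s a + worstCaseExp σ (M.P h s a) V := by
  have h1 := abs_le.1 (hx.abs_sub_le_bonus hσ hc hV0 fun s => (hVH s).trans (by linarith))
  have h2 := worstCaseExp_nonneg (σ := σ) (p := M.P h s a) hV0
  have h3 := worstCaseExp_le_of_le hσ.le (transitionEst_mem hx.nonempty) hV0 hVH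
  have h4 := (M.r_mem h s a).1
  have h5 := hx.rewardEst_le
  refine max_le ?_ (by positivity)
  rw [penalty_eq _ _ _ hx.nonempty]
  rcases min_choice (H : ℝ) (bonus c σ δ x h s a) with h6 | h6 <;> rw [h6] <;> linarith

/-- The penalty costs at most one bonus and the error of the backup another one. -/
theorem le_qStep (hx : IsAccurate M δ θ x h s a) (hσ : 0 < σ) (hc : 9 ≤ c)
    (hV0 : ∀ s, 0 ≤ V s) (hVH : ∀ s, V s ≤ H) :
    M.r h s a + worstCaseExp σ (M.P h s a) V ≤
      qStep c σ δ θ x V h s a + 2 * bonus c σ δ x h s a := by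
  have h1 := abs_le.1 (hx.abs_sub_le_bonus hσ hc hV0 hVH)
  have h2 : rewardEst θ x h s a + worstCaseExp σ (transitionEst x h s a) V -
      penalty c σ δ x h s a ≤ qStep c σ δ θ x V h s a := le_max_left _ _
  rw [penalty_eq _ _ _ hx.nonempty] at h2
  have h3 := min_le_right (H : ℝ) (bonus c σ δ x h s a)
  linarith

/-- The bonus in terms of a lower bound on the positive nominal transition probabilities. -/
theorem bonus_le (hx : IsAccurate M δ θ x h s a) (hσ : 0 < σ) (hc : 0 ≤ c) {q : ℝ} (hq : 0 < q)
    (hq' : ∀ s', 0 < M.P h s a s' → q ≤ M.P h s a s') :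
    bonus c σ δ x h s a ≤ 3 / 2 * c * (H / (σ * q) * √(samplingVar δ x h s a) +
      (1 + H / (σ * q)) * √(sourceVar δ x h s a)) := by
  have h1 := le_minPos_of_abs_sub_le (M.P_mem h s a) (transitionEst_mem hx.nonempty) hx.ac
    hx.transition_dev hx.small hq'
  have h2 : c / (σ * minPos (transitionEst x h s a)) ≤ 3 / 2 * c / (σ * q) := by
    rw [div_le_div_iff₀ (mul_pos hσ hx.minPos_pos) (by positivity)]
    nlinarith [mul_nonneg hc hσ.le]
  calc bonus c σ δ x h s a ≤ 3 / 2 * c / (σ * q) * (H * √(samplingVar δ x h s a)) +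
        3 / 2 * c / (σ * q) * (H * √(sourceVar δ x h s a)) +
        3 / 2 * c * √(sourceVar δ x h s a) := by
        rw [bonus]
        gcongr
        linarith
    _ = _ := by ring

end IsAccurate

section ValueEst

variable {c σ δ : ℝ} {θ : Sources L H S A} {x : Sample L K H S A}

theorem valueEst_of_le {n : ℕ} (hn : H ≤ n) (s : S) : valueEst c σ δ θ x n s = 0 := by
  rw [valueEst, dif_neg hn.not_gt]

theorem valueEst_eq [Nonempty A] {π : DetPolicy H S A} (hπ : IsOutput c σ δ θ x π) (h : Fin H)
    (s : S) : valueEst c σ δ θ x h s =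
      qStep c σ δ θ x (valueEst c σ δ θ x (h + 1)) h s (π h s) := by
  rw [valueEst, dif_pos h.2]
  exact le_antisymm (ciSup_le fun a => hπ h s a)
    (le_ciSup (f := fun a => qStep c σ δ θ x (valueEst c σ δ θ x (h + 1)) h s a)
      (Set.finite_range _).bddAbove (π h s))

theorem qStep_le_valueEst (h : Fin H) (s : S) (a : A) :
    qStep c σ δ θ x (valueEst c σ δ θ x (h + 1)) h s a ≤ valueEst c σ δ θ x h s := by
  conv_rhs => rw [valueEst, dif_pos h.2]
  exact le_ciSup (f := fun a => qStep c σ δ θ x (valueEst c σ δ θ x (h + 1)) h s a)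
    (Set.finite_range _).bddAbove a

theorem valueEst_nonneg [Nonempty A] (n : ℕ) (s : S) : 0 ≤ valueEst c σ δ θ x n s := by
  by_cases hn : n < H
  · exact (qStep_nonneg _ _ _ _ _ _ _ _ _).trans
      (qStep_le_valueEst ⟨n, hn⟩ s (Classical.arbitrary A))
  · rw [valueEst_of_le (not_lt.1 hn)]

theorem penalty_nonneg (hc : 0 ≤ c) (hσ : 0 < σ) (h : Fin H) (s : S) (a : A) :
    0 ≤ penalty c σ δ x h s a := by
  rcases (seenSources x h s a).eq_empty_or_nonempty with hx | hx
  · simp [penalty, hx]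
  · have : 0 ≤ minPos (transitionEst x h s a) :=
      Real.sInf_nonneg (by rintro _ ⟨s', hs', rfl⟩; exact hs'.le)
    rw [penalty_eq _ _ _ hx, bonus]
    positivity

/-- Empirical rewards are at most one and the penalty is nonnegative, so each remaining step adds at
most one; accuracy plays no role. -/
theorem valueEst_le [Nonempty A] (hc : 0 ≤ c) (hσ : 0 < σ)
    (hθ : ∀ l h s a, θ.reward l h s a ∈ Set.Icc (0 : ℝ) 1) {n : ℕ} (hn : n ≤ H) (s : S) :
    valueEst c σ δ θ x n s ≤ (H : ℝ) - n := by
  induction hn using Nat.decreasingInduction generalizing s with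
  | self => rw [valueEst_of_le le_rfl, sub_self]
  | of_succ n hn ih =>
    rw [valueEst, dif_pos hn]
    have hn' : (n : ℝ) + 1 ≤ H := by exact_mod_cast hn
    refine ciSup_le fun a => ?_
    rcases (seenSources x ⟨n, hn⟩ s a).eq_empty_or_nonempty with hx | hx
    · rw [qStep_of_seenSources_eq_empty hx]
      linarith
    · have h1 := (rewardEst_mem hθ x ⟨n, hn⟩ s a).2
      have h2 := worstCaseExp_le_of_le hσ.le (transitionEst_mem hx)
        (valueEst_nonneg (c := c) (σ := σ) (δ := δ) (θ := θ) (x := x) (n + 1)) ih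
      have h3 := penalty_nonneg (δ := δ) (x := x) hc hσ ⟨n, hn⟩ s a
      push_cast at h2
      exact max_le (by linarith) (by linarith)

/-- The robust gap of the output is at most twice the accumulated bonuses, if the estimates are
accurate at all tuples in the data and at all tuples that the comparator can visit. -/
theorem exists_robustGap_le_bonus [Nonempty A] {M : EpisodicMDP H S A} (hc : 9 ≤ c) (hσ : 0 < σ)
    {ξ : S → ℝ} (hξ : ∀ s, 0 ≤ ξ s) (hθ : ∀ l h s a, θ.reward l h s a ∈ Set.Icc (0 : ℝ) 1)
    {π π' : DetPolicy H S A} (hπ' : IsOutput c σ δ θ x π')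
    (hseen : ∀ h s a, (seenSources x h s a).Nonempty → IsAccurate M δ θ x h s a)
    (hcov : ∀ (h : Fin H) s, (∃ P' ∈ uncertaintySet σ M.P, 0 < stateDist ξ π.toPolicy P' h s) →
      IsAccurate M δ θ x h s (π h s)) :
    ∃ P' ∈ uncertaintySet σ M.P, robustGap M σ ξ π π' ≤
      ∑ h : Fin H, ∑ s, stateDist ξ π.toPolicy P' h s * (2 * bonus c σ δ x h s (π h s)) := by
  have hc0 : 0 ≤ c := by linarith
  have hle : ∀ (h : Fin H) s, valueEst c σ δ θ x (h + 1) s ≤ (H : ℝ) - 1 := fun h s => by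
    have h1 := valueEst_le (δ := δ) (x := x) hc0 hσ hθ (Nat.succ_le_of_lt h.2) s
    push_cast at h1
    linarith [(Nat.cast_nonneg (h : ℕ) : (0 : ℝ) ≤ _)]
  refine exists_robustGap_le hσ.le hξ (V := valueEst c σ δ θ x) valueEst_nonneg
    (fun s => valueEst_of_le le_rfl s) (fun h s => ?_) fun h s hs => ?_
  · rw [valueEst_eq hπ']
    -- At an unseen tuple the estimate is `0`, so pessimism holds there without any accuracy.
    rcases (seenSources x h s (π' h s)).eq_empty_or_nonempty with hx | hx
    · rw [qStep_of_seenSources_eq_empty hx]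
      exact add_nonneg (M.r_mem _ _ _).1 (worstCaseExp_nonneg (valueEst_nonneg _))
    · exact (hseen h s _ hx).qStep_le hσ hc (valueEst_nonneg _) (hle h)
  · refine ((hcov h s hs).le_qStep hσ hc (valueEst_nonneg _) fun s' =>
      (hle h s').trans (by linarith)).trans ?_
    exact add_le_add_left (qStep_le_valueEst h s _) _

end ValueEst

end Estimates

/-! ### Elementary properties of the coverage quantities. -/

section Coverage

variable {L K H : ℕ} {S A : Type*} [Fintype S] [DecidableEq S] [Fintype A] [DecidableEq A]
  {M : EpisodicMDP H S A} {σ δ : ℝ} {ξ : S → ℝ} {π : DetPolicy H S A} {ξs : Fin L → S → ℝ}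
  {ρ : Fin L → Policy H S A} {θ : Sources L H S A}

theorem mem_coveringSources {l : Fin L} {h : Fin H} {s : S} {a : A} :
    l ∈ coveringSources ξs ρ θ h s a ↔
      0 < occupancy (ξs l) (ρ l) (θ.transition l) h s a := by
  simp [coveringSources]

/-- An infimum of finitely many positive numbers is attained, hence positive. -/
theorem dmin_pos_and_le {l : Fin L} {h : Fin H} {s : S} {a : A}
    (hl : l ∈ coveringSources ξs ρ θ h s a) :
    0 < dmin ξs ρ θ ∧ dmin ξs ρ θ ≤ occupancy (ξs l) (ρ l) (θ.transition l) h s a := by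
  set X := {x | 0 < x ∧ ∃ l h s a, x = occupancy (ξs l) (ρ l) (θ.transition l) h s a} with hX
  have hmem : occupancy (ξs l) (ρ l) (θ.transition l) h s a ∈ X :=
    ⟨mem_coveringSources.1 hl, l, h, s, a, rfl⟩
  have hfin : X.Finite := by
    refine (Set.finite_range fun i : Fin L × Fin H × S × A =>
      occupancy (ξs i.1) (ρ i.1) (θ.transition i.1) i.2.1 i.2.2.1 i.2.2.2).subset ?_
    rintro _ ⟨-, l, h, s, a, rfl⟩
    exact ⟨(l, h, s, a), rfl⟩
  exact ⟨(Set.Nonempty.csInf_mem ⟨_, hmem⟩ hfin).1, csInf_le hfin.bddBelow hmem⟩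

theorem finite_range_transition (P : Transition H S A) (X : Set ℝ)
    (hX : ∀ x ∈ X, ∃ h s a s', x = P h s a s') : X.Finite := by
  refine (Set.finite_range fun i : Fin H × S × A × S => P i.1 i.2.1 i.2.2.1 i.2.2.2).subset ?_
  intro x hx
  obtain ⟨h, s, a, s', rfl⟩ := hX x hx
  exact ⟨(h, s, a, s'), rfl⟩

theorem exists_pos_of_mem_stdSimplex {p : S → ℝ} (hp : p ∈ stdSimplex ℝ S) : ∃ s, 0 < p s := by
  obtain ⟨s, hs, -⟩ := exists_minPos_eq hp
  exact ⟨s, hs⟩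

theorem Pminsigma_pos {l : Fin L} {h : Fin H} {s : S} {a : A}
    (hl : l ∈ coveringSources ξs ρ θ h s a) : 0 < Pminsigma M ξs ρ θ := by
  obtain ⟨s', hs'⟩ := exists_pos_of_mem_stdSimplex (M.P_mem h s a)
  have hmem := Set.Nonempty.csInf_mem (s := {x | 0 < x ∧ ∃ h s a s',
      (∃ l, 0 < occupancy (ξs l) (ρ l) (θ.transition l) h s a) ∧ x = M.P h s a s'})
    ⟨_, hs', h, s, a, s', ⟨l, mem_coveringSources.1 hl⟩, rfl⟩
    (finite_range_transition M.P _ ?_)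
  · exact hmem.1
  · rintro _ ⟨-, h, s, a, s', -, rfl⟩
    exact ⟨h, s, a, s', rfl⟩

theorem Pminsigma_le {l : Fin L} {h : Fin H} {s : S} {a : A}
    (hl : l ∈ coveringSources ξs ρ θ h s a) {s' : S} (hs' : 0 < M.P h s a s') :
    Pminsigma M ξs ρ θ ≤ M.P h s a s' :=
  csInf_le ⟨0, by rintro _ ⟨h, -⟩; exact h.le⟩
    ⟨hs', h, s, a, s', ⟨l, mem_coveringSources.1 hl⟩, rfl⟩

theorem Pminsigma_le_one {l : Fin L} {h : Fin H} {s : S} {a : A}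
    (hl : l ∈ coveringSources ξs ρ θ h s a) : Pminsigma M ξs ρ θ ≤ 1 := by
  obtain ⟨s', hs'⟩ := exists_pos_of_mem_stdSimplex (M.P_mem h s a)
  exact (Pminsigma_le hl hs').trans (mem_Icc_of_mem_stdSimplex (M.P_mem h s a) s').2

theorem Pminstar_pos {h : Fin H} {s : S} {a : A} (hd : 0 < occupancy ξ π.toPolicy M.P h s a) :
    0 < Pminstar M ξ π := by
  obtain ⟨s', hs'⟩ := exists_pos_of_mem_stdSimplex (M.P_mem h s a)
  have hmem := Set.Nonempty.csInf_mem (s := {x | 0 < x ∧ ∃ h s a s',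
      0 < occupancy ξ π.toPolicy M.P h s a ∧ x = M.P h s a s'})
    ⟨_, hs', h, s, a, s', hd, rfl⟩ (finite_range_transition M.P _ ?_)
  · exact hmem.1
  · rintro _ ⟨-, h, s, a, s', -, rfl⟩
    exact ⟨h, s, a, s', rfl⟩

theorem Pminstar_le {h : Fin H} {s : S} {a : A} (hd : 0 < occupancy ξ π.toPolicy M.P h s a)
    {s' : S} (hs' : 0 < M.P h s a s') : Pminstar M ξ π ≤ M.P h s a s' :=
  csInf_le ⟨0, by rintro _ ⟨h, -⟩; exact h.le⟩ ⟨hs', h, s, a, s', hd, rfl⟩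

theorem Lmin_le {h : Fin H} {s : S} {a : A} (hne : (coveringSources ξs ρ θ h s a).Nonempty) :
    Lmin ξs ρ θ ≤ (coveringSources ξs ρ θ h s a).card :=
  Nat.sInf_le ⟨hne.card_pos, h, s, a, rfl⟩

theorem Ldagger_le {P' : Transition H S A} (hP' : P' ∈ uncertaintySet σ M.P) {h : Fin H} {s : S}
    {a : A} (hd : 0 < occupancy ξ π.toPolicy P' h s a) :
    Ldagger M σ ξ π ξs ρ θ ≤ (coveringSources ξs ρ θ h s a).card :=
  Nat.sInf_le ⟨h, s, a, ⟨P', hP', hd⟩, rfl⟩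

/-- The uncertainty set may be infinite, so the supremum needs a bound: the clip at `1 / S`
dominates each term by one free of `P'`, and these are finitely many. -/
theorem le_Cdagger {P' : Transition H S A}
    (hP' : P' ∈ uncertaintySet σ M.P) (h : Fin H) (s : S) (a : A) :
    ∑ l ∈ coveringSources ξs ρ θ h s a,
      min (occupancy ξ π.toPolicy P' h s a) (1 / (Fintype.card S : ℝ)) /
        (((coveringSources ξs ρ θ h s a).card : ℝ) *
          occupancy (ξs l) (ρ l) (θ.transition l) h s a) ≤ Cdagger M σ ξ π ξs ρ θ := by
  let G : Fin H → S → A → ℝ := fun h s a => ∑ l ∈ coveringSources ξs ρ θ h s a,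
    (1 / (Fintype.card S : ℝ)) / (((coveringSources ξs ρ θ h s a).card : ℝ) *
          occupancy (ξs l) (ρ l) (θ.transition l) h s a)
  have hfin : (Set.range fun i : Fin H × S × A => G i.1 i.2.1 i.2.2).Finite :=
    Set.finite_range _
  obtain ⟨B, hB⟩ := hfin.bddAbove
  refine le_csSup ⟨B, ?_⟩ ⟨h, s, a, P', hP', rfl⟩
  rintro _ ⟨h, s, a, P', hP', rfl⟩
  refine le_trans (Finset.sum_le_sum fun l hl => ?_) (hB ⟨(h, s, a), rfl⟩)
  have := mem_coveringSources.1 hl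
  exact div_le_div_of_nonneg_right (min_le_right _ _) (by positivity)

theorem Cdagger_nonneg (hξ : ∀ s, 0 ≤ ξ s) : 0 ≤ Cdagger M σ ξ π ξs ρ θ := by
  refine Real.sSup_nonneg ?_
  rintro _ ⟨h, s, a, P', hP', rfl⟩
  refine Finset.sum_nonneg fun l hl => ?_
  have h1 := mem_coveringSources.1 hl
  have h2 := occupancy_nonneg hξ π.toPolicy (fun h s a => (hP' h s a).1.1) h s a
  exact div_nonneg (le_min h2 (by positivity)) (by positivity)

theorem Pminstar_nonneg : 0 ≤ Pminstar M ξ π :=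
  Real.sInf_nonneg (by rintro _ ⟨h, -⟩; exact h.le)

theorem rate_nonneg (hσ : 0 ≤ σ) : 0 ≤ rate K M σ ξ π ξs ρ θ := by
  have := Pminstar_nonneg (M := M) (ξ := ξ) (π := π)
  rw [rate]
  positivity

/-- States that some model of the uncertainty set visits are visited by the nominal model. -/
theorem stateDist_pos_of_mem_uncertaintySet (hξ : ∀ s, 0 ≤ ξ s) (π' : Policy H S A)
    {P' : Transition H S A} (hP' : P' ∈ uncertaintySet σ M.P) {n : ℕ} {s : S}
    (hs : 0 < stateDist ξ π' P' n s) : 0 < stateDist ξ π' M.P n s := by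
  have hnn := stateDist_nonneg hξ π' fun h s a => (M.P_mem h s a).1
  induction n generalizing s with
  | zero => exact hs
  | succ n ih =>
    refine (hnn _ _).lt_of_ne' fun h0 => hs.ne' ?_
    rw [stateDist_succ] at h0 ⊢
    split_ifs at h0 ⊢ with hn
    · have hterm : ∀ s₀ a, 0 ≤ stateDist ξ π' M.P n s₀ * π'.prob ⟨n, hn⟩ s₀ a *
          M.P ⟨n, hn⟩ s₀ a s := fun s₀ a =>
        mul_nonneg (mul_nonneg (hnn n s₀) ((π'.prob_mem _ _).1 a)) ((M.P_mem _ _ _).1 s)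
      refine Finset.sum_eq_zero fun s₀ hs₀ => Finset.sum_eq_zero fun a ha => ?_
      have h1 := (Finset.sum_eq_zero_iff_of_nonneg fun a _ => hterm s₀ a).1
        ((Finset.sum_eq_zero_iff_of_nonneg fun s₀ _ =>
          Finset.sum_nonneg fun a _ => hterm s₀ a).1 h0 s₀ hs₀) a ha
      rcases mul_eq_zero.1 h1 with h1 | h1
      · rcases mul_eq_zero.1 h1 with h1 | h1
        · have h2 : stateDist ξ π' P' n s₀ = 0 := by
            by_contra h2
            exact (ih ((stateDist_nonneg hξ π' (fun h s a => (hP' h s a).1.1) n s₀).lt_of_ne'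
              h2)).ne' h1
          rw [h2, zero_mul, zero_mul]
        · rw [h1, mul_zero, zero_mul]
      -- Absolute continuity: kernels in the ball cannot open new transitions.
      · rw [(hP' _ _ _).2.1 s h1, mul_zero]
    · rfl

theorem occupancy_toPolicy {P' : Transition H S A} (hP' : ∀ h s a, P' h s a ∈ stdSimplex ℝ S)
    (h : Fin H) (s : S) :
    occupancy ξ π.toPolicy P' h s (π h s) = stateDist ξ π.toPolicy P' h s := by
  rw [occupancy_eq _ _ hP']
  simp [DetPolicy.toPolicy]

end Coverage

/-! ### Typical outcomes and the effect of burn-in. -/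

section Typical

variable {L K H : ℕ} {S A : Type*} [Fintype S] [DecidableEq S] [Fintype A] [DecidableEq A]

/-- The outcomes at which all estimates and all counts are close to what is expected. -/
structure IsTypical (M : EpisodicMDP H S A) (δ : ℝ) (ξs : Fin L → S → ℝ)
    (ρ : Fin L → Policy H S A) (θ : Sources L H S A) (x : Sample L K H S A) : Prop where
  transition_mem : ∀ l h s a, θ.transition l h s a ∈ stdSimplex ℝ S
  transition_ac : ∀ l h s a s', M.P h s a s' = 0 → θ.transition l h s a s' = 0
  reward_mem : ∀ l h s a, θ.reward l h s a ∈ Set.Icc (0 : ℝ) 1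
  trajProb_pos : ∀ l k, 0 < trajProb (ξs l) (ρ l) (θ.transition l) (x.1 l k)
  selection_mem : ∀ l h s,
    x.2 l h s ∈ (mainVisits x.1 l h s).powersetCard (trimCount δ x.1 l h s)
  transition_dev : ∀ h s a, (seenSources x h s a).Nonempty → ∀ s',
    |transitionEst x h s a s' - M.P h s a s'| ≤
      6 * √(samplingVar δ x h s a) + 6 * √(sourceVar δ x h s a)
  reward_dev : ∀ h s a, (seenSources x h s a).Nonempty →
    |rewardEst θ x h s a - M.r h s a| ≤ 6 * √(sourceVar δ x h s a)
  main_count : ∀ l (h : Fin H) s,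
    32 * logFactor S A H L K δ ≤ (K / 2 : ℕ) * stateDist (ξs l) (ρ l) (θ.transition l) h s →
      (K / 2 : ℕ) * stateDist (ξs l) (ρ l) (θ.transition l) h s / 2 ≤
        ((mainVisits x.1 l h s).card : ℝ)
  aux_count : ∀ l (h : Fin H) s,
    32 * logFactor S A H L K δ ≤
      (K - K / 2 : ℕ) * stateDist (ξs l) (ρ l) (θ.transition l) h s →
      (K - K / 2 : ℕ) * stateDist (ξs l) (ρ l) (θ.transition l) h s / 2 ≤
        ((auxVisits x.1 l h s).card : ℝ)
  action_count : ∀ l h s a,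
    32 * logFactor S A H L K δ ≤ (x.2 l h s).card * (ρ l).prob h s a →
      (x.2 l h s).card * (ρ l).prob h s a / 2 ≤ (count x l h s a : ℝ)

/-- With two actions the argument of the logarithm is at least `2`. Being bounded below, the
logarithm absorbs additive constants, such as the loss from rounding down, and dominates its own
square root up to a factor. -/
theorem half_le_logFactor (hH : 1 ≤ H) (hL : 1 ≤ L) (hK : 1 ≤ K) {δ : ℝ} (hδ0 : 0 < δ)
    (hδ1 : δ < 1) [Nonempty S] (hA : 2 ≤ Fintype.card A) :
    1 / 2 ≤ logFactor S A H L K δ := by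
  have h2 : (2 : ℝ) ≤ (K : ℝ) * H * Fintype.card S * Fintype.card A * L / δ := by
    rw [le_div_iff₀ hδ0]
    have : 1 * 1 * 1 * 2 * 1 ≤ K * H * Fintype.card S * Fintype.card A * L := by
      gcongr
      exact Fintype.card_pos
    have h3 : (2 : ℝ) ≤ (K : ℝ) * H * Fintype.card S * Fintype.card A * L := by
      exact_mod_cast this
    linarith
  have h3 := Real.log_le_log (by norm_num) h2
  have h4 := Real.log_two_gt_d9
  rw [logFactor]
  linarith

theorem log_visits_le_logFactor (hH : 1 ≤ H) (hL : 1 ≤ L) (hK : 1 ≤ K) {δ : ℝ} (hδ0 : 0 < δ)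
    [Nonempty S] [Nonempty A] :
    Real.log ((H : ℝ) * Fintype.card S * L / δ) ≤ logFactor S A H L K δ := by
  have hS : 0 < Fintype.card S := Fintype.card_pos
  have h0 : 0 < H * Fintype.card S * L := by positivity
  have h1 : H * Fintype.card S * L * (1 * 1) ≤ K * H * Fintype.card S * Fintype.card A * L := by
    calc H * Fintype.card S * L * (1 * 1)
        ≤ H * Fintype.card S * L * (K * Fintype.card A) := by
          gcongr
          exact Fintype.card_pos
      _ = _ := by ring
  have h2 : (H : ℝ) * Fintype.card S * L ≤ (K : ℝ) * H * Fintype.card S * Fintype.card A * L := by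
    rw [mul_one, mul_one] at h1
    exact_mod_cast h1
  have h3 : (0 : ℝ) < (H : ℝ) * Fintype.card S * L := by exact_mod_cast h0
  exact Real.log_le_log (by positivity) (by gcongr)

theorem tupleLog_le_logFactor (hH : 1 ≤ H) (hL : 1 ≤ L) (hK : 1 ≤ K) {δ : ℝ} (hδ0 : 0 < δ)
    [Nonempty S] [Nonempty A] : tupleLog S A H δ ≤ logFactor S A H L K δ := by
  have hS : 0 < Fintype.card S := Fintype.card_pos
  have hA : 0 < Fintype.card A := Fintype.card_pos
  have h0 : 0 < Fintype.card S * Fintype.card A * H := by positivity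
  have h1 : Fintype.card S * Fintype.card A * H * (1 * 1) ≤
      K * H * Fintype.card S * Fintype.card A * L := by
    calc Fintype.card S * Fintype.card A * H * (1 * 1)
        ≤ Fintype.card S * Fintype.card A * H * (K * L) := by gcongr
      _ = _ := by ring
  have h2 : (Fintype.card S : ℝ) * Fintype.card A * H ≤
      (K : ℝ) * H * Fintype.card S * Fintype.card A * L := by
    rw [mul_one, mul_one] at h1
    exact_mod_cast h1
  have h3 : (0 : ℝ) < (Fintype.card S : ℝ) * Fintype.card A * H := by exact_mod_cast h0
  exact Real.log_le_log (by positivity) (by gcongr)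

/-- The bounds that the burn-in conditions give at a covered tuple. -/
theorem BurnIn.bounds {M : EpisodicMDP H S A} {c₁ δ : ℝ} {ξs : Fin L → S → ℝ}
    {ρ : Fin L → Policy H S A} {θ : Sources L H S A} (hB : BurnIn c₁ δ K M ξs ρ θ) {l : Fin L}
    {h : Fin H} {s : S} {a : A} (hl : l ∈ coveringSources ξs ρ θ h s a) :
    c₁ * logFactor S A H L K δ ≤
        K * occupancy (ξs l) (ρ l) (θ.transition l) h s a * Pminsigma M ξs ρ θ ^ 2 ∧
      c₁ * logFactor S A H L K δ ≤
        (coveringSources ξs ρ θ h s a).card * Pminsigma M ξs ρ θ ^ 2 := by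
  obtain ⟨hd0, hd⟩ := dmin_pos_and_le hl
  have hP : 0 < Pminsigma M ξs ρ θ := Pminsigma_pos hl
  have h1 := hB.1
  have h2 := hB.2
  rw [div_mul_eq_mul_div, div_le_iff₀ (by positivity)] at h1 h2
  constructor
  · refine h1.trans ?_
    rw [← mul_assoc]
    gcongr
  · refine h2.trans ?_
    gcongr
    exact Lmin_le ⟨l, hl⟩

/-- The trimmed count is a constant fraction of the expected number of visits. -/
theorem le_trimCount {δ ℓ μ : ℝ} {D : Dataset L K H S A} {l : Fin L} {h : Fin H} {s : S}
    (hℓ : 1 / 2 ≤ ℓ) (hlog : Real.log ((H : ℝ) * Fintype.card S * L / δ) ≤ ℓ)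
    (hμ : 2400 * ℓ ≤ K * μ) (hmain : K * μ / 6 ≤ ((mainVisits D l h s).card : ℝ))
    (haux : K * μ / 4 ≤ ((auxVisits D l h s).card : ℝ)) :
    K * μ / 24 ≤ (trimCount δ D l h s : ℝ) := by
  set n : ℝ := ((auxVisits D l h s).card : ℝ) with hn
  have hn400 : 400 * ℓ ≤ n := by linarith
  -- From `n ≥ 400 * ℓ` the subtracted term is at most `n / 2`. Rounding down loses one more, which
  -- `K * μ ≥ 1200` covers.
  have hsqrt : √(n * Real.log ((H : ℝ) * Fintype.card S * L / δ)) ≤ n / 20 := by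
    rw [Real.sqrt_le_left (by linarith)]
    nlinarith
  have hfloor := Nat.lt_floor_add_one
    (n - 10 * √(n * Real.log ((H : ℝ) * Fintype.card S * L / δ)))
  rw [trimCount, Nat.cast_min, ← hn]
  refine le_min ?_ (by linarith)
  linarith

variable {M : EpisodicMDP H S A} {σ δ : ℝ} {ξ : S → ℝ} {π : DetPolicy H S A}
  {ξs : Fin L → S → ℝ} {ρ : Fin L → Policy H S A} {θ : Sources L H S A}
  {x : Sample L K H S A}

namespace IsTypical

/-- Kept visits come from trajectories of positive probability, whose tuples and transitions have
positive probability under their source. -/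
theorem mem_coveringSources_of_mem_seenSources (hx : IsTypical M δ ξs ρ θ x)
    (hξs : ∀ l, ξs l ∈ stdSimplex ℝ S) {l : Fin L} {h : Fin H} {s : S} {a : A}
    (hl : l ∈ seenSources x h s a) :
    l ∈ coveringSources ξs ρ θ h s a ∧
      ∀ s', 0 < countNext x l h s a s' → 0 < θ.transition l h s a s' := by
  have hvis : ∀ k ∈ x.2 l h s, (x.1 l k).1 h.castSucc = s := fun k hk =>
    (Finset.mem_filter.1 ((Finset.mem_powersetCard.1 (hx.selection_mem l h s)).1 hk)).2.2
  have hP : ∀ h s a s', 0 ≤ θ.transition l h s a s' := fun h s a => (hx.transition_mem l h s a).1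
  constructor
  · obtain ⟨k, hk⟩ := Finset.card_pos.1 (Finset.mem_filter.1 hl).2
    obtain ⟨hk', rfl⟩ := Finset.mem_filter.1 hk
    have h1 := occupancy_pos_of_trajProb_pos (hξs l).1 hP (hx.trajProb_pos l k) h
    rw [hvis k hk'] at h1
    exact mem_coveringSources.2 h1
  · intro s' hs'
    obtain ⟨k, hk⟩ := Finset.card_pos.1 hs'
    obtain ⟨hk', rfl, rfl⟩ := Finset.mem_filter.1 hk
    have h1 := transition_pos_of_trajProb_pos hP (hx.trajProb_pos l k) h
    rwa [hvis k hk'] at h1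

/-- The constants compose: the halves have at least `K / 3` and `K / 2` trajectories, counts are at
least half their means, trimming leaves `K * μ / 24`, and the choice of the action halves once more,
whence `48`. The threshold `2400` puts all these means above `32 * ℓ`. -/
theorem le_count (hx : IsTypical M δ ξs ρ θ x) (hξs : ∀ l, ξs l ∈ stdSimplex ℝ S)
    (hℓ : 1 / 2 ≤ logFactor S A H L K δ)
    (hlog : Real.log ((H : ℝ) * Fintype.card S * L / δ) ≤ logFactor S A H L K δ)
    {l : Fin L} {h : Fin H} {s : S} {a : A}
    (hd : 2400 * logFactor S A H L K δ ≤
      K * occupancy (ξs l) (ρ l) (θ.transition l) h s a) :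
    K * occupancy (ξs l) (ρ l) (θ.transition l) h s a / 48 ≤ (count x l h s a : ℝ) := by
  have hsel := (Finset.mem_powersetCard.1 (hx.selection_mem l h s)).2
  have hmain := hx.main_count l h s
  have haux := hx.aux_count l h s
  have hact := hx.action_count l h s a
  rw [occupancy_eq _ _ (hx.transition_mem l)] at hd ⊢
  have hμmem := stateDist_mem (hξs l) (ρ l) (hx.transition_mem l) h.2.le
  have hμ0 := hμmem.1 s
  have hμ1 := (mem_Icc_of_mem_stdSimplex hμmem s).2
  set μ := stateDist (ξs l) (ρ l) (θ.transition l) h s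
  set ℓ := logFactor S A H L K δ
  have hρ0 := ((ρ l).prob_mem h s).1 a
  have hρ1 := (mem_Icc_of_mem_stdSimplex ((ρ l).prob_mem h s) a).2
  have hμ : 2400 * ℓ ≤ K * μ := hd.trans <| by
    gcongr
    exact mul_le_of_le_one_right hμ0 hρ1
  have hK0 : (0 : ℝ) ≤ K := Nat.cast_nonneg K
  have hK1 : (2 : ℝ) ≤ K := by nlinarith
  have hK2 : (2 : ℕ) ≤ K := by exact_mod_cast hK1
  have hK3 : K ≤ 3 * (K / 2 : ℕ) := by omega
  have hK4 : K ≤ 2 * (K - K / 2 : ℕ) := by omega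
  have hK3' : (K : ℝ) / 3 ≤ (K / 2 : ℕ) := by
    have : (K : ℝ) ≤ 3 * (K / 2 : ℕ) := by exact_mod_cast hK3
    linarith
  have hK4' : (K : ℝ) / 2 ≤ (K - K / 2 : ℕ) := by
    have : (K : ℝ) ≤ 2 * (K - K / 2 : ℕ) := by exact_mod_cast hK4
    linarith
  have h3 := mul_le_mul_of_nonneg_right hK3' hμ0
  have h4 := mul_le_mul_of_nonneg_right hK4' hμ0
  have h5 := hmain (by linarith)
  have h6 := haux (by linarith)
  have h7 := le_trimCount (δ := δ) (l := l) (h := h) (s := s) (D := x.1) hℓ hlog hμ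
    (by linarith) (by linarith)
  rw [hsel] at hact
  have h8 := mul_le_mul_of_nonneg_right h7 hρ0
  have h9 := hact (by linarith)
  linarith

/-- Burn-in makes every covering source seen, with a count proportional to its mean, and makes the
two error scales at most `p / 100` and `p / 1000`; six times their sum is below `p / 3`. -/
theorem isAccurate (hx : IsTypical M δ ξs ρ θ x) (hξs : ∀ l, ξs l ∈ stdSimplex ℝ S)
    (hℓ : 1 / 2 ≤ logFactor S A H L K δ)
    (hlog : Real.log ((H : ℝ) * Fintype.card S * L / δ) ≤ logFactor S A H L K δ)
    (hι : tupleLog S A H δ ≤ logFactor S A H L K δ)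
    (hB : BurnIn 1000000 δ K M ξs ρ θ) {h : Fin H} {s : S} {a : A}
    (hcov : (coveringSources ξs ρ θ h s a).Nonempty) :
    seenSources x h s a = coveringSources ξs ρ θ h s a ∧ IsAccurate M δ θ x h s a ∧
      ∀ l ∈ coveringSources ξs ρ θ h s a,
        K * occupancy (ξs l) (ρ l) (θ.transition l) h s a / 48 ≤ (count x l h s a : ℝ) := by
  obtain ⟨l₀, hl₀⟩ := hcov
  have hP0 : 0 < Pminsigma M ξs ρ θ := Pminsigma_pos hl₀
  have hP1 : Pminsigma M ξs ρ θ ≤ 1 := Pminsigma_le_one hl₀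
  have hPle : ∀ s', 0 < M.P h s a s' → Pminsigma M ξs ρ θ ≤ M.P h s a s' :=
    fun s' hs' => Pminsigma_le hl₀ hs'
  have hb := fun l (hl : l ∈ coveringSources ξs ρ θ h s a) => hB.bounds hl
  set p := Pminsigma M ξs ρ θ
  set ℓ := logFactor S A H L K δ with hℓdef
  have hp2 : p ^ 2 ≤ 1 := pow_le_one₀ hP0.le hP1
  have hcount : ∀ l ∈ coveringSources ξs ρ θ h s a,
      K * occupancy (ξs l) (ρ l) (θ.transition l) h s a / 48 ≤ (count x l h s a : ℝ) := by
    intro l hl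
    refine hx.le_count hξs hℓ hlog ?_
    have h1 := mem_coveringSources.1 hl
    have h2 := (hb l hl).1
    have h3 : K * occupancy (ξs l) (ρ l) (θ.transition l) h s a * p ^ 2 ≤
        K * occupancy (ξs l) (ρ l) (θ.transition l) h s a :=
      mul_le_of_le_one_right (by positivity) hp2
    linarith
  have hcount' : ∀ l ∈ coveringSources ξs ρ θ h s a,
      1000000 * ℓ ≤ 48 * p ^ 2 * (count x l h s a : ℝ) := by
    intro l hl
    refine (hb l hl).1.trans ?_
    have := mul_le_mul_of_nonneg_right (hcount l hl) (by positivity : 0 ≤ 48 * p ^ 2)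
    linarith
  have hseen : seenSources x h s a = coveringSources ξs ρ θ h s a := by
    refine Finset.Subset.antisymm
      (fun l hl => (hx.mem_coveringSources_of_mem_seenSources hξs hl).1) fun l hl => ?_
    refine Finset.mem_filter.2 ⟨Finset.mem_univ _, Nat.pos_of_ne_zero fun h0 => ?_⟩
    have := hcount' l hl
    rw [h0] at this
    norm_num at this
    linarith
  have hne : (seenSources x h s a).Nonempty := ⟨l₀, hseen ▸ hl₀⟩
  refine ⟨hseen, ⟨hne, (rewardEst_mem hx.reward_mem x h s a).2, ?_,
    hx.transition_dev h s a hne, hx.reward_dev h s a hne, ?_⟩, hcount⟩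
  · intro s' hs'
    rw [transitionEst, Finset.sum_eq_zero, zero_div]
    intro l hl
    have h1 : countNext x l h s a s' = 0 := by
      by_contra h1
      have := (hx.mem_coveringSources_of_mem_seenSources hξs hl).2 s' (Nat.pos_of_ne_zero h1)
      rw [hx.transition_ac l h s a s' hs'] at this
      exact this.false
    rw [h1, Nat.cast_zero, zero_div]
  · intro s' hs'
    have hn0 : (0 : ℝ) < (coveringSources ξs ρ θ h s a).card := by
      exact_mod_cast Finset.card_pos.2 ⟨l₀, hl₀⟩
    have hn1 : (1 : ℝ) ≤ (coveringSources ξs ρ θ h s a).card := by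
      exact_mod_cast Finset.card_pos.2 ⟨l₀, hl₀⟩
    have hℓ0 : 0 < ℓ := by linarith
    have h1 : √(samplingVar δ x h s a) ≤ p / 100 := by
      rw [Real.sqrt_le_left (by positivity), samplingVar, hseen]
      set n : ℝ := ((coveringSources ξs ρ θ h s a).card : ℝ) with hn
      have hterm : ∀ l ∈ coveringSources ξs ρ θ h s a,
          tupleLog S A H δ / (n ^ 2 * (count x l h s a : ℝ)) ≤ (p / 100) ^ 2 / n := by
        intro l hl
        have h2 := hcount' l hl
        have h3 : 0 < (count x l h s a : ℝ) := by
          rw [← hseen] at hl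
          exact_mod_cast (Finset.mem_filter.1 hl).2
        rw [div_le_div_iff₀ (by positivity) hn0]
        -- Because `48 / 1000000 ≤ (1 / 100) ^ 2`.
        have h4 : tupleLog S A H δ ≤ (p / 100) ^ 2 * (count x l h s a : ℝ) := by nlinarith
        have h5 : 0 ≤ (p / 100) ^ 2 * (count x l h s a : ℝ) := by positivity
        calc tupleLog S A H δ * n ≤ (p / 100) ^ 2 * (count x l h s a : ℝ) * n := by gcongr
          _ ≤ (p / 100) ^ 2 * (count x l h s a : ℝ) * n ^ 2 := by
            gcongr
            nlinarith
          _ = _ := by ring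
      refine (Finset.sum_le_sum hterm).trans (le_of_eq ?_)
      rw [Finset.sum_const, nsmul_eq_mul, ← hn]
      field_simp
    have h2 : √(sourceVar δ x h s a) ≤ p / 1000 := by
      rw [Real.sqrt_le_left (by positivity), sourceVar, hseen, div_le_iff₀ hn0]
      have := (hb l₀ hl₀).2
      nlinarith
    have h3 := hPle s' hs'
    linarith

end IsTypical

end Typical

/-! ### Summing the bonuses along the comparator. -/

section GapBound

variable {L K H : ℕ} {S A : Type*} [Fintype S] [DecidableEq S] [Fintype A] [DecidableEq A]
  {M : EpisodicMDP H S A} {c σ δ : ℝ} {ξ : S → ℝ} {π : DetPolicy H S A}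
  {ξs : Fin L → S → ℝ} {ρ : Fin L → Policy H S A} {θ : Sources L H S A}
  {x : Sample L K H S A}

/-- With `r = √(card S)`, the square `(r * √d - 1) ^ 2 ≥ 0` gives `√d ≤ r * d / 2 + 1 / (2 * r)`,
which sums to `r`; the second part of the summand also sums to `r`. -/
theorem sum_sqrt_add_le [Nonempty S] {d : S → ℝ} (hd : d ∈ stdSimplex ℝ S) :
    ∑ s, (√(d s) + √(Fintype.card S : ℝ) * d s) ≤ 2 * √(Fintype.card S : ℝ) := by
  have hS : (0 : ℝ) < Fintype.card S := by exact_mod_cast Fintype.card_pos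
  have hr : 0 < √(Fintype.card S : ℝ) := Real.sqrt_pos.2 hS
  have hr2 := Real.sq_sqrt hS.le
  set r := √(Fintype.card S : ℝ)
  have hterm : ∀ s, √(d s) + r * d s ≤ 3 / 2 * r * d s + 1 / (2 * r) := by
    intro s
    have h1 := Real.sq_sqrt (hd.1 s)
    have h2 : √(d s) ≤ r * d s / 2 + 1 / (2 * r) := by
      have h3 : r * d s / 2 + 1 / (2 * r) - √(d s) = (r * √(d s) - 1) ^ 2 / (2 * r) := by
        field_simp
        nlinarith
      have h4 : 0 ≤ (r * √(d s) - 1) ^ 2 / (2 * r) := by positivity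
      linarith
    linarith
  calc _ ≤ ∑ s, (3 / 2 * r * d s + 1 / (2 * r)) := Finset.sum_le_sum fun s _ => hterm s
    _ = 3 / 2 * r + r ^ 2 * (1 / (2 * r)) := by
      rw [Finset.sum_add_distrib, ← Finset.mul_sum, hd.2, Finset.sum_const, Finset.card_univ,
        nsmul_eq_mul, hr2, mul_one]
    _ = 2 * r := by
      field_simp
      ring

/-- A clipped average controls the unclipped one. -/
theorem mul_sqrt_le_of_min_mul_le {d m X C : ℝ} (hd : 0 < d) (hm : 0 < m) (hX : 0 ≤ X)
    (h : min d (1 / m) * X ≤ C) : d * √X ≤ √C * (√d + √m * d) := by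
  have hC : 0 ≤ C := le_trans (by positivity) h
  -- Unclipped, `d * √X = √d * √(d * X)` gives the first term. Clipped, `X ≤ m * C` gives the
  -- second.
  rcases le_total d (1 / m) with h1 | h1
  · rw [min_eq_left h1] at h
    calc d * √X = √d * √(d * X) := by
          rw [Real.sqrt_mul hd.le, ← mul_assoc, Real.mul_self_sqrt hd.le]
      _ ≤ √d * √C := by gcongr
      _ ≤ √C * (√d + √m * d) := by
          have : 0 ≤ √C * (√m * d) := by positivity
          linarith
  · rw [min_eq_right h1, one_div, inv_mul_le_iff₀ hm] at h
    calc d * √X ≤ d * √(m * C) := by gcongr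
      _ = √C * (√m * d) := by rw [Real.sqrt_mul hm.le]; ring
      _ ≤ √C * (√d + √m * d) := by gcongr; linarith [Real.sqrt_nonneg d]

/-- Counts proportional to `K * o l` turn the variance into an average of inverse occupancies, which
`Cdagger` controls after clipping. One factor `1 / N.card` is spent on `Ldagger`, the other forms
the average; `7` bounds `√48`. -/
theorem stateDist_mul_sqrt_samplingVar_le [Nonempty S] (hK : 1 ≤ K)
    {P' : Transition H S A} (hP' : P' ∈ uncertaintySet σ M.P) {h : Fin H} {s : S}
    (hd : 0 < stateDist ξ π.toPolicy P' h s) (hLd : 0 < Ldagger M σ ξ π ξs ρ θ)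
    (hℓ : 0 ≤ logFactor S A H L K δ)
    (hι : tupleLog S A H δ ≤ logFactor S A H L K δ)
    (hseen : seenSources x h s (π h s) = coveringSources ξs ρ θ h s (π h s))
    (hcount : ∀ l ∈ coveringSources ξs ρ θ h s (π h s),
      K * occupancy (ξs l) (ρ l) (θ.transition l) h s (π h s) / 48 ≤
        (count x l h s (π h s) : ℝ)) :
    stateDist ξ π.toPolicy P' h s * √(samplingVar δ x h s (π h s)) ≤
      7 * √(logFactor S A H L K δ) * (√(Cdagger M σ ξ π ξs ρ θ) /
          √((Ldagger M σ ξ π ξs ρ θ : ℝ) * K)) *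
        (√(stateDist ξ π.toPolicy P' h s) +
          √(Fintype.card S : ℝ) * stateDist ξ π.toPolicy P' h s) := by
  have hocc : occupancy ξ π.toPolicy P' h s (π h s) = stateDist ξ π.toPolicy P' h s :=
    occupancy_toPolicy (fun h s a => (hP' h s a).1) h s
  have hcard := Ldagger_le (ξs := ξs) (ρ := ρ) (θ := θ) hP' (hocc ▸ hd)
  have hC := le_Cdagger (ξ := ξ) (π := π) (ξs := ξs) (ρ := ρ) (θ := θ) hP' h s (π h s)
  rw [hocc] at hC
  set d := stateDist ξ π.toPolicy P' h s
  set ℓ := logFactor S A H L K δ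
  set N := coveringSources ξs ρ θ h s (π h s)
  set o := fun l => occupancy (ξs l) (ρ l) (θ.transition l) h s (π h s) with ho
  have ho0 : ∀ l ∈ N, 0 < o l := fun l hl => mem_coveringSources.1 hl
  have hK0 : (0 : ℝ) < K := by exact_mod_cast hK
  have hS : (0 : ℝ) < Fintype.card S := by exact_mod_cast Fintype.card_pos
  have hLd0 : (0 : ℝ) < Ldagger M σ ξ π ξs ρ θ := by exact_mod_cast hLd
  have hn : (Ldagger M σ ξ π ξs ρ θ : ℝ) ≤ N.card := by exact_mod_cast hcard
  have hn0 : (0 : ℝ) < N.card := hLd0.trans_le hn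
  set Λ : ℝ := (Ldagger M σ ξ π ξs ρ θ : ℝ)
  set X : ℝ := ∑ l ∈ N, 1 / ((N.card : ℝ) * o l) with hX
  have hX0 : 0 ≤ X := Finset.sum_nonneg fun l hl => by
    have := ho0 l hl
    positivity
  have hmin : min d (1 / (Fintype.card S : ℝ)) * X ≤ Cdagger M σ ξ π ξs ρ θ := by
    rw [hX, Finset.mul_sum]
    simp only [mul_one_div]
    exact hC
  have hvar : samplingVar δ x h s (π h s) ≤ 48 * ℓ / (Λ * K) * X := by
    rw [samplingVar, hseen, hX, Finset.mul_sum]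
    refine Finset.sum_le_sum fun l hl => ?_
    have h0 := ho0 l hl
    have h1 := hcount l hl
    have h2 : 0 < K * o l / 48 := by positivity
    calc tupleLog S A H δ / ((N.card : ℝ) ^ 2 * (count x l h s (π h s) : ℝ))
        ≤ ℓ / ((N.card : ℝ) ^ 2 * (K * o l / 48)) := by
          have h3 : 0 < (N.card : ℝ) ^ 2 * (K * o l / 48) := by positivity
          calc _ ≤ ℓ / ((N.card : ℝ) ^ 2 * (count x l h s (π h s) : ℝ)) := by gcongr
            _ ≤ _ := by gcongr
      _ = 48 * ℓ / (N.card * K) * (1 / (N.card * o l)) := by field_simp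
      _ ≤ 48 * ℓ / (Λ * K) * (1 / (N.card * o l)) := by gcongr
  have h48 : √(48 : ℝ) ≤ 7 := by
    rw [Real.sqrt_le_left (by norm_num)]
    norm_num
  calc d * √(samplingVar δ x h s (π h s)) ≤ d * √(48 * ℓ / (Λ * K) * X) := by gcongr
    _ = √48 * √ℓ / √(Λ * K) * (d * √X) := by
      rw [Real.sqrt_mul (by positivity), Real.sqrt_div (by positivity),
        Real.sqrt_mul (by norm_num)]
      ring
    _ ≤ 7 * √ℓ / √(Λ * K) * (√(Cdagger M σ ξ π ξs ρ θ) *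
          (√d + √(Fintype.card S : ℝ) * d)) := by
      have := mul_sqrt_le_of_min_mul_le hd hS hX0 hmin
      gcongr
    _ = _ := by ring

/-- The bound on the robust gap at typical outcomes. -/
theorem IsTypical.robustGap_le [Nonempty S] [Nonempty A] (hx : IsTypical M δ ξs ρ θ x)
    (hH : 1 ≤ H) (hL : 1 ≤ L) (hK : 1 ≤ K) (hσ : 0 < σ) (hδ0 : 0 < δ) (hδ1 : δ < 1)
    (hA : 2 ≤ Fintype.card A) (hξ : ξ ∈ stdSimplex ℝ S) (hξs : ∀ l, ξs l ∈ stdSimplex ℝ S)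
    (hc : 9 ≤ c) (hB : BurnIn 1000000 δ K M ξs ρ θ) (hLd : 0 < Ldagger M σ ξ π ξs ρ θ)
    {π' : DetPolicy H S A} (hπ' : IsOutput c σ δ θ x π') :
    robustGap M σ ξ π π' ≤ 100 * c * logFactor S A H L K δ * rate K M σ ξ π ξs ρ θ := by
  have hℓ := half_le_logFactor (S := S) (A := A) hH hL hK hδ0 hδ1 hA
  have hlog := log_visits_le_logFactor (S := S) (A := A) hH hL hK hδ0
  have hι := tupleLog_le_logFactor (S := S) (A := A) hH hL hK hδ0
  have hacc := fun {h s a} (hcov : (coveringSources ξs ρ θ h s a).Nonempty) =>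
    hx.isAccurate hξs hℓ hlog hι hB hcov
  -- Positivity of `Ldagger` means that all tuples the comparator can reach in some model are
  -- covered.
  have hcov : ∀ {P'}, P' ∈ uncertaintySet σ M.P → ∀ {h : Fin H} {s},
      0 < stateDist ξ π.toPolicy P' h s → (coveringSources ξs ρ θ h s (π h s)).Nonempty := by
    intro P' hP' h s hd
    rw [← occupancy_toPolicy (fun h s a => (hP' h s a).1)] at hd
    exact Finset.card_pos.1 (hLd.trans_le (Ldagger_le hP' hd))
  obtain ⟨P', hP', hgap⟩ := exists_robustGap_le_bonus hc hσ hξ.1 hx.reward_mem (M := M) (π := π)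
    hπ' (fun h s a hne => (hacc (hne.mono fun l hl =>
      (hx.mem_coveringSources_of_mem_seenSources hξs hl).1)).2.1)
    fun h s ⟨P', hP', hd⟩ => (hacc (hcov hP' hd)).2.1
  refine hgap.trans ?_
  have hdmem : ∀ h : Fin H, stateDist ξ π.toPolicy P' h ∈ stdSimplex ℝ S := fun h =>
    stateDist_mem hξ _ (fun h s a => (hP' h s a).1) h.2.le
  have hC0 : 0 ≤ Cdagger M σ ξ π ξs ρ θ := Cdagger_nonneg hξ.1
  have hq0 := Pminstar_nonneg (M := M) (ξ := ξ) (π := π)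
  have hLd0 : (0 : ℝ) < Ldagger M σ ξ π ξs ρ θ := by exact_mod_cast hLd
  have hbonus : ∀ (h : Fin H) s, 0 < stateDist ξ π.toPolicy P' h s →
      stateDist ξ π.toPolicy P' h s * (2 * bonus c σ δ x h s (π h s)) ≤
      3 * c * √(logFactor S A H L K δ) * (7 * (H / (σ * Pminstar M ξ π)) *
          (√(Cdagger M σ ξ π ξs ρ θ) / √((Ldagger M σ ξ π ξs ρ θ : ℝ) * K)) *
        (√(stateDist ξ π.toPolicy P' h s) +
          √(Fintype.card S : ℝ) * stateDist ξ π.toPolicy P' h s) +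
        (1 + H / (σ * Pminstar M ξ π)) / √(Ldagger M σ ξ π ξs ρ θ : ℝ) *
          stateDist ξ π.toPolicy P' h s) := by
    intro h s hd
    obtain ⟨hseen, hac, hcount⟩ := hacc (hcov hP' hd)
    -- `Pminstar` only sees tuples visited nominally; reachability under `P'` implies this.
    have hnom : 0 < occupancy ξ π.toPolicy M.P h s (π h s) := by
      rw [occupancy_toPolicy M.P_mem]
      exact stateDist_pos_of_mem_uncertaintySet hξ.1 _ hP' hd
    have hq : 0 < Pminstar M ξ π := Pminstar_pos hnom
    have h1 := hac.bonus_le (c := c) hσ (by linarith) hq fun s' hs' => Pminstar_le hnom hs'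
    have h2 := stateDist_mul_sqrt_samplingVar_le (x := x) (δ := δ) hK hP' hd hLd (by linarith)
      hι hseen hcount
    have h3 : √(sourceVar δ x h s (π h s)) ≤
        √(logFactor S A H L K δ) / √(Ldagger M σ ξ π ξs ρ θ : ℝ) := by
      rw [← Real.sqrt_div' _ hLd0.le]
      refine Real.sqrt_le_sqrt ?_
      rw [sourceVar, hseen]
      have hd' := hd
      rw [← occupancy_toPolicy (fun h s a => (hP' h s a).1)] at hd'
      have h4 : (Ldagger M σ ξ π ξs ρ θ : ℝ) ≤
          ((coveringSources ξs ρ θ h s (π h s)).card : ℝ) := by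
        exact_mod_cast Ldagger_le hP' hd'
      gcongr
    set d := stateDist ξ π.toPolicy P' h s
    calc d * (2 * bonus c σ δ x h s (π h s))
        ≤ d * (2 * (3 / 2 * c * (H / (σ * Pminstar M ξ π) * √(samplingVar δ x h s (π h s)) +
          (1 + H / (σ * Pminstar M ξ π)) * √(sourceVar δ x h s (π h s))))) := by gcongr
      _ = 3 * c * (H / (σ * Pminstar M ξ π) * (d * √(samplingVar δ x h s (π h s))) +
          (1 + H / (σ * Pminstar M ξ π)) * √(sourceVar δ x h s (π h s)) * d) := by ring
      _ ≤ 3 * c * (H / (σ * Pminstar M ξ π) * (7 * √(logFactor S A H L K δ) *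
            (√(Cdagger M σ ξ π ξs ρ θ) / √((Ldagger M σ ξ π ξs ρ θ : ℝ) * K)) *
            (√d + √(Fintype.card S : ℝ) * d)) +
          (1 + H / (σ * Pminstar M ξ π)) *
            (√(logFactor S A H L K δ) / √(Ldagger M σ ξ π ξs ρ θ : ℝ)) * d) := by gcongr
      _ = _ := by ring
  have hsum : ∀ h : Fin H,
      ∑ s, stateDist ξ π.toPolicy P' h s * (2 * bonus c σ δ x h s (π h s)) ≤
      3 * c * √(logFactor S A H L K δ) * (7 * (H / (σ * Pminstar M ξ π)) *
          (√(Cdagger M σ ξ π ξs ρ θ) / √((Ldagger M σ ξ π ξs ρ θ : ℝ) * K)) *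
        (2 * √(Fintype.card S : ℝ)) +
        (1 + H / (σ * Pminstar M ξ π)) / √(Ldagger M σ ξ π ξs ρ θ : ℝ)) := by
    intro h
    have h1 : ∀ s, stateDist ξ π.toPolicy P' h s * (2 * bonus c σ δ x h s (π h s)) ≤
      3 * c * √(logFactor S A H L K δ) * (7 * (H / (σ * Pminstar M ξ π)) *
          (√(Cdagger M σ ξ π ξs ρ θ) / √((Ldagger M σ ξ π ξs ρ θ : ℝ) * K)) *
        (√(stateDist ξ π.toPolicy P' h s) +
          √(Fintype.card S : ℝ) * stateDist ξ π.toPolicy P' h s) +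
        (1 + H / (σ * Pminstar M ξ π)) / √(Ldagger M σ ξ π ξs ρ θ : ℝ) *
          stateDist ξ π.toPolicy P' h s) := by
      intro s
      rcases ((hdmem h).1 s).eq_or_lt with h0 | h0
      · simp [← h0]
      · exact hbonus h s h0
    refine (Finset.sum_le_sum fun s _ => h1 s).trans ?_
    rw [← Finset.mul_sum, Finset.sum_add_distrib, ← Finset.mul_sum, ← Finset.mul_sum,
      (hdmem h).2, mul_one]
    have h2 := sum_sqrt_add_le (hdmem h)
    gcongr
  refine (Finset.sum_le_sum fun h _ => hsum h).trans ?_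
  rw [Finset.sum_const, Finset.card_univ, Fintype.card_fin, nsmul_eq_mul, rate]
  have hsq : √(Cdagger M σ ξ π ξs ρ θ * (H : ℝ) ^ 4 * Fintype.card S) =
      √(Cdagger M σ ξ π ξs ρ θ) * (H : ℝ) ^ 2 * √(Fintype.card S : ℝ) := by
    rw [Real.sqrt_mul (by positivity), Real.sqrt_mul hC0]
    congr 2
    rw [show (H : ℝ) ^ 4 = ((H : ℝ) ^ 2) ^ 2 by ring, Real.sqrt_sq (by positivity)]
  rw [hsq]
  -- Trading `√ℓ` for `ℓ` gives a natural exponent; any `ℓ ≥ 1 / 4` allows it.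
  have hsqrtℓ : √(logFactor S A H L K δ) ≤ 2 * logFactor S A H L K δ := by
    rw [Real.sqrt_le_left (by linarith)]
    nlinarith
  set ℓ := logFactor S A H L K δ
  set q := Pminstar M ξ π
  set Λ : ℝ := (Ldagger M σ ξ π ξs ρ θ : ℝ)
  set C := Cdagger M σ ξ π ξs ρ θ
  calc (H : ℝ) * (3 * c * √ℓ * (7 * (H / (σ * q)) * (√C / √(Λ * K)) *
        (2 * √(Fintype.card S : ℝ)) + (1 + H / (σ * q)) / √Λ))
      = 3 * c * √ℓ * (14 * (√C * (H : ℝ) ^ 2 * √(Fintype.card S : ℝ) / (σ * q * √(Λ * K))) +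
        (H + (H : ℝ) ^ 2 / (σ * q)) / √Λ) := by ring
    _ ≤ 3 * c * (2 * ℓ) * (14 * (√C * (H : ℝ) ^ 2 * √(Fintype.card S : ℝ) /
          (σ * q * √(Λ * K))) + 14 * ((H + (H : ℝ) ^ 2 / (σ * q)) / √Λ)) := by
        gcongr
        have : 0 ≤ (H + (H : ℝ) ^ 2 / (σ * q)) / √Λ := by positivity
        linarith
    _ = 84 * c * ℓ * (√C * (H : ℝ) ^ 2 * √(Fintype.card S : ℝ) / (σ * q * √(Λ * K)) +
          (H + (H : ℝ) ^ 2 / (σ * q)) / √Λ) := by ring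
    _ ≤ _ := by gcongr; norm_num

end GapBound

/-! ### Sums against product weights. -/

section ProductSums

variable {ι X Y : Type*} [Fintype ι] [DecidableEq ι] [Fintype X] [Fintype Y] [DecidableEq Y]

theorem sum_prod_eq_prod_sum (f : ι → X → ℝ) :
    ∑ z : ι → X, ∏ i, f i (z i) = ∏ i, ∑ x, f i x := by
  rw [Finset.prod_univ_sum, Fintype.piFinset_univ]

theorem sum_prod_mul_exp (p f : ι → X → ℝ) :
    ∑ z : ι → X, (∏ i, p i (z i)) * Real.exp (∑ i, f i (z i)) =
      ∏ i, ∑ x, p i x * Real.exp (f i x) := by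
  rw [← sum_prod_eq_prod_sum]
  refine Finset.sum_congr rfl fun z _ => ?_
  rw [Real.exp_sum, Finset.prod_mul_distrib]

/-- The image of a product weight under a map of the coordinates. -/
theorem sum_prod_mul_comp (w : ι → X → ℝ) (φ : X → Y) (G : (ι → Y) → ℝ) :
    ∑ D : ι → X, (∏ i, w i (D i)) * G (fun i => φ (D i)) =
      ∑ y : ι → Y, (∏ i, ∑ x, if φ x = y i then w i x else 0) * G y := by
  simp only [← sum_prod_eq_prod_sum (fun i x => if φ x = _ then w i x else 0), Finset.sum_mul]
  rw [Finset.sum_comm]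
  refine Finset.sum_congr rfl fun D _ => ?_
  rw [Finset.sum_eq_single fun i => φ (D i)]
  · simp
  · intro y _ hy
    obtain ⟨i, hi⟩ := Function.ne_iff.1 hy
    rw [Finset.prod_eq_zero (Finset.mem_univ i) (if_neg (Ne.symm hi)), zero_mul]
  · simp

/-- The marginal of a product of probability weights at one coordinate. -/
theorem sum_prod_mul_apply {w : ι → X → ℝ} (j : ι) (hw : ∀ i ≠ j, ∑ x, w i x = 1)
    (g : X → ℝ) : ∑ z : ι → X, (∏ i, w i (z i)) * g (z j) = ∑ x, w j x * g x := by
  have h : ∀ z : ι → X, (∏ i, w i (z i)) * g (z j) =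
      ∏ i, (w i (z i) * if i = j then g (z i) else 1) := by
    intro z
    rw [Finset.prod_mul_distrib, Finset.prod_ite_eq' Finset.univ j]
    simp
  simp only [h]
  rw [sum_prod_eq_prod_sum (fun i x => w i x * if i = j then g x else 1),
    Finset.prod_eq_single j]
  · simp
  · intro i _ hi
    simp [hi, hw i hi]
  · simp

theorem sum_prod_eq_one {w : ι → X → ℝ} (hw : ∀ i, w i ∈ stdSimplex ℝ X) :
    ∑ z : ι → X, ∏ i, w i (z i) = 1 := by
  rw [sum_prod_eq_prod_sum, Finset.prod_eq_one fun i _ => (hw i).2]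

theorem sum_mul_le_of_sum_eq_one {w f : X → ℝ} {B : ℝ} (hw0 : ∀ x, 0 ≤ w x)
    (hw1 : ∑ x, w x = 1) (hf : ∀ x, w x ≠ 0 → f x ≤ B) : ∑ x, w x * f x ≤ B := by
  calc ∑ x, w x * f x ≤ ∑ x, w x * B := Finset.sum_le_sum fun x _ => by
        rcases (hw0 x).eq_or_lt with h | h
        · simp [← h]
        · exact mul_le_mul_of_nonneg_left (hf x h.ne') h.le
    _ = B := by rw [← Finset.sum_mul, hw1, one_mul]

end ProductSums

/-! ### Exponential moments of centered indicators and of counts. -/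

section ExponentialMoments

/-- For a centered variable bounded by one, applied to `u` times it, the linear term averages out
and `exp (u ^ 2)` remains. For `|x| ≤ 1` use `exp x ≤ 1 + x + x ^ 2`, otherwise `|x| ≤ x ^ 2`. -/
theorem exp_le_add_exp_sq (x : ℝ) : Real.exp x ≤ x + Real.exp (x ^ 2) := by
  have h1 := Real.add_one_le_exp (x ^ 2)
  rcases le_or_gt |x| 1 with hx | hx
  · have h2 := (abs_le.1 (Real.abs_exp_sub_one_sub_id_le hx)).2
    linarith
  · rcases lt_abs.1 hx with h | h
    · have h2 : Real.exp x ≤ Real.exp (x ^ 2) := Real.exp_le_exp.2 (by nlinarith)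
      linarith
    · have h2 : Real.exp x ≤ 1 := Real.exp_le_one_iff.2 (by linarith)
      nlinarith

variable {ι X : Type*} [Fintype ι] [DecidableEq ι] [Fintype X] [DecidableEq X]

/-- A sub-Gaussian bound for centered weighted indicators. -/
theorem sum_prod_mul_exp_le {p : ι → X → ℝ} (hp : ∀ i, p i ∈ stdSimplex ℝ X) (u : ι → ℝ)
    (x₀ : X) :
    ∑ z : ι → X, (∏ i, p i (z i)) *
        Real.exp (∑ i, u i * ((if z i = x₀ then 1 else 0) - p i x₀)) ≤
      Real.exp (∑ i, u i ^ 2) := by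
  rw [sum_prod_mul_exp p fun i x => u i * ((if x = x₀ then 1 else 0) - p i x₀), Real.exp_sum]
  refine Finset.prod_le_prod (fun i _ => Finset.sum_nonneg fun x _ =>
    mul_nonneg ((hp i).1 x) (Real.exp_pos _).le) fun i _ => ?_
  obtain ⟨h0, h1⟩ := mem_Icc_of_mem_stdSimplex (hp i) x₀
  have hterm : ∀ x, p i x * Real.exp (u i * ((if x = x₀ then 1 else 0) - p i x₀)) ≤
      p i x * (u i * ((if x = x₀ then 1 else 0) - p i x₀)) + p i x * Real.exp (u i ^ 2) := by
    intro x
    rw [← mul_add]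
    refine mul_le_mul_of_nonneg_left ((exp_le_add_exp_sq _).trans ?_) ((hp i).1 x)
    refine add_le_add_right (Real.exp_le_exp.2 ?_) _
    rw [mul_pow]
    refine mul_le_of_le_one_right (sq_nonneg _) ?_
    split_ifs <;> nlinarith
  refine (Finset.sum_le_sum fun x _ => hterm x).trans (le_of_eq ?_)
  rw [Finset.sum_add_distrib, ← Finset.sum_mul, (hp i).2, one_mul, add_eq_right]
  have h2 : ∀ x, p i x * (u i * ((if x = x₀ then 1 else 0) - p i x₀)) =
      u i * (if x = x₀ then p i x else 0) - u i * p i x₀ * p i x := fun x => by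
    split_ifs <;> ring
  simp only [h2, Finset.sum_sub_distrib, ← Finset.mul_sum, (hp i).2]
  simp

/-- A lower-tail Chernoff bound for the number of hits of a point. -/
theorem sum_prod_mul_exp_neg_card_le {p : ι → X → ℝ} (hp : ∀ i, p i ∈ stdSimplex ℝ X)
    (I : Finset ι) (x₀ : X) {r : ℝ} (hr : ∀ i ∈ I, p i x₀ = r) :
    ∑ z : ι → X, (∏ i, p i (z i)) * Real.exp (-((I.filter fun i => z i = x₀).card : ℝ)) ≤
      Real.exp (-(5 / 8 * I.card * r)) := by
  have hcard : ∀ z : ι → X, -((I.filter fun i => z i = x₀).card : ℝ) =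
      ∑ i, if i ∈ I ∧ z i = x₀ then (-1 : ℝ) else 0 := by
    intro z
    rw [← Finset.sum_filter, Finset.sum_const, nsmul_eq_mul, mul_neg_one]
    congr 3
    ext i
    simp
  simp only [hcard]
  rw [sum_prod_mul_exp p fun i x => if i ∈ I ∧ x = x₀ then (-1 : ℝ) else 0]
  -- Each index in `I` then contributes a factor of at most `1 - 5 / 8 * r ≤ exp (-(5 / 8 * r))`.
  have hexp : Real.exp (-1) ≤ 3 / 8 := by
    rw [Real.exp_neg, inv_le_comm₀ (Real.exp_pos _) (by norm_num)]
    have := Real.exp_one_gt_d9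
    norm_num
    linarith
  have hfac : ∀ i, ∑ x, p i x * Real.exp (if i ∈ I ∧ x = x₀ then (-1 : ℝ) else 0) ≤
      Real.exp (if i ∈ I then -(5 / 8 * r) else 0) := by
    intro i
    by_cases hi : i ∈ I
    · have h1 : ∀ x, p i x * Real.exp (if i ∈ I ∧ x = x₀ then (-1 : ℝ) else 0) =
          p i x + if x = x₀ then p i x * (Real.exp (-1) - 1) else 0 := by
        intro x
        by_cases hx : x = x₀
        · simp [hi, hx]
          ring
        · simp [hx]
      simp only [h1]
      rw [Finset.sum_add_distrib, (hp i).2, Finset.sum_ite_eq', if_pos (Finset.mem_univ _),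
        if_pos hi]
      have h2 := (hp i).1 x₀
      rw [hr i hi] at h2 ⊢
      have h3 := Real.add_one_le_exp (-(5 / 8 * r))
      nlinarith
    · simp [hi, (hp i).2]
  calc _ ≤ ∏ i, Real.exp (if i ∈ I then -(5 / 8 * r) else 0) :=
        Finset.prod_le_prod (fun i _ => Finset.sum_nonneg fun x _ =>
          mul_nonneg ((hp i).1 x) (Real.exp_pos _).le) fun i _ => hfac i
    _ = _ := by
      rw [← Real.exp_sum, Finset.sum_ite_mem, Finset.univ_inter, Finset.sum_const, nsmul_eq_mul]
      congr 1
      ring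

end ExponentialMoments

/-! ### Joint law of states, kept sets, actions and next states at one step. -/

section Marginals

variable {L K H : ℕ} {S A : Type*} [Fintype S] [DecidableEq S] [Fintype A] [DecidableEq A]

/-- The states of all trajectories at step `h`. -/
def stepStates (D : Dataset L K H S A) (h : Fin H) : Fin L × Fin K → S :=
  fun i => (D i.1 i.2).1 h.castSucc

/-- The actions of all trajectories at step `h`. -/
def stepActions (D : Dataset L K H S A) (h : Fin H) : Fin L × Fin K → A :=
  fun i => (D i.1 i.2).2 h

/-- The states of all trajectories after step `h`. -/
def stepNext (D : Dataset L K H S A) (h : Fin H) : Fin L × Fin K → S :=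
  fun i => (D i.1 i.2).1 h.succ

/-- The probability of the states at step `h`. -/
noncomputable def stateWeight (ξs : Fin L → S → ℝ) (ρ : Fin L → Policy H S A)
    (θ : Sources L H S A) (h : Fin H) (z : Fin L × Fin K → S) : ℝ :=
  ∏ i, stateDist (ξs i.1) (ρ i.1) (θ.transition i.1) h (z i)

/-- The probability of the actions at step `h`, given the states. -/
noncomputable def actionWeight (ρ : Fin L → Policy H S A) (h : Fin H) (z : Fin L × Fin K → S)
    (α : Fin L × Fin K → A) : ℝ :=
  ∏ i, (ρ i.1).prob h (z i) (α i)

/-- The probability of the next states at step `h`, given the states and actions. -/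
noncomputable def nextWeight (θ : Sources L H S A) (h : Fin H) (z : Fin L × Fin K → S)
    (α : Fin L × Fin K → A) (η : Fin L × Fin K → S) : ℝ :=
  ∏ i, θ.transition i.1 h (z i) (α i) (η i)

theorem datasetProb_curry (ξs : Fin L → S → ℝ) (ρ : Fin L → Policy H S A) (θ : Sources L H S A)
    (D : Fin L × Fin K → Trajectory H S A) :
    datasetProb ξs ρ θ (Function.curry D) =
      ∏ i, trajProb (ξs i.1) (ρ i.1) (θ.transition i.1) (D i) := by
  rw [datasetProb, Fintype.prod_prod_type]
  rfl

/-- The joint law of the states, actions and next states at one step of all trajectories. -/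
theorem sum_datasetProb_mul (ξs : Fin L → S → ℝ) (ρ : Fin L → Policy H S A)
    {θ : Sources L H S A} (hθ : ∀ l h s a, θ.transition l h s a ∈ stdSimplex ℝ S) (h : Fin H)
    (G : (Fin L × Fin K → S) → (Fin L × Fin K → A) → (Fin L × Fin K → S) → ℝ) :
    ∑ D : Dataset L K H S A, datasetProb ξs ρ θ D *
        G (stepStates D h) (stepActions D h) (stepNext D h) =
      ∑ z, stateWeight ξs ρ θ h z * ∑ α, actionWeight ρ h z α *
        ∑ η, nextWeight θ h z α η * G z α η := by
  rw [← (Equiv.curry (Fin L) (Fin K) (Trajectory H S A)).sum_comp]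
  have h1 := sum_prod_mul_comp
    (fun (i : Fin L × Fin K) τ => trajProb (ξs i.1) (ρ i.1) (θ.transition i.1) τ)
    (fun τ : Trajectory H S A => (τ.1 h.castSucc, τ.2 h, τ.1 h.succ))
    (fun y => G (fun i => (y i).1) (fun i => (y i).2.1) (fun i => (y i).2.2))
  have h2 : ∀ (i : Fin L × Fin K) (y : S × A × S),
      (∑ τ : Trajectory H S A, if (τ.1 h.castSucc, τ.2 h, τ.1 h.succ) = y then
        trajProb (ξs i.1) (ρ i.1) (θ.transition i.1) τ else 0) =
      stateDist (ξs i.1) (ρ i.1) (θ.transition i.1) h y.1 *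
        (ρ i.1).prob h y.1 y.2.1 * θ.transition i.1 h y.1 y.2.1 y.2.2 := by
    rintro i ⟨s, a, s'⟩
    have := sum_trajProb_mul (ξs i.1) (ρ i.1) (hθ i.1) h
      fun s₁ a₁ s₁' => if (s₁, a₁, s₁') = (s, a, s') then 1 else 0
    simp only [mul_ite, mul_one, mul_zero] at this
    rw [this]
    simp only [Prod.mk.injEq, ite_and, Finset.sum_ite_irrel, Finset.sum_const_zero,
      Finset.sum_ite_eq', Finset.mem_univ, if_true]
  simp only [h2] at h1
  simp only [Equiv.curry_apply, datasetProb_curry]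
  refine Eq.trans h1 ?_
  rw [← (((Equiv.arrowProdEquivProdArrow _ (fun _ => S) (fun _ => A × S)).trans
    ((Equiv.refl _).prodCongr
      (Equiv.arrowProdEquivProdArrow _ (fun _ => A) (fun _ => S)))).symm).sum_comp,
    Fintype.sum_prod_type]
  refine Finset.sum_congr rfl fun z _ => ?_
  rw [Fintype.sum_prod_type, Finset.mul_sum]
  refine Finset.sum_congr rfl fun α _ => ?_
  rw [Finset.mul_sum, Finset.mul_sum]
  refine Finset.sum_congr rfl fun η _ => ?_
  simp only [stateWeight, actionWeight, nextWeight, ← mul_assoc, ← Finset.prod_mul_distrib]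
  rfl

/-- The trajectories of source `l` with indices in `p` that are in state `s`. -/
def visits (p : Fin K → Prop) [DecidablePred p] (z : Fin L × Fin K → S) (l : Fin L) (s : S) :
    Finset (Fin K) :=
  {k | p k ∧ z (l, k) = s}

/-- The number of kept transitions in terms of the states at the step. -/
noncomputable def trimSize (H : ℕ) (δ : ℝ) (z : Fin L × Fin K → S) (l : Fin L) (s : S) : ℕ :=
  min ⌊((visits (fun k => ¬ (k : ℕ) < K / 2) z l s).card : ℝ) -
      10 * √(((visits (fun k => ¬ (k : ℕ) < K / 2) z l s).card : ℝ) *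
        Real.log ((H : ℝ) * Fintype.card S * L / δ))⌋₊
    (visits (fun k => (k : ℕ) < K / 2) z l s).card

/-- The probability of a set under the uniform distribution on the subsets of size `t`. -/
noncomputable def uniformSubset (m : Finset (Fin K)) (t : ℕ) (b : Finset (Fin K)) : ℝ :=
  if b ∈ m.powersetCard t then ((m.card.choose t : ℕ) : ℝ)⁻¹ else 0

theorem uniformSubset_mem {m : Finset (Fin K)} {t : ℕ} (ht : t ≤ m.card) :
    uniformSubset m t ∈ stdSimplex ℝ (Finset (Fin K)) := by
  refine ⟨fun b => ?_, ?_⟩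
  · rw [uniformSubset]
    positivity
  · simp only [uniformSubset]
    rw [Finset.sum_ite_mem, Finset.univ_inter, Finset.sum_const, Finset.card_powersetCard,
      nsmul_eq_mul]
    exact mul_inv_cancel₀ (by exact_mod_cast (Nat.choose_pos ht).ne')

/-- The probability of the kept transitions out of `s`, given the states at the step. -/
noncomputable def keepWeight (H : ℕ) (δ : ℝ) (s : S) (z : Fin L × Fin K → S)
    (b : Fin L → Finset (Fin K)) : ℝ :=
  ∏ l, uniformSubset (visits (fun k => (k : ℕ) < K / 2) z l s) (trimSize H δ z l s) (b l)

theorem trimSize_le (H : ℕ) (δ : ℝ) (z : Fin L × Fin K → S) (l : Fin L) (s : S) :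
    trimSize H δ z l s ≤ (visits (fun k => (k : ℕ) < K / 2) z l s).card :=
  min_le_right _ _

/-- The law of the kept transitions out of one state at one step. -/
theorem sum_selectionProb_mul (δ : ℝ) (D : Dataset L K H S A) (h : Fin H) (s : S)
    (G : (Fin L → Finset (Fin K)) → ℝ) :
    ∑ B : Selection L K H S, selectionProb δ D B * G (fun l => B l h s) =
      ∑ b, keepWeight H δ s (stepStates D h) b * G b := by
  have hsel : ∀ B : Selection L K H S, selectionProb δ D B = ∏ l, ∏ h', ∏ s',
      uniformSubset (visits (fun k => (k : ℕ) < K / 2) (stepStates D h') l s')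
        (trimSize H δ (stepStates D h') l s') (B l h' s') := fun _ => rfl
  have hone : ∀ l h' s', ∑ b, uniformSubset (visits (fun k => (k : ℕ) < K / 2)
      (stepStates D h') l s') (trimSize H δ (stepStates D h') l s') b = 1 := fun l h' s' =>
    (uniformSubset_mem (trimSize_le _ _ _ _ _)).2
  simp only [hsel]
  have h1 := sum_prod_mul_comp (fun (l : Fin L) (β : Fin H → S → Finset (Fin K)) =>
    ∏ h', ∏ s', uniformSubset (visits (fun k => (k : ℕ) < K / 2) (stepStates D h') l s')
        (trimSize H δ (stepStates D h') l s') (β h' s')) (fun β => β h s) G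
  refine h1.trans (Finset.sum_congr rfl fun b _ => ?_)
  congr 1
  refine Finset.prod_congr rfl fun l _ => ?_
  -- The selections at the other steps, and then at the other states, are probability weights and
  -- sum out.
  have h2 := sum_prod_mul_apply
    (w := fun (h' : Fin H) (β : S → Finset (Fin K)) => ∏ s', uniformSubset
      (visits (fun k => (k : ℕ) < K / 2) (stepStates D h') l s')
        (trimSize H δ (stepStates D h') l s') (β s')) h
    (fun h' _ => sum_prod_eq_one fun s' => uniformSubset_mem (trimSize_le _ _ _ _ _))
    (fun β => if β s = b l then 1 else 0)
  have h3 := sum_prod_mul_apply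
    (w := fun s' : S => uniformSubset
      (visits (fun k => (k : ℕ) < K / 2) (stepStates D h) l s')
        (trimSize H δ (stepStates D h) l s')) s
    (fun s' _ => hone l h s') (fun β => if β = b l then 1 else 0)
  have h4 := h2.trans h3
  simp only [mul_ite, mul_one, mul_zero, Finset.sum_ite_eq', Finset.mem_univ, if_true] at h4
  exact h4

theorem keepWeight_nonneg (H : ℕ) (δ : ℝ) (s : S) (z : Fin L × Fin K → S)
    (b : Fin L → Finset (Fin K)) : 0 ≤ keepWeight H δ s z b :=
  Finset.prod_nonneg fun _ _ => (uniformSubset_mem (trimSize_le _ _ _ _ _)).1 _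

theorem sum_keepWeight (H : ℕ) (δ : ℝ) (s : S) (z : Fin L × Fin K → S) :
    ∑ b, keepWeight H δ s z b = 1 :=
  sum_prod_eq_one fun _ => uniformSubset_mem (trimSize_le _ _ _ _ _)

theorem eq_of_keepWeight_ne_zero {δ : ℝ} {s : S} {z : Fin L × Fin K → S}
    {b : Fin L → Finset (Fin K)} (hb : keepWeight H δ s z b ≠ 0) {l : Fin L} {k : Fin K}
    (hk : k ∈ b l) : z (l, k) = s := by
  have h1 := Finset.prod_ne_zero_iff.1 hb l (Finset.mem_univ l)
  rw [uniformSubset, ite_ne_right_iff] at h1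
  exact (Finset.mem_filter.1 ((Finset.mem_powersetCard.1 h1.1).1 hk)).2.2

/-- The probability of a sample, given the sources. -/
noncomputable def sampleProb (δ : ℝ) (ξs : Fin L → S → ℝ) (ρ : Fin L → Policy H S A)
    (θ : Sources L H S A) (x : Sample L K H S A) : ℝ :=
  datasetProb ξs ρ θ x.1 * selectionProb δ x.1 x.2

/-- The law, given the sources, of the part of the sample that concerns one state at one step. -/
theorem sum_sampleProb_mul (δ : ℝ) (ξs : Fin L → S → ℝ) (ρ : Fin L → Policy H S A)
    {θ : Sources L H S A} (hθ : ∀ l h s a, θ.transition l h s a ∈ stdSimplex ℝ S) (h : Fin H)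
    (s : S) (G : (Fin L × Fin K → S) → (Fin L → Finset (Fin K)) → (Fin L × Fin K → A) →
      (Fin L × Fin K → S) → ℝ) :
    ∑ x : Sample L K H S A, sampleProb δ ξs ρ θ x *
        G (stepStates x.1 h) (fun l => x.2 l h s) (stepActions x.1 h) (stepNext x.1 h) =
      ∑ z, stateWeight ξs ρ θ h z * ∑ b, keepWeight H δ s z b * ∑ α, actionWeight ρ h z α *
        ∑ η, nextWeight θ h z α η * G z b α η := by
  have h1 : ∑ x : Sample L K H S A, sampleProb δ ξs ρ θ x *
        G (stepStates x.1 h) (fun l => x.2 l h s) (stepActions x.1 h) (stepNext x.1 h) =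
      ∑ D : Dataset L K H S A, ∑ B : Selection L K H S,
        datasetProb ξs ρ θ D * selectionProb δ D B *
        G (stepStates D h) (fun l => B l h s) (stepActions D h) (stepNext D h) :=
    Fintype.sum_prod_type (fun x : Dataset L K H S A × Selection L K H S =>
      datasetProb ξs ρ θ x.1 * selectionProb δ x.1 x.2 *
        G (stepStates x.1 h) (fun l => x.2 l h s) (stepActions x.1 h) (stepNext x.1 h))
  rw [h1]
  simp only [mul_assoc, ← Finset.mul_sum]
  simp only [fun D : Dataset L K H S A => sum_selectionProb_mul δ D h s
    fun b => G (stepStates D h) b (stepActions D h) (stepNext D h)]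
  -- The law of the kept sets involves the dataset only through the states at the step, so they are
  -- conditionally independent of actions and next states.
  rw [sum_datasetProb_mul ξs ρ hθ h fun z α η => ∑ b, keepWeight H δ s z b * G z b α η]
  refine Finset.sum_congr rfl fun z _ => ?_
  congr 1
  simp only [Finset.mul_sum]
  rw [Finset.sum_comm (γ := Fin L → Finset (Fin K))]
  refine Finset.sum_congr rfl fun α _ => ?_
  rw [Finset.sum_comm (γ := Fin L → Finset (Fin K))]
  exact Finset.sum_congr rfl fun η _ => Finset.sum_congr rfl fun b _ => by ring

end Marginals

/-! ### Tail bounds given the sources. -/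

section ConditionalBounds

variable {L K H : ℕ} {S A : Type*} [Fintype S] [DecidableEq S] [Fintype A] [DecidableEq A]
  {ξs : Fin L → S → ℝ} {ρ : Fin L → Policy H S A} {θ : Sources L H S A}

theorem stateWeight_nonneg (hξs : ∀ l, ξs l ∈ stdSimplex ℝ S)
    (hθ : ∀ l h s a, θ.transition l h s a ∈ stdSimplex ℝ S) (h : Fin H)
    (z : Fin L × Fin K → S) : 0 ≤ stateWeight ξs ρ θ h z :=
  Finset.prod_nonneg fun i _ =>
    (stateDist_mem (hξs i.1) (ρ i.1) (hθ i.1) h.2.le).1 _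

theorem sum_stateWeight (hξs : ∀ l, ξs l ∈ stdSimplex ℝ S)
    (hθ : ∀ l h s a, θ.transition l h s a ∈ stdSimplex ℝ S) (h : Fin H) :
    ∑ z : Fin L × Fin K → S, stateWeight ξs ρ θ h z = 1 :=
  sum_prod_eq_one fun i => stateDist_mem (hξs i.1) (ρ i.1) (hθ i.1) h.2.le

theorem actionWeight_nonneg (ρ : Fin L → Policy H S A) (h : Fin H) (z : Fin L × Fin K → S)
    (α : Fin L × Fin K → A) : 0 ≤ actionWeight ρ h z α :=
  Finset.prod_nonneg fun i _ => ((ρ i.1).prob_mem h (z i)).1 _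

theorem sum_actionWeight (ρ : Fin L → Policy H S A) (h : Fin H) (z : Fin L × Fin K → S) :
    ∑ α, actionWeight ρ h z α = 1 :=
  sum_prod_eq_one fun i => (ρ i.1).prob_mem h (z i)

theorem sum_nextWeight (hθ : ∀ l h s a, θ.transition l h s a ∈ stdSimplex ℝ S) (h : Fin H)
    (z : Fin L × Fin K → S) (α : Fin L × Fin K → A) : ∑ η, nextWeight θ h z α η = 1 :=
  sum_prod_eq_one fun i => hθ i.1 h (z i) (α i)

/-- Conditional bounds, given the states and the kept transitions, hold on average. -/
theorem sum_sampleProb_mul_le (δ : ℝ) (hξs : ∀ l, ξs l ∈ stdSimplex ℝ S)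
    (hθ : ∀ l h s a, θ.transition l h s a ∈ stdSimplex ℝ S) (h : Fin H) (s : S)
    {G : (Fin L × Fin K → S) → (Fin L → Finset (Fin K)) → (Fin L × Fin K → A) →
      (Fin L × Fin K → S) → ℝ} {B : ℝ}
    (hG : ∀ z b, (∀ l k, k ∈ b l → z (l, k) = s) →
      ∑ α, actionWeight ρ h z α * ∑ η, nextWeight θ h z α η * G z b α η ≤ B) :
    ∑ x : Sample L K H S A, sampleProb δ ξs ρ θ x *
      G (stepStates x.1 h) (fun l => x.2 l h s) (stepActions x.1 h) (stepNext x.1 h) ≤ B := by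
  rw [sum_sampleProb_mul δ ξs ρ hθ h s]
  refine sum_mul_le_of_sum_eq_one (stateWeight_nonneg hξs hθ h) (sum_stateWeight hξs hθ h)
    fun z _ => ?_
  exact sum_mul_le_of_sum_eq_one (keepWeight_nonneg H δ s z) (sum_keepWeight H δ s z)
    fun b hb => hG z b fun l k hk => eq_of_keepWeight_ne_zero hb hk

theorem card_filter_singleton_product {X : Type*} [DecidableEq X] (l : Fin L)
    (m : Finset (Fin K)) (z : Fin L × Fin K → X) (x : X) :
    ((({l} : Finset (Fin L)) ×ˢ m).filter fun i => z i = x).card =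
      (m.filter fun k => z (l, k) = x).card := by
  rw [Finset.singleton_product, Finset.filter_map, Finset.card_map]
  rfl

/-- A Chernoff bound normalized for Markov's inequality at level one: where the exponent is
negative, the count exceeds `5 / 8` of its mean minus `T / 8`, hence half its mean once the mean is
at least `T`. -/
theorem sum_sampleProb_mul_exp_visits_le (δ : ℝ) (hξs : ∀ l, ξs l ∈ stdSimplex ℝ S)
    (hθ : ∀ l h s a, θ.transition l h s a ∈ stdSimplex ℝ S) (p : Fin K → Prop)
    [DecidablePred p] (l : Fin L) (h : Fin H) (s : S) (T : ℝ) :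
    ∑ x : Sample L K H S A, sampleProb δ ξs ρ θ x *
      Real.exp (5 / 8 * (Finset.univ.filter p).card *
        stateDist (ξs l) (ρ l) (θ.transition l) h s -
        ((visits p (stepStates x.1 h) l s).card : ℝ) - T / 8) ≤ Real.exp (-(T / 8)) := by
  have h1 := sum_sampleProb_mul δ ξs ρ hθ h s fun z _ _ _ =>
    Real.exp (5 / 8 * (Finset.univ.filter p).card *
        stateDist (ξs l) (ρ l) (θ.transition l) h s - ((visits p z l s).card : ℝ) - T / 8)
  refine h1.le.trans ?_
  simp only [← Finset.sum_mul, sum_nextWeight hθ, sum_actionWeight, sum_keepWeight, one_mul]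
  have h2 := sum_prod_mul_exp_neg_card_le
    (fun i : Fin L × Fin K => stateDist_mem (hξs i.1) (ρ i.1) (hθ i.1) h.2.le)
    ({l} ×ˢ Finset.univ.filter p) s
    (r := stateDist (ξs l) (ρ l) (θ.transition l) h s) (fun i hi => by
      rw [Finset.mem_singleton.1 (Finset.mem_product.1 hi).1])
  simp only [card_filter_singleton_product, Finset.card_product, Finset.card_singleton, one_mul,
    Finset.filter_filter] at h2
  set c := 5 / 8 * ((Finset.univ.filter p).card : ℝ) *
    stateDist (ξs l) (ρ l) (θ.transition l) h s
  have h3 : ∀ z : Fin L × Fin K → S, stateWeight ξs ρ θ h z *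
      Real.exp (c - ((visits p z l s).card : ℝ) - T / 8) = Real.exp (c - T / 8) *
      (stateWeight ξs ρ θ h z * Real.exp (-((visits p z l s).card : ℝ))) := by
    intro z
    rw [mul_left_comm, ← Real.exp_add]
    congr 2
    ring
  simp only [h3, ← Finset.mul_sum]
  calc _ ≤ Real.exp (c - T / 8) * Real.exp (-c) := by
        gcongr
        exact h2
    _ = _ := by
      rw [← Real.exp_add]
      congr 1
      ring

/-- The number of kept visits of `(s, a)`. -/
def keptCount (b : Fin L → Finset (Fin K)) (α : Fin L × Fin K → A) (a : A) (l : Fin L) : ℕ :=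
  ((b l).filter fun k => α (l, k) = a).card

/-- The number of kept visits of `(s, a, s')`. -/
def keptCountNext (b : Fin L → Finset (Fin K)) (α : Fin L × Fin K → A) (η : Fin L × Fin K → S)
    (a : A) (s' : S) (l : Fin L) : ℕ :=
  ((b l).filter fun k => α (l, k) = a ∧ η (l, k) = s').card

/-- The sources with kept visits of `(s, a)`. -/
def keptSeen (b : Fin L → Finset (Fin K)) (α : Fin L × Fin K → A) (a : A) : Finset (Fin L) :=
  {l | 0 < keptCount b α a l}

/-- Given the states and the kept set, the actions at the kept visits are independent draws from one
law, because all these visits are in state `s`. -/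
theorem sum_sampleProb_mul_exp_count_le (δ : ℝ) (hξs : ∀ l, ξs l ∈ stdSimplex ℝ S)
    (hθ : ∀ l h s a, θ.transition l h s a ∈ stdSimplex ℝ S) (l : Fin L) (h : Fin H) (s : S)
    (a : A) (T : ℝ) :
    ∑ x : Sample L K H S A, sampleProb δ ξs ρ θ x *
      Real.exp (5 / 8 * (x.2 l h s).card * (ρ l).prob h s a - (count x l h s a : ℝ) - T / 8) ≤
      Real.exp (-(T / 8)) := by
  refine sum_sampleProb_mul_le δ hξs hθ h s (G := fun z b α η =>
    Real.exp (5 / 8 * (b l).card * (ρ l).prob h s a - (keptCount b α a l : ℝ) - T / 8))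
    fun z b hzb => ?_
  simp only [← Finset.sum_mul, sum_nextWeight hθ, one_mul]
  have h2 := sum_prod_mul_exp_neg_card_le
    (fun i : Fin L × Fin K => (ρ i.1).prob_mem h (z i)) ({l} ×ˢ b l) a
    (r := (ρ l).prob h s a) (fun i hi => by
      obtain ⟨l', k⟩ := i
      obtain ⟨h1, h2⟩ := Finset.mem_product.1 hi
      obtain rfl : l' = l := Finset.mem_singleton.1 h1
      rw [hzb l' k h2])
  simp only [card_filter_singleton_product, Finset.card_product, Finset.card_singleton,
    one_mul] at h2
  set c := 5 / 8 * ((b l).card : ℝ) * (ρ l).prob h s a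
  have h3 : ∀ α : Fin L × Fin K → A, actionWeight ρ h z α *
      Real.exp (c - (keptCount b α a l : ℝ) - T / 8) = Real.exp (c - T / 8) *
      (actionWeight ρ h z α * Real.exp (-(keptCount b α a l : ℝ))) := by
    intro α
    rw [mul_left_comm, ← Real.exp_add]
    congr 2
    ring
  simp only [h3, ← Finset.mul_sum]
  calc _ ≤ Real.exp (c - T / 8) * Real.exp (-c) := by
        gcongr
        exact h2
    _ = _ := by
      rw [← Real.exp_add]
      congr 1
      ring

/-- The deviation of the transition estimate from the average over the seen sources. -/
noncomputable def samplingDev (θ : Sources L H S A) (x : Sample L K H S A) (h : Fin H) (s : S)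
    (a : A) (s' : S) : ℝ :=
  ∑ l ∈ seenSources x h s a, ((countNext x l h s a s' : ℝ) / (count x l h s a : ℝ) -
    θ.transition l h s a s') / ((seenSources x h s a).card : ℝ)

/-- All kept visits of `(s, a)` in one source carry the same coefficient, so a linear form in
centered next-state indicators reduces to the two counts. -/
theorem sum_kept_indicator (b : Fin L → Finset (Fin K)) (z : Fin L × Fin K → S)
    (α : Fin L × Fin K → A) (η : Fin L × Fin K → S) (h : Fin H) {s : S} (a : A) (s' : S)
    (hzb : ∀ l k, k ∈ b l → z (l, k) = s) (l : Fin L) (v : ℝ) :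
    ∑ k, (if k ∈ b l ∧ α (l, k) = a then v else 0) * ((if η (l, k) = s' then 1 else 0) -
        θ.transition l h (z (l, k)) (α (l, k)) s') =
      v * (keptCountNext b α η a s' l - keptCount b α a l * θ.transition l h s a s') := by
  have h1 : ∀ k, (if k ∈ b l ∧ α (l, k) = a then v else 0) * ((if η (l, k) = s' then 1 else 0) -
        θ.transition l h (z (l, k)) (α (l, k)) s') =
      (if k ∈ b l then if α (l, k) = a ∧ η (l, k) = s' then v else 0 else 0) -
      if k ∈ b l then if α (l, k) = a then v * θ.transition l h s a s' else 0 else 0 := by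
    intro k
    by_cases hk : k ∈ b l
    · by_cases ha : α (l, k) = a
      · simp [hk, ha, hzb l k hk]
        split_ifs <;> ring
      · simp [ha]
    · simp [hk]
  simp only [h1, Finset.sum_sub_distrib, Finset.sum_ite_mem, Finset.univ_inter]
  rw [← Finset.sum_filter, ← Finset.sum_filter, Finset.sum_const, Finset.sum_const,
    nsmul_eq_mul, nsmul_eq_mul, keptCountNext, keptCount]
  ring

/-- The exponential moment of the deviation that comes from sampling the sources. -/
theorem sum_sampleProb_mul_exp_samplingDev_le (δ : ℝ) (hξs : ∀ l, ξs l ∈ stdSimplex ℝ S)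
    (hθ : ∀ l h s a, θ.transition l h s a ∈ stdSimplex ℝ S) (h : Fin H) (s : S) (a : A)
    (s' : S) (hτ : 0 ≤ tupleLog S A H δ) {ε : ℝ} (hε : ε ^ 2 = 1) :
    ∑ x : Sample L K H S A, sampleProb δ ξs ρ θ x *
      Real.exp (ε * (3 * tupleLog S A H δ / √(samplingVar δ x h s a)) *
        samplingDev θ x h s a s' - 18 * tupleLog S A H δ) ≤
      Real.exp (-(9 * tupleLog S A H δ)) := by
  set τ := tupleLog S A H δ with hτdef
  -- `samplingVar` and `samplingDev` in terms of kept sets, actions and next states.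
  let V : (Fin L → Finset (Fin K)) → (Fin L × Fin K → A) → ℝ := fun b α =>
    ∑ l ∈ keptSeen b α a, τ / (((keptSeen b α a).card : ℝ) ^ 2 * (keptCount b α a l : ℝ))
  let X : (Fin L → Finset (Fin K)) → (Fin L × Fin K → A) → (Fin L × Fin K → S) → ℝ :=
    fun b α η => ∑ l ∈ keptSeen b α a, ((keptCountNext b α η a s' l : ℝ) /
      (keptCount b α a l : ℝ) - θ.transition l h s a s') / ((keptSeen b α a).card : ℝ)
  refine sum_sampleProb_mul_le δ hξs hθ h s (G := fun z b α η =>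
    Real.exp (ε * (3 * τ / √(V b α)) * X b α η - 18 * τ)) fun z b hzb => ?_
  refine sum_mul_le_of_sum_eq_one (actionWeight_nonneg ρ h z) (sum_actionWeight ρ h z)
    fun α _ => ?_
  -- With the actions fixed, the data-dependent scale is a constant; only the next states are still
  -- random.
  set Λ := 3 * τ / √(V b α) with hΛ
  set n : ℝ := ((keptSeen b α a).card : ℝ) with hn
  set v : Fin L → ℝ := fun l => ε * Λ / (n * keptCount b α a l) with hv
  set u : Fin L × Fin K → ℝ := fun i => if i.2 ∈ b i.1 ∧ α i = a then v i.1 else 0 with hu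
  have hzero : ∀ l ∉ keptSeen b α a, keptCount b α a l = 0 := fun l hl => by
    simpa [keptSeen] using hl
  have hX : ∀ η, ε * Λ * X b α η = ∑ i, u i * ((if η i = s' then 1 else 0) -
      θ.transition i.1 h (z i) (α i) s') := by
    intro η
    rw [Fintype.sum_prod_type]
    simp only [hu, sum_kept_indicator b z α η h a s' hzb]
    rw [← Finset.sum_subset (Finset.subset_univ (keptSeen b α a)), Finset.mul_sum]
    · refine Finset.sum_congr rfl fun l hl => ?_
      have h1 : (keptCount b α a l : ℝ) ≠ 0 := by
        have := (Finset.mem_filter.1 hl).2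
        exact_mod_cast this.ne'
      simp only [hv, hn]
      field_simp
    · intro l _ hl
      simp [hv, hzero l hl]
  have hVnn : 0 ≤ V b α := Finset.sum_nonneg fun l _ => by positivity
  -- `V` is `τ` times the sum over the kept visits of the squared averaging weights, so the scale `3
  -- * τ / √V` normalizes this sum.
  have husq : ∑ i, u i ^ 2 ≤ 9 * τ := by
    have h1 : ∑ i, u i ^ 2 = ∑ l ∈ keptSeen b α a, Λ ^ 2 / (n ^ 2 * keptCount b α a l) := by
      rw [Fintype.sum_prod_type, ← Finset.sum_subset (Finset.subset_univ (keptSeen b α a))]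
      · refine Finset.sum_congr rfl fun l hl => ?_
        have h1 : (keptCount b α a l : ℝ) ≠ 0 := by
          have := (Finset.mem_filter.1 hl).2
          exact_mod_cast this.ne'
        have h2 : ∀ k, u (l, k) ^ 2 =
            if k ∈ b l then if α (l, k) = a then v l ^ 2 else 0 else 0 := by
          intro k
          simp only [hu, ite_and]
          split_ifs <;> simp
        simp only [h2, Finset.sum_ite_mem, Finset.univ_inter]
        rw [← Finset.sum_filter, Finset.sum_const, nsmul_eq_mul]
        change (keptCount b α a l : ℝ) * v l ^ 2 = _
        simp only [hv, div_pow, mul_pow, hε, one_mul]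
        field_simp
      · intro l _ hl
        refine Finset.sum_eq_zero fun k _ => ?_
        simp only [hu, hv, hzero l hl]
        simp
    have h2 : τ * ∑ i, u i ^ 2 = Λ ^ 2 * V b α := by
      rw [h1, Finset.mul_sum, Finset.mul_sum]
      exact Finset.sum_congr rfl fun l _ => by ring
    rcases hτ.eq_or_lt with h0 | h0
    · rw [h1, ← h0]
      have : Λ = 0 := by simp [hΛ, ← h0]
      simp [this]
    · have h3 : Λ ^ 2 * V b α ≤ 9 * τ ^ 2 := by
        rw [hΛ, div_pow, Real.sq_sqrt hVnn]
        rcases hVnn.eq_or_lt with h4 | h4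
        · simp [← h4]
          positivity
        · rw [div_mul_cancel₀ _ h4.ne']
          nlinarith
      nlinarith
  have h4 := sum_prod_mul_exp_le
    (fun i : Fin L × Fin K => hθ i.1 h (z i) (α i)) u s'
  have h5 : ∀ η, nextWeight θ h z α η * Real.exp (ε * Λ * X b α η - 18 * τ) =
      Real.exp (-(18 * τ)) * (nextWeight θ h z α η *
        Real.exp (∑ i, u i * ((if η i = s' then 1 else 0) -
          θ.transition i.1 h (z i) (α i) s'))) := by
    intro η
    rw [← hX, mul_left_comm, ← Real.exp_add]
    congr 2
    ring
  simp only [h5, ← Finset.mul_sum]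
  calc _ ≤ Real.exp (-(18 * τ)) * Real.exp (∑ i, u i ^ 2) := by
        gcongr
        exact h4
    _ ≤ Real.exp (-(18 * τ)) * Real.exp (9 * τ) := by gcongr
    _ = _ := by
      rw [← Real.exp_add]
      congr 1
      ring

end ConditionalBounds

/-! ### The experiment as a measure: regular sources and Markov's inequality. -/

section Experiment

variable {L K H : ℕ} {S A : Type*} [Fintype S] [DecidableEq S] [Fintype A] [DecidableEq A]
  {M : EpisodicMDP H S A} {g : Fin H → Measure (StepModel S A)} {Tl Tu δ : ℝ}
  {ξs : Fin L → S → ℝ} {ρ : Fin L → Policy H S A}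

theorem measurable_transition (l : Fin L) (h : Fin H) (s : S) (a : A) (s' : S) :
    Measurable fun θ : Sources L H S A => θ.transition l h s a s' := by
  unfold Sources.transition
  fun_prop

theorem measurable_sampleProb (x : Sample L K H S A) :
    Measurable fun θ : Sources L H S A => sampleProb δ ξs ρ θ x := by
  unfold sampleProb datasetProb trajProb
  have := measurable_transition (L := L) (H := H) (S := S) (A := A)
  fun_prop

theorem measurable_stateDist_model (ξ : S → ℝ) (π : Policy H S A) (n : ℕ) (s : S) :
    Measurable fun m : Fin H → StepModel S A => stateDist ξ π (fun h => (m h).2) n s := by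
  induction n generalizing s with
  | zero => exact measurable_const
  | succ n ih =>
    simp only [stateDist_succ]
    split_ifs
    · fun_prop
    · exact measurable_const

theorem measurable_stateDist (ξ : S → ℝ) (π : Policy H S A) (l : Fin L) (n : ℕ) (s : S) :
    Measurable fun θ : Sources L H S A => stateDist ξ π (θ.transition l) n s :=
  (measurable_stateDist_model ξ π n s).comp (measurable_pi_apply l)

/-- Sources whose rewards and transitions are as they should be. -/
structure Sources.IsRegular (M : EpisodicMDP H S A) (θ : Sources L H S A) : Prop where
  transition_mem : ∀ l h s a, θ.transition l h s a ∈ stdSimplex ℝ S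
  transition_ac : ∀ l h s a s', M.P h s a s' = 0 → θ.transition l h s a s' = 0
  reward_mem : ∀ l h s a, θ.reward l h s a ∈ Set.Icc (0 : ℝ) 1

theorem ae_isRegular (hg : IsTaskSourceLaw M g Tl Tu) :
    ∀ᵐ θ ∂sourceLaw L g, θ.IsRegular M := by
  have := hg.isProbabilityMeasure
  have hpull : ∀ (l : Fin L) (h : Fin H) (p : StepModel S A → Prop), (∀ᵐ y ∂g h, p y) →
      ∀ᵐ θ ∂sourceLaw L g, p (θ l h) := by
    intro l h p hp
    have h1 : ∀ᵐ m ∂Measure.pi fun h : Fin H => g h, p (m h) :=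
      (Measure.quasiMeasurePreserving_eval (fun h : Fin H => g h) h).ae hp
    exact (Measure.quasiMeasurePreserving_eval
      (fun _ : Fin L => Measure.pi fun h : Fin H => g h) l).ae h1
  have h1 : ∀ᵐ θ ∂sourceLaw L g, ∀ l h, (∀ s a, (θ l h).2 s a ∈ stdSimplex ℝ S) ∧
      (∀ s a s', (θ l h).2 s a s' ∈ Set.Icc (Tl * M.P h s a s') (Tu * M.P h s a s')) ∧
      ∀ s a, (θ l h).1 s a ∈ Set.Icc (0 : ℝ) 1 := by
    refine ae_all_iff.2 fun l => ae_all_iff.2 fun h => hpull l h (fun y =>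
      (∀ s a, y.2 s a ∈ stdSimplex ℝ S) ∧
      (∀ s a s', y.2 s a s' ∈ Set.Icc (Tl * M.P h s a s') (Tu * M.P h s a s')) ∧
      ∀ s a, y.1 s a ∈ Set.Icc (0 : ℝ) 1) ?_
    filter_upwards [hg.transition_mem h, hg.transition_bounds h, hg.reward_mem h]
      with y h1 h2 h3 using ⟨h1, h2, h3⟩
  filter_upwards [h1] with θ hθ
  refine ⟨fun l h => (hθ l h).1, fun l h s a s' h0 => ?_, fun l h => (hθ l h).2.2⟩
  -- Where the nominal probability is `0`, the two-sided bounds collapse to `0`.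
  have h2 := (hθ l h).2.1 s a s'
  rw [h0, mul_zero, mul_zero] at h2
  exact le_antisymm h2.2 h2.1

/-- The sample space is finite with all sets measurable, so only the sections matter. -/
theorem measurableSet_prod_sample {E : Set (Sources L H S A × Sample L K H S A)}
    (hE : ∀ x, MeasurableSet {θ | (θ, x) ∈ E}) : MeasurableSet E := by
  have h1 : E = ⋃ x : Sample L K H S A, (fun ω : Sources L H S A × Sample L K H S A => ω.1) ⁻¹'
      {θ | (θ, x) ∈ E} ∩ (fun ω => ω.2) ⁻¹' {x} := by
    ext ⟨θ, x⟩
    simp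
  rw [h1]
  exact MeasurableSet.iUnion fun x => (measurable_fst (hE x)).inter
    (measurable_snd (MeasurableSpace.measurableSet_top))

theorem experimentLaw_apply {E : Set (Sources L H S A × Sample L K H S A)}
    (hE : ∀ x, MeasurableSet {θ | (θ, x) ∈ E}) :
    experimentLaw K δ g ξs ρ E = ∑ x : Sample L K H S A,
      ∫⁻ θ in {θ | (θ, x) ∈ E}, ENNReal.ofReal (sampleProb δ ξs ρ θ x) ∂sourceLaw L g := by
  rw [experimentLaw, Measure.finsetSum_apply]
  refine Finset.sum_congr rfl fun x _ => ?_
  have hm : Measurable fun θ : Sources L H S A => (θ, x) := by fun_prop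
  rw [Measure.map_apply hm (measurableSet_prod_sample hE)]
  exact withDensity_apply _ (hE x)

/-- Markov's inequality for the experiment. -/
theorem experimentLaw_le_lintegral {F : Sources L H S A → Sample L K H S A → ℝ}
    (hF : ∀ x, Measurable fun θ => F θ x) :
    experimentLaw K δ g ξs ρ {ω | 1 ≤ F ω.1 ω.2} ≤
      ∫⁻ θ, ∑ x, ENNReal.ofReal (sampleProb δ ξs ρ θ x) * ENNReal.ofReal (F θ x)
        ∂sourceLaw L g := by
  have hmeas : ∀ x, MeasurableSet {θ | 1 ≤ F θ x} := fun x =>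
    measurableSet_le measurable_const (hF x)
  have hW : ∀ x : Sample L K H S A, Measurable fun θ : Sources L H S A =>
      ENNReal.ofReal (sampleProb δ ξs ρ θ x) := fun x =>
    (measurable_sampleProb x).ennreal_ofReal
  have hWF : ∀ x : Sample L K H S A, Measurable fun θ : Sources L H S A =>
      ENNReal.ofReal (sampleProb δ ξs ρ θ x) * ENNReal.ofReal (F θ x) := fun x =>
    (hW x).mul (hF x).ennreal_ofReal
  rw [experimentLaw_apply hmeas, lintegral_finsetSum _ fun x _ => hWF x]
  refine Finset.sum_le_sum fun x _ => ?_
  refine (setLIntegral_mono (hWF x) fun θ hθ => ?_).trans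
    (setLIntegral_le_lintegral _ _)
  have h1 : (1 : ℝ≥0∞) ≤ ENNReal.ofReal (F θ x) := by
    rw [← ENNReal.ofReal_one]
    exact ENNReal.ofReal_le_ofReal hθ
  calc ENNReal.ofReal (sampleProb δ ξs ρ θ x)
      = ENNReal.ofReal (sampleProb δ ξs ρ θ x) * 1 := (mul_one _).symm
    _ ≤ _ := by gcongr

theorem selectionProb_nonneg (δ : ℝ) (D : Dataset L K H S A) (B : Selection L K H S) :
    0 ≤ selectionProb δ D B := by
  unfold selectionProb
  exact Finset.prod_nonneg fun l _ => Finset.prod_nonneg fun h _ => Finset.prod_nonneg fun s _ =>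
    by positivity

theorem sampleProb_nonneg (hξs : ∀ l, ξs l ∈ stdSimplex ℝ S) {θ : Sources L H S A}
    (hθ : ∀ l h s a, θ.transition l h s a ∈ stdSimplex ℝ S) (x : Sample L K H S A) :
    0 ≤ sampleProb δ ξs ρ θ x :=
  mul_nonneg (Finset.prod_nonneg fun l _ => Finset.prod_nonneg fun _ _ =>
    trajProb_nonneg (hξs l).1 _ (fun h s a => (hθ l h s a).1) _) (selectionProb_nonneg _ _ _)

/-- A bound on the probability of an event from a bound given the sources. -/
theorem experimentLaw_le_ofReal (hg : IsTaskSourceLaw M g Tl Tu)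
    (hξs : ∀ l, ξs l ∈ stdSimplex ℝ S) {F : Sources L H S A → Sample L K H S A → ℝ}
    (hF : ∀ x, Measurable fun θ => F θ x) (hF0 : ∀ θ x, 0 ≤ F θ x) {B : ℝ}
    (hB : ∀ θ : Sources L H S A, θ.IsRegular M → ∑ x, sampleProb δ ξs ρ θ x * F θ x ≤ B) :
    experimentLaw K δ g ξs ρ {ω | 1 ≤ F ω.1 ω.2} ≤ ENNReal.ofReal B := by
  have := hg.isProbabilityMeasure
  have : IsProbabilityMeasure (sourceLaw L g) := by unfold sourceLaw; infer_instance
  refine (experimentLaw_le_lintegral hF).trans ?_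
  calc _ ≤ ∫⁻ _, ENNReal.ofReal B ∂sourceLaw L g := by
        refine lintegral_mono_ae ?_
        filter_upwards [ae_isRegular hg] with θ hθ
        have h0 := sampleProb_nonneg (K := K) (δ := δ) (ρ := ρ) hξs hθ.transition_mem
        simp only [← ENNReal.ofReal_mul (h0 _)]
        rw [← ENNReal.ofReal_sum_of_nonneg fun x _ => mul_nonneg (h0 x) (hF0 θ x)]
        exact ENNReal.ofReal_le_ofReal (hB θ hθ)
    _ = ENNReal.ofReal B := by simp

theorem ae_experimentLaw (hg : IsTaskSourceLaw M g Tl Tu) :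
    experimentLaw K δ g ξs ρ
      {ω | ¬ (ω.1.IsRegular M ∧ 0 < sampleProb δ ξs ρ ω.1 ω.2)} = 0 := by
  have h1 : experimentLaw K δ g ξs ρ {ω | ¬ 0 < sampleProb δ ξs ρ ω.1 ω.2} = 0 := by
    have hm : ∀ x : Sample L K H S A,
        MeasurableSet {θ : Sources L H S A | ¬ 0 < sampleProb δ ξs ρ θ x} := fun x =>
      (measurableSet_lt measurable_const (measurable_sampleProb x)).compl
    rw [experimentLaw_apply hm]
    refine Finset.sum_eq_zero fun x _ => ?_
    refine (setLIntegral_congr_fun (g := fun _ => 0) (hm x) fun θ hθ => ?_).trans lintegral_zero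
    exact ENNReal.ofReal_of_nonpos (not_lt.1 hθ)
  have h2 : experimentLaw K δ g ξs ρ {ω | ¬ ω.1.IsRegular M} = 0 := by
    obtain ⟨N, hN, hNm, hN0⟩ := exists_measurable_superset_of_null (ae_iff.1 (ae_isRegular
      (L := L) hg))
    refine measure_mono_null (t := {ω | ω.1 ∈ N}) (fun ω hω => hN hω) ?_
    rw [experimentLaw_apply (E := {ω | ω.1 ∈ N}) fun _ => hNm]
    refine Finset.sum_eq_zero fun x _ => ?_
    exact setLIntegral_measure_zero _ _ hN0
  refine measure_mono_null (fun ω hω => ?_) (measure_union_null h2 h1)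
  exact not_and_or.1 hω

end Experiment

/-! ### Integrals over product measures. -/

section ProductMeasures

/-- The integral of a product of functions of different coordinates. -/
theorem lintegral_pi_prod {ι : Type*} [Fintype ι] {Ω : ι → Type*} [∀ i, MeasurableSpace (Ω i)]
    (μ : ∀ i, Measure (Ω i)) [∀ i, IsProbabilityMeasure (μ i)] {f : ∀ i, Ω i → ℝ≥0∞}
    (hf : ∀ i, Measurable (f i)) :
    ∫⁻ ω, ∏ i, f i (ω i) ∂Measure.pi μ = ∏ i, ∫⁻ y, f i y ∂μ i := by
  rw [ProbabilityTheory.lintegral_prod_eq_prod_lintegral_of_indepFun Finset.univ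
    (fun i (ω : ∀ i, Ω i) => f i (ω i))
    (ProbabilityTheory.iIndepFun_pi fun i => (hf i).aemeasurable)
    fun i => (hf i).comp (measurable_pi_apply i)]
  refine Finset.prod_congr rfl fun i _ => ?_
  exact (measurePreserving_eval μ i).lintegral_comp (hf i)

/-- A function of one coordinate is bounded on average, also when it is weighted by a function of
the other coordinates. -/
theorem lintegral_pi_mul_le {ι : Type*} [Fintype ι] [DecidableEq ι] {Ω : ι → Type*}
    [∀ i, MeasurableSpace (Ω i)] (μ : ∀ i, Measure (Ω i)) [∀ i, IsProbabilityMeasure (μ i)]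
    (i : ι) {f : (∀ i, Ω i) → ℝ≥0∞} (hf : Measurable f)
    (hfi : ∀ ω y, f (Function.update ω i y) = f ω) {G : Ω i → ℝ≥0∞} (hG : Measurable G)
    {c : ℝ≥0∞} (hc : ∫⁻ y, G y ∂μ i ≤ c) :
    ∫⁻ ω, f ω * G (ω i) ∂Measure.pi μ ≤ ∫⁻ ω, f ω * c ∂Measure.pi μ := by
  -- Coordinate `i` is integrated out first; by `hfi` the weight `f` is constant in it.
  refine lintegral_le_of_lmarginal_le {i}
    (hf.mul (hG.comp (measurable_pi_apply i))) (hf.mul_const c) fun ω => ?_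
  rw [lmarginal_singleton, lmarginal_singleton]
  simp only [hfi, Function.update_self]
  rw [lintegral_const_mul _ hG, lintegral_const, measure_univ, mul_one]
  gcongr

end ProductMeasures

/-! ### Concentration of the random sources. -/

section SourceDeviations

variable {L K H : ℕ} {S A : Type*} [Fintype S] [DecidableEq S] [Fintype A] [DecidableEq A]
  {M : EpisodicMDP H S A} {g : Fin H → Measure (StepModel S A)} {Tl Tu δ : ℝ}
  {ξs : Fin L → S → ℝ} {ρ : Fin L → Policy H S A}

/-- The step models at step `h` are independent of the states at step `h`. -/
theorem lintegral_stateWeight_mul_prod_le (hg : IsTaskSourceLaw M g Tl Tu) (h : Fin H)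
    (z : Fin L × Fin K → S) {G : Fin L → StepModel S A → ℝ≥0∞} (hG : ∀ l, Measurable (G l))
    {c : Fin L → ℝ≥0∞} (hc : ∀ l, ∫⁻ y, G l y ∂g h ≤ c l) :
    ∫⁻ θ, (∏ i : Fin L × Fin K, ENNReal.ofReal
        (stateDist (ξs i.1) (ρ i.1) (θ.transition i.1) h (z i))) * ∏ l, G l (θ l h)
        ∂sourceLaw L g ≤
      (∫⁻ θ, ∏ i : Fin L × Fin K, ENNReal.ofReal
        (stateDist (ξs i.1) (ρ i.1) (θ.transition i.1) h (z i)) ∂sourceLaw L g) *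
        ∏ l, c l := by
  have := hg.isProbabilityMeasure
  let a : Fin L → (Fin H → StepModel S A) → ℝ≥0∞ := fun l m => ∏ k : Fin K,
    ENNReal.ofReal (stateDist (ξs l) (ρ l) (fun h => (m h).2) h (z (l, k)))
  have ha : ∀ l, Measurable (a l) := fun l => Finset.measurable_prod _ fun k _ =>
    (measurable_stateDist_model _ _ _ _).ennreal_ofReal
  -- The state distribution at step `h` does not involve the model of step `h`, so the moment of
  -- that model factors out.
  have hup : ∀ l m y, a l (Function.update m h y) = a l m := by
    intro l m y
    refine Finset.prod_congr rfl fun k _ => ?_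
    rw [stateDist_congr (ξs l) (ρ l) (P' := fun h => (m h).2) fun i hi => ?_]
    rw [Function.update_of_ne (Fin.ne_of_lt hi)]
  have h1 : ∀ θ : Sources L H S A, (∏ i : Fin L × Fin K, ENNReal.ofReal
      (stateDist (ξs i.1) (ρ i.1) (θ.transition i.1) h (z i))) = ∏ l, a l (θ l) := fun θ => by
    rw [Fintype.prod_prod_type]
    rfl
  simp only [h1, ← Finset.prod_mul_distrib]
  unfold sourceLaw
  rw [lintegral_pi_prod (fun _ : Fin L => Measure.pi fun h : Fin H => g h) ha,
    lintegral_pi_prod (fun _ : Fin L => Measure.pi fun h : Fin H => g h)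
      (f := fun l m => a l m * G l (m h))
      fun l => (ha l).mul ((hG l).comp (measurable_pi_apply h)), ← Finset.prod_mul_distrib]
  refine Finset.prod_le_prod' fun l _ => ?_
  refine (lintegral_pi_mul_le (fun h => g h) h (ha l) (hup l) (hG l) (hc l)).trans ?_
  rw [lintegral_mul_const _ (ha l)]

/-- The exponential moments of centered variables with values in `[-1, 1]`. -/
theorem lintegral_exp_mul_le {Ω : Type*} [MeasurableSpace Ω] {μ : Measure Ω}
    [IsProbabilityMeasure μ] {Y : Ω → ℝ} (hY : Measurable Y) (hY1 : ∀ᵐ ω ∂μ, |Y ω| ≤ 1)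
    (hY0 : ∫ ω, Y ω ∂μ = 0) (u : ℝ) :
    ∫⁻ ω, ENNReal.ofReal (Real.exp (u * Y ω)) ∂μ ≤ ENNReal.ofReal (Real.exp (u ^ 2)) := by
  have hint : Integrable Y μ := Integrable.of_bound hY.aestronglyMeasurable 1 hY1
  have hle : ∀ᵐ ω ∂μ, Real.exp (u * Y ω) ≤ u * Y ω + Real.exp (u ^ 2) := by
    filter_upwards [hY1] with ω hω
    refine (exp_le_add_exp_sq _).trans ?_
    refine add_le_add_right (Real.exp_le_exp.2 ?_) _
    rw [mul_pow]
    exact mul_le_of_le_one_right (sq_nonneg _) ((sq_le_one_iff_abs_le_one _).2 hω)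
  have hint2 : Integrable (fun ω => u * Y ω + Real.exp (u ^ 2)) μ :=
    (hint.const_mul u).add (integrable_const _)
  calc _ ≤ ∫⁻ ω, ENNReal.ofReal (u * Y ω + Real.exp (u ^ 2)) ∂μ := by
        refine lintegral_mono_ae ?_
        filter_upwards [hle] with ω hω using ENNReal.ofReal_le_ofReal hω
    _ = ENNReal.ofReal (∫ ω, (u * Y ω + Real.exp (u ^ 2)) ∂μ) := by
        refine (ofReal_integral_eq_lintegral_ofReal hint2 ?_).symm
        filter_upwards [hle] with ω hω using (Real.exp_pos _).le.trans hω
    _ = _ := by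
        rw [integral_add (hint.const_mul u) (integrable_const _), integral_const_mul, hY0]
        simp

/-- The average over the seen sources of a function of their step models. -/
noncomputable def sourceDev (Y : StepModel S A → ℝ) (θ : Sources L H S A) (x : Sample L K H S A)
    (h : Fin H) (s : S) (a : A) : ℝ :=
  ∑ l ∈ seenSources x h s a, Y (θ l h) / ((seenSources x h s a).card : ℝ)

/-- The exponential tail of the deviation that comes from the randomness of the sources. -/
theorem experimentLaw_sourceDev_le (hg : IsTaskSourceLaw M g Tl Tu)
    (hξs : ∀ l, ξs l ∈ stdSimplex ℝ S) (h : Fin H) (s : S) (a : A)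
    (hτ : 0 ≤ tupleLog S A H δ) {ε : ℝ} (hε : ε ^ 2 = 1) {Y : StepModel S A → ℝ}
    (hY : Measurable Y) (hY1 : ∀ᵐ y ∂g h, |Y y| ≤ 1) (hY0 : ∫ y, Y y ∂g h = 0) :
    experimentLaw K δ g ξs ρ {ω | 1 ≤ Real.exp
      (ε * (3 * tupleLog S A H δ / √(sourceVar δ ω.2 h s a)) * sourceDev Y ω.1 ω.2 h s a -
        18 * tupleLog S A H δ)} ≤ ENNReal.ofReal (Real.exp (-(9 * tupleLog S A H δ))) := by
  have := hg.isProbabilityMeasure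
  have : IsProbabilityMeasure (sourceLaw L g) := by unfold sourceLaw; infer_instance
  set τ := tupleLog S A H δ with hτdef
  let V : (Fin L → Finset (Fin K)) → (Fin L × Fin K → A) → ℝ := fun b α =>
    τ / ((keptSeen b α a).card : ℝ)
  -- Unseen sources get the coefficient `0`; for fixed `b` and `α` the exponential is then a product
  -- over all sources with deterministic coefficients.
  let u : (Fin L → Finset (Fin K)) → (Fin L × Fin K → A) → Fin L → ℝ := fun b α l =>
    if l ∈ keptSeen b α a then ε * (3 * τ / √(V b α)) / ((keptSeen b α a).card : ℝ) else 0
  have husq : ∀ b α, ∑ l, u b α l ^ 2 ≤ 9 * τ := by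
    intro b α
    simp only [u, ite_pow, ne_eq, OfNat.ofNat_ne_zero, not_false_eq_true, zero_pow]
    rw [Finset.sum_ite_mem, Finset.univ_inter, Finset.sum_const, nsmul_eq_mul]
    rcases (Nat.cast_nonneg (keptSeen b α a).card : (0 : ℝ) ≤ _).eq_or_lt with h0 | h0
    · rw [← h0]
      simp only [zero_mul]
      positivity
    rcases hτ.eq_or_lt with h1 | h1
    · simp [← h1]
    have hV : 0 < V b α := div_pos h1 h0
    rw [div_pow, mul_pow, hε, one_mul, div_pow, Real.sq_sqrt hV.le]
    refine le_of_eq ?_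
    simp only [V]
    field_simp
    norm_num
  let F : Sources L H S A → Sample L K H S A → ℝ := fun θ x => Real.exp
    (ε * (3 * τ / √(sourceVar δ x h s a)) * sourceDev Y θ x h s a - 18 * τ)
  have hFmeas : ∀ x, Measurable fun θ => F θ x := by
    intro x
    simp only [F, sourceDev]
    have hYl : ∀ l : Fin L, Measurable fun θ : Sources L H S A => Y (θ l h) := fun l =>
      hY.comp ((measurable_pi_apply h).comp (measurable_pi_apply l))
    fun_prop
  refine (experimentLaw_le_lintegral (F := F) hFmeas).trans ?_
  let w : Sources L H S A → (Fin L × Fin K → S) → ℝ≥0∞ := fun θ z =>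
    ∏ i : Fin L × Fin K, ENNReal.ofReal
      (stateDist (ξs i.1) (ρ i.1) (θ.transition i.1) h (z i))
  let C : (Fin L × Fin K → S) → (Fin L → Finset (Fin K)) → (Fin L × Fin K → A) → ℝ≥0∞ :=
    fun z b α => ENNReal.ofReal (keepWeight H δ s z b * actionWeight ρ h z α)
  -- The next states sum out, since the deviation does not involve them. Given the states, kept sets
  -- and actions have laws free of the sources; so the sources enter only through the state weights
  -- and the models of step `h`.
  have hae : ∀ᵐ θ ∂sourceLaw L g,
      ∑ x, ENNReal.ofReal (sampleProb δ ξs ρ θ x) * ENNReal.ofReal (F θ x) =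
      ∑ z, ∑ b, ∑ α, C z b α * ENNReal.ofReal (Real.exp (-(18 * τ))) *
        (w θ z * ∏ l, ENNReal.ofReal (Real.exp (u b α l * Y (θ l h)))) := by
    filter_upwards [ae_isRegular hg] with θ hθ
    have h0 := sampleProb_nonneg (K := K) (δ := δ) (ρ := ρ) hξs hθ.transition_mem
    simp only [← ENNReal.ofReal_mul (h0 _)]
    rw [← ENNReal.ofReal_sum_of_nonneg fun x _ => mul_nonneg (h0 x) (Real.exp_pos _).le]
    have h1 := sum_sampleProb_mul δ ξs ρ hθ.transition_mem h s fun _ b α _ =>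
      Real.exp (ε * (3 * τ / √(V b α)) * (∑ l ∈ keptSeen b α a, Y (θ l h) /
        ((keptSeen b α a).card : ℝ)) - 18 * τ)
    simp only [← Finset.sum_mul, sum_nextWeight hθ.transition_mem, one_mul] at h1
    refine (congrArg ENNReal.ofReal h1).trans ?_
    simp only [Finset.mul_sum]
    have hnn : ∀ z b α, 0 ≤ stateWeight ξs ρ θ h z * (keepWeight H δ s z b *
        (actionWeight ρ h z α * Real.exp (ε * (3 * τ / √(V b α)) * (∑ l ∈ keptSeen b α a,
        Y (θ l h) / ((keptSeen b α a).card : ℝ)) - 18 * τ))) := fun z b α =>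
      mul_nonneg (stateWeight_nonneg hξs hθ.transition_mem h z)
        (mul_nonneg (keepWeight_nonneg H δ s z b)
          (mul_nonneg (actionWeight_nonneg ρ h z α) (Real.exp_pos _).le))
    simp only [Finset.mul_sum] at hnn
    rw [ENNReal.ofReal_sum_of_nonneg fun z _ => Finset.sum_nonneg fun b _ =>
      Finset.sum_nonneg fun α _ => hnn z b α]
    refine Finset.sum_congr rfl fun z _ => ?_
    rw [ENNReal.ofReal_sum_of_nonneg fun b _ => Finset.sum_nonneg fun α _ => hnn z b α]
    refine Finset.sum_congr rfl fun b _ => ?_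
    rw [ENNReal.ofReal_sum_of_nonneg fun α _ => hnn z b α]
    refine Finset.sum_congr rfl fun α _ => ?_
    have hsum : ∑ i ∈ keptSeen b α a, ε * (3 * τ / √(V b α)) * (Y (θ i h) /
        ((keptSeen b α a).card : ℝ)) = ∑ l, u b α l * Y (θ l h) := by
      simp only [u, ite_mul, zero_mul]
      rw [Finset.sum_ite_mem, Finset.univ_inter]
      exact Finset.sum_congr rfl fun l _ => by ring
    have hw : w θ z = ENNReal.ofReal (stateWeight ξs ρ θ h z) :=
      (ENNReal.ofReal_prod_of_nonneg fun i _ =>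
        (stateDist_mem (hξs i.1) (ρ i.1) (hθ.transition_mem i.1) h.2.le).1 _).symm
    rw [hsum, hw, ← ENNReal.ofReal_prod_of_nonneg fun l _ => (Real.exp_pos _).le,
      ← Real.exp_sum]
    have hk := mul_nonneg (keepWeight_nonneg H δ s z b) (actionWeight_nonneg ρ h z α)
    rw [← ENNReal.ofReal_mul hk, ← ENNReal.ofReal_mul
      (stateWeight_nonneg hξs hθ.transition_mem h z), ← ENNReal.ofReal_mul (by positivity),
      sub_eq_add_neg, Real.exp_add]
    congr 1
    ring
  rw [lintegral_congr_ae hae]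
  have hwm : ∀ z, Measurable fun θ : Sources L H S A => w θ z := fun z =>
    Finset.measurable_prod _ fun i _ => (measurable_stateDist _ _ _ _ _).ennreal_ofReal
  have hGm : ∀ b α l, Measurable fun y => ENNReal.ofReal (Real.exp (u b α l * Y y)) :=
    fun b α l => by fun_prop
  have hGm' : ∀ b α, Measurable fun θ : Sources L H S A =>
      ∏ l, ENNReal.ofReal (Real.exp (u b α l * Y (θ l h))) := fun b α =>
    Finset.measurable_prod _ fun l _ => (hGm b α l).comp
      ((measurable_pi_apply h).comp (measurable_pi_apply l))
  -- The sources themselves fluctuate here, so each term is integrated over them instead of being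
  -- bounded at fixed sources.
  have hterm : ∀ z b α, ∫⁻ θ, C z b α * ENNReal.ofReal (Real.exp (-(18 * τ))) *
        (w θ z * ∏ l, ENNReal.ofReal (Real.exp (u b α l * Y (θ l h)))) ∂sourceLaw L g ≤
      ∫⁻ θ, C z b α * w θ z * ENNReal.ofReal (Real.exp (-(9 * τ))) ∂sourceLaw L g := by
    intro z b α
    have hwG : Measurable fun θ : Sources L H S A =>
        w θ z * ∏ l, ENNReal.ofReal (Real.exp (u b α l * Y (θ l h))) := (hwm z).mul (hGm' b α)
    rw [lintegral_const_mul _ hwG,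
      lintegral_mul_const _ ((hwm z).const_mul _), lintegral_const_mul _ (hwm z)]
    have h1 := lintegral_stateWeight_mul_prod_le (ξs := ξs) (ρ := ρ) hg h z (hGm b α)
      fun l => lintegral_exp_mul_le hY hY1 hY0 (u b α l)
    rw [← ENNReal.ofReal_prod_of_nonneg fun l _ => (Real.exp_pos _).le, ← Real.exp_sum] at h1
    calc _ ≤ C z b α * ENNReal.ofReal (Real.exp (-(18 * τ))) *
          ((∫⁻ θ, w θ z ∂sourceLaw L g) * ENNReal.ofReal (Real.exp (9 * τ))) := by
          gcongr
          refine h1.trans ?_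
          gcongr
          exact husq b α
      _ = C z b α * (∫⁻ θ, w θ z ∂sourceLaw L g) * (ENNReal.ofReal (Real.exp (-(18 * τ))) *
          ENNReal.ofReal (Real.exp (9 * τ))) := by ring
      _ = _ := by
          rw [← ENNReal.ofReal_mul (Real.exp_pos _).le, ← Real.exp_add]
          congr 3
          ring
  -- After the termwise bound the weights recombine to total mass one.
  have hmass : ∀ᵐ θ ∂sourceLaw L g, ∑ z, ∑ b, ∑ α, C z b α * w θ z *
      ENNReal.ofReal (Real.exp (-(9 * τ))) = ENNReal.ofReal (Real.exp (-(9 * τ))) := by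
    filter_upwards [ae_isRegular hg] with θ hθ
    have hw : ∀ z, w θ z = ENNReal.ofReal (stateWeight ξs ρ θ h z) := fun z =>
      (ENNReal.ofReal_prod_of_nonneg fun i _ =>
        (stateDist_mem (hξs i.1) (ρ i.1) (hθ.transition_mem i.1) h.2.le).1 _).symm
    have hC : ∀ z, ∑ b, ∑ α, C z b α = 1 := by
      intro z
      have hnn : ∀ b α, 0 ≤ keepWeight H δ s z b * actionWeight ρ h z α := fun b α =>
        mul_nonneg (keepWeight_nonneg H δ s z b) (actionWeight_nonneg ρ h z α)
      simp only [C]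
      simp only [← fun b => ENNReal.ofReal_sum_of_nonneg
        (fun α (_ : α ∈ Finset.univ) => hnn b α)]
      rw [← ENNReal.ofReal_sum_of_nonneg fun b _ => Finset.sum_nonneg fun α _ => hnn b α]
      simp only [← Finset.mul_sum, sum_actionWeight, mul_one, sum_keepWeight, ENNReal.ofReal_one]
    simp only [← Finset.sum_mul, hC, hw, one_mul]
    rw [← ENNReal.ofReal_sum_of_nonneg fun z _ => stateWeight_nonneg hξs hθ.transition_mem h z,
      sum_stateWeight hξs hθ.transition_mem, ENNReal.ofReal_one, one_mul]
  calc _ = ∑ z, ∑ b, ∑ α, ∫⁻ θ, C z b α * ENNReal.ofReal (Real.exp (-(18 * τ))) *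
        (w θ z * ∏ l, ENNReal.ofReal (Real.exp (u b α l * Y (θ l h)))) ∂sourceLaw L g := by
        have hm : ∀ z b α, Measurable fun θ : Sources L H S A =>
            C z b α * ENNReal.ofReal (Real.exp (-(18 * τ))) *
            (w θ z * ∏ l, ENNReal.ofReal (Real.exp (u b α l * Y (θ l h)))) := fun z b α =>
          ((hwm z).mul (hGm' b α)).const_mul _
        rw [lintegral_finsetSum _ fun z _ => Finset.measurable_sum _ fun b _ =>
          Finset.measurable_sum _ fun α _ => hm z b α]
        refine Finset.sum_congr rfl fun z _ => ?_
        rw [lintegral_finsetSum _ fun b _ => Finset.measurable_sum _ fun α _ => hm z b α]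
        refine Finset.sum_congr rfl fun b _ => ?_
        rw [lintegral_finsetSum _ fun α _ => hm z b α]
    _ ≤ ∑ z, ∑ b, ∑ α, ∫⁻ θ, C z b α * w θ z * ENNReal.ofReal (Real.exp (-(9 * τ)))
          ∂sourceLaw L g := Finset.sum_le_sum fun z _ => Finset.sum_le_sum fun b _ =>
        Finset.sum_le_sum fun α _ => hterm z b α
    _ = ∫⁻ θ, ∑ z, ∑ b, ∑ α, C z b α * w θ z * ENNReal.ofReal (Real.exp (-(9 * τ)))
          ∂sourceLaw L g := by
        have hm : ∀ z b α, Measurable fun θ : Sources L H S A =>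
            C z b α * w θ z * ENNReal.ofReal (Real.exp (-(9 * τ))) := fun z b α =>
          ((hwm z).const_mul _).mul_const _
        rw [lintegral_finsetSum _ fun z _ => Finset.measurable_sum _ fun b _ =>
          Finset.measurable_sum _ fun α _ => hm z b α]
        refine Finset.sum_congr rfl fun z _ => ?_
        rw [lintegral_finsetSum _ fun b _ => Finset.measurable_sum _ fun α _ => hm z b α]
        refine Finset.sum_congr rfl fun b _ => ?_
        rw [lintegral_finsetSum _ fun α _ => hm z b α]
    _ = _ := by
        rw [lintegral_congr_ae hmass, lintegral_const, measure_univ, mul_one]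

end SourceDeviations

/-! ### Union bound over atypical outcomes. -/

section TypicalOutcomes

variable {L K H : ℕ} {S A : Type*} [Fintype S] [DecidableEq S] [Fintype A] [DecidableEq A]
  {M : EpisodicMDP H S A} {g : Fin H → Measure (StepModel S A)} {Tl Tu δ : ℝ}
  {ξs : Fin L → S → ℝ} {ρ : Fin L → Policy H S A}

/-- The two signs. -/
def boolSign (b : Bool) : ℝ := if b then 1 else -1

theorem boolSign_sq (b : Bool) : boolSign b ^ 2 = 1 := by
  cases b <;> simp [boolSign]

/-- At the scale `3 * τ / √v`, a deviation of `6 * √v` corresponds to the exponent `18 * τ`; the two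
signs give the absolute value. -/
theorem abs_le_of_exp_lt_one {τ v X : ℝ} (hτ : 0 < τ) (hv : 0 < v)
    (h : ∀ b, ¬ 1 ≤ Real.exp (boolSign b * (3 * τ / √v) * X - 18 * τ)) : |X| ≤ 6 * √v := by
  have hr : 0 < √v := Real.sqrt_pos.2 hv
  have key : ∀ b, boolSign b * X ≤ 6 * √v := by
    intro b
    have h1 := h b
    rw [Real.one_le_exp_iff, not_le] at h1
    have h2 : boolSign b * (3 * τ / √v) * X = 3 * τ * (boolSign b * X) / √v := by ring
    have h3 : 3 * τ * (boolSign b * X) / √v < 18 * τ := by linarith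
    rw [div_lt_iff₀ hr] at h3
    nlinarith
  have h1 := key true
  have h2 := key false
  simp only [boolSign, if_true, Bool.false_eq_true, if_false] at h1 h2
  exact abs_le.2 ⟨by linarith, by linarith⟩

theorem card_filter_lt_half : (Finset.univ.filter fun k : Fin K => (k : ℕ) < K / 2).card =
    K / 2 := by
  rw [Fin.card_filter_val_lt]
  omega

theorem card_filter_not_lt_half :
    (Finset.univ.filter fun k : Fin K => ¬ (k : ℕ) < K / 2).card = K - K / 2 := by
  have h1 := Finset.card_filter_add_card_filter_not
    (s := (Finset.univ : Finset (Fin K))) fun k => (k : ℕ) < K / 2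
  rw [card_filter_lt_half, Finset.card_univ, Fintype.card_fin] at h1
  omega

/-- The deviation of the transition estimate splits into the two kinds of errors. -/
theorem transitionEst_sub_eq {θ : Sources L H S A} {x : Sample L K H S A} {h : Fin H} {s : S}
    {a : A} (hx : (seenSources x h s a).Nonempty) (s' : S) :
    transitionEst x h s a s' - M.P h s a s' = samplingDev θ x h s a s' +
      sourceDev (fun y => y.2 s a s' - M.P h s a s') θ x h s a := by
  have hn : ((seenSources x h s a).card : ℝ) ≠ 0 := by exact_mod_cast hx.card_pos.ne'
  rw [transitionEst_of_nonempty hx, samplingDev, sourceDev, ← Finset.sum_div, ← Finset.sum_div,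
    Finset.sum_sub_distrib, Finset.sum_sub_distrib, Finset.sum_const, nsmul_eq_mul]
  simp only [Sources.transition]
  field_simp
  ring

theorem rewardEst_sub_eq {θ : Sources L H S A} {x : Sample L K H S A} {h : Fin H} {s : S}
    {a : A} (hx : (seenSources x h s a).Nonempty) :
    rewardEst θ x h s a - M.r h s a = sourceDev (fun y => y.1 s a - M.r h s a) θ x h s a := by
  have hn : ((seenSources x h s a).card : ℝ) ≠ 0 := by exact_mod_cast hx.card_pos.ne'
  rw [rewardEst, max_eq_left (by exact_mod_cast hx.card_pos), sourceDev, ← Finset.sum_div,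
    Finset.sum_sub_distrib, Finset.sum_const, nsmul_eq_mul]
  simp only [Sources.reward]
  field_simp

theorem samplingVar_pos (hτ : 0 < tupleLog S A H δ) {x : Sample L K H S A} {h : Fin H} {s : S}
    {a : A} (hx : (seenSources x h s a).Nonempty) : 0 < samplingVar δ x h s a := by
  refine Finset.sum_pos (fun l hl => ?_) hx
  have h1 := (Finset.mem_filter.1 hl).2
  have h2 := hx.card_pos
  positivity

theorem sourceVar_pos (hτ : 0 < tupleLog S A H δ) {x : Sample L K H S A} {h : Fin H} {s : S}
    {a : A} (hx : (seenSources x h s a).Nonempty) : 0 < sourceVar δ x h s a := by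
  have h2 := hx.card_pos
  unfold sourceVar
  positivity

/-- Outcomes with small exponents in all tail bounds are typical. -/
theorem isTypical_of_exp_lt_one (hτ : 0 < tupleLog S A H δ) (hξs : ∀ l, ξs l ∈ stdSimplex ℝ S)
    {θ : Sources L H S A} {x : Sample L K H S A} (hθ : θ.IsRegular M)
    (hx : 0 < sampleProb δ ξs ρ θ x)
    (h1 : ∀ h s a s' b, ¬ 1 ≤ Real.exp (boolSign b *
      (3 * tupleLog S A H δ / √(samplingVar δ x h s a)) * samplingDev θ x h s a s' -
        18 * tupleLog S A H δ))
    (h2 : ∀ h s a s' b, ¬ 1 ≤ Real.exp (boolSign b *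
      (3 * tupleLog S A H δ / √(sourceVar δ x h s a)) *
        sourceDev (fun y => y.2 s a s' - M.P h s a s') θ x h s a - 18 * tupleLog S A H δ))
    (h3 : ∀ h s a b, ¬ 1 ≤ Real.exp (boolSign b *
      (3 * tupleLog S A H δ / √(sourceVar δ x h s a)) *
        sourceDev (fun y => y.1 s a - M.r h s a) θ x h s a - 18 * tupleLog S A H δ))
    (h4 : ∀ l (h : Fin H) s, ¬ 1 ≤ Real.exp
      (5 / 8 * (Finset.univ.filter fun k : Fin K => (k : ℕ) < K / 2).card *
        stateDist (ξs l) (ρ l) (θ.transition l) h s -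
        ((visits (fun k : Fin K => (k : ℕ) < K / 2) (stepStates x.1 h) l s).card : ℝ) -
        32 * logFactor S A H L K δ / 8))
    (h5 : ∀ l (h : Fin H) s, ¬ 1 ≤ Real.exp
      (5 / 8 * (Finset.univ.filter fun k : Fin K => ¬ (k : ℕ) < K / 2).card *
        stateDist (ξs l) (ρ l) (θ.transition l) h s -
        ((visits (fun k : Fin K => ¬ (k : ℕ) < K / 2) (stepStates x.1 h) l s).card : ℝ) -
        32 * logFactor S A H L K δ / 8))
    (h6 : ∀ l h s a, ¬ 1 ≤ Real.exp (5 / 8 * (x.2 l h s).card * (ρ l).prob h s a -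
      (count x l h s a : ℝ) - 32 * logFactor S A H L K δ / 8)) :
    IsTypical M δ ξs ρ θ x where
  transition_mem := hθ.transition_mem
  transition_ac := hθ.transition_ac
  reward_mem := hθ.reward_mem
  trajProb_pos l k := by
    refine (trajProb_nonneg (hξs l).1 _ (fun h s a => (hθ.transition_mem l h s a).1) _).lt_of_ne'
      fun h0 => hx.ne' ?_
    rw [sampleProb, datasetProb, Finset.prod_eq_zero (Finset.mem_univ l)
      (Finset.prod_eq_zero (Finset.mem_univ k) h0), zero_mul]
  selection_mem l h s := by
    by_contra h0
    refine hx.ne' ?_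
    rw [sampleProb, selectionProb, Finset.prod_eq_zero (Finset.mem_univ l)
      (Finset.prod_eq_zero (Finset.mem_univ h)
        (Finset.prod_eq_zero (Finset.mem_univ s) (if_neg h0))), mul_zero]
  transition_dev h s a hne s' := by
    rw [transitionEst_sub_eq (θ := θ) hne]
    exact (abs_add_le _ _).trans (add_le_add
      (abs_le_of_exp_lt_one hτ (samplingVar_pos hτ hne) (h1 h s a s'))
      (abs_le_of_exp_lt_one hτ (sourceVar_pos hτ hne) (h2 h s a s')))
  reward_dev h s a hne := by
    rw [rewardEst_sub_eq (θ := θ) hne]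
    exact abs_le_of_exp_lt_one hτ (sourceVar_pos hτ hne) (h3 h s a)
  -- By `hT`, `5 / 8` of the mean minus `4 * ℓ` is at least half the mean.
  main_count l h s hT := by
    have := h4 l h s
    rw [Real.one_le_exp_iff, card_filter_lt_half] at this
    change _ ≤ ((visits (fun k : Fin K => (k : ℕ) < K / 2) (stepStates x.1 h) l s).card : ℝ)
    linarith
  aux_count l h s hT := by
    have := h5 l h s
    rw [Real.one_le_exp_iff, card_filter_not_lt_half] at this
    change _ ≤ ((visits (fun k : Fin K => ¬ (k : ℕ) < K / 2) (stepStates x.1 h) l s).card : ℝ)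
    linarith
  action_count l h s a hT := by
    have := h6 l h s a
    rw [Real.one_le_exp_iff] at this
    linarith

theorem measure_iUnion_le_ofReal {Ω ι : Type*} [MeasurableSpace Ω] [Fintype ι] {μ : Measure Ω}
    {E : ι → Set Ω} {q : ℝ} (hE : ∀ i, μ (E i) ≤ ENNReal.ofReal q) :
    μ (⋃ i, E i) ≤ ENNReal.ofReal (Fintype.card ι * q) := by
  refine (measure_iUnion_fintype_le μ E).trans ((Finset.sum_le_sum fun i _ => hE i).trans ?_)
  rw [Finset.sum_const, nsmul_eq_mul, ENNReal.ofReal_mul (Nat.cast_nonneg _),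
    ENNReal.ofReal_natCast, Finset.card_univ]

theorem ae_abs_sub_le_one {Ω : Type*} [MeasurableSpace Ω] {μ : Measure Ω} {f : Ω → ℝ} {c : ℝ}
    (hf : ∀ᵐ ω ∂μ, f ω ∈ Set.Icc (0 : ℝ) 1) (hc : c ∈ Set.Icc (0 : ℝ) 1) :
    ∀ᵐ ω ∂μ, |f ω - c| ≤ 1 := by
  filter_upwards [hf] with ω hω
  exact abs_le.2 ⟨by linarith [hω.1, hc.2], by linarith [hω.2, hc.1]⟩

theorem integral_sub_const_eq_zero {Ω : Type*} [MeasurableSpace Ω] {μ : Measure Ω}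
    [IsProbabilityMeasure μ] {f : Ω → ℝ} (hm : Measurable f) {c : ℝ}
    (hf : ∀ᵐ ω ∂μ, f ω ∈ Set.Icc (0 : ℝ) 1) (hc : ∫ ω, f ω ∂μ = c) :
    ∫ ω, (f ω - c) ∂μ = 0 := by
  have hint : Integrable f μ := Integrable.of_bound hm.aestronglyMeasurable 1 <| by
    filter_upwards [hf] with ω hω
    exact abs_le.2 ⟨by linarith [hω.1], hω.2⟩
  rw [integral_sub hint (integrable_const _), hc]
  simp

/-- Atypical outcomes have probability at most `δ`. -/
theorem experimentLaw_not_isTypical_le [Nonempty S] (hg : IsTaskSourceLaw M g Tl Tu)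
    (hξs : ∀ l, ξs l ∈ stdSimplex ℝ S) (hH : 1 ≤ H) (hL : 1 ≤ L) (hK : 1 ≤ K) (hδ0 : 0 < δ)
    (hδ1 : δ < 1) (hA : 2 ≤ Fintype.card A) :
    experimentLaw K δ g ξs ρ {ω | ¬ IsTypical M δ ξs ρ ω.1 ω.2} ≤ ENNReal.ofReal δ := by
  have hprob := hg.isProbabilityMeasure
  have hS1 : (1 : ℝ) ≤ Fintype.card S := by exact_mod_cast Fintype.card_pos (α := S)
  have hA2 : (2 : ℝ) ≤ Fintype.card A := by exact_mod_cast hA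
  have hH1 : (1 : ℝ) ≤ H := by exact_mod_cast hH
  have hL1 : (1 : ℝ) ≤ L := by exact_mod_cast hL
  have hK1 : (1 : ℝ) ≤ K := by exact_mod_cast hK
  set n : ℝ := (Fintype.card S : ℝ) * Fintype.card A * H with hn
  set N : ℝ := (K : ℝ) * H * Fintype.card S * Fintype.card A * L with hN
  have hn2 : 2 ≤ n := by
    calc (2 : ℝ) = 1 * 2 * 1 := by norm_num
      _ ≤ n := by rw [hn]; gcongr
  have hN2 : 2 ≤ N := by
    calc (2 : ℝ) = 1 * 1 * 1 * 2 * 1 := by norm_num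
      _ ≤ N := by rw [hN]; gcongr
  have hτ : 0 < tupleLog S A H δ := by
    refine Real.log_pos ?_
    rw [lt_div_iff₀ hδ0]
    linarith
  set τ := tupleLog S A H δ with hτdef
  set ℓ := logFactor S A H L K δ with hℓdef
  -- Estimation events are indexed by tuples and next states only, so the penalty needs no logarithm
  -- of `L` or `K`. The count events are also indexed by sources and use the larger logarithm.
  have hq : Real.exp (-(9 * τ)) = (δ / n) ^ 9 := by
    have h1 : -(9 * τ) = ((9 : ℕ) : ℝ) * (-τ) := by push_cast; ring
    rw [h1, Real.exp_nat_mul, Real.exp_neg, hτdef, tupleLog, Real.exp_log (by positivity), inv_div]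
  have hr : Real.exp (-(32 * ℓ / 8)) = (δ / N) ^ 4 := by
    have h1 : -(32 * ℓ / 8) = ((4 : ℕ) : ℝ) * (-ℓ) := by push_cast; ring
    rw [h1, Real.exp_nat_mul, Real.exp_neg, hℓdef, logFactor, Real.exp_log (by positivity),
      inv_div]
  set q := Real.exp (-(9 * τ)) with hqdef
  set r := Real.exp (-(32 * ℓ / 8)) with hrdef
  have hstate := measurable_stateDist (L := L) (H := H) (S := S) (A := A)
  have htrans := measurable_transition (L := L) (H := H) (S := S) (A := A)
  let E₁ : Fin H × S × A × S × Bool → Set (Sources L H S A × Sample L K H S A) := fun i =>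
    {ω | 1 ≤ Real.exp (boolSign i.2.2.2.2 *
      (3 * τ / √(samplingVar δ ω.2 i.1 i.2.1 i.2.2.1)) *
        samplingDev ω.1 ω.2 i.1 i.2.1 i.2.2.1 i.2.2.2.1 - 18 * τ)}
  let E₂ : Fin H × S × A × S × Bool → Set (Sources L H S A × Sample L K H S A) := fun i =>
    {ω | 1 ≤ Real.exp (boolSign i.2.2.2.2 *
      (3 * τ / √(sourceVar δ ω.2 i.1 i.2.1 i.2.2.1)) *
        sourceDev (fun y => y.2 i.2.1 i.2.2.1 i.2.2.2.1 - M.P i.1 i.2.1 i.2.2.1 i.2.2.2.1)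
          ω.1 ω.2 i.1 i.2.1 i.2.2.1 - 18 * τ)}
  let E₃ : Fin H × S × A × Bool → Set (Sources L H S A × Sample L K H S A) := fun i =>
    {ω | 1 ≤ Real.exp (boolSign i.2.2.2 *
      (3 * τ / √(sourceVar δ ω.2 i.1 i.2.1 i.2.2.1)) *
        sourceDev (fun y => y.1 i.2.1 i.2.2.1 - M.r i.1 i.2.1 i.2.2.1)
          ω.1 ω.2 i.1 i.2.1 i.2.2.1 - 18 * τ)}
  let E₄ : Fin L × Fin H × S → Set (Sources L H S A × Sample L K H S A) := fun i =>
    {ω | 1 ≤ Real.exp (5 / 8 * (Finset.univ.filter fun k : Fin K => (k : ℕ) < K / 2).card *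
        stateDist (ξs i.1) (ρ i.1) (ω.1.transition i.1) i.2.1 i.2.2 -
        ((visits (fun k : Fin K => (k : ℕ) < K / 2) (stepStates ω.2.1 i.2.1) i.1 i.2.2).card : ℝ)
        - 32 * ℓ / 8)}
  let E₅ : Fin L × Fin H × S → Set (Sources L H S A × Sample L K H S A) := fun i =>
    {ω | 1 ≤ Real.exp (5 / 8 * (Finset.univ.filter fun k : Fin K => ¬ (k : ℕ) < K / 2).card *
        stateDist (ξs i.1) (ρ i.1) (ω.1.transition i.1) i.2.1 i.2.2 -
        ((visits (fun k : Fin K => ¬ (k : ℕ) < K / 2)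
          (stepStates ω.2.1 i.2.1) i.1 i.2.2).card : ℝ) - 32 * ℓ / 8)}
  let E₆ : Fin L × Fin H × S × A → Set (Sources L H S A × Sample L K H S A) := fun i =>
    {ω | 1 ≤ Real.exp (5 / 8 * (ω.2.2 i.1 i.2.1 i.2.2.1).card *
      (ρ i.1).prob i.2.1 i.2.2.1 i.2.2.2 - (count ω.2 i.1 i.2.1 i.2.2.1 i.2.2.2 : ℝ) -
        32 * ℓ / 8)}
  have b₁ := measure_iUnion_le_ofReal (μ := experimentLaw K δ g ξs ρ) (E := E₁) (q := q)
    fun ⟨h, s, a, s', b⟩ => experimentLaw_le_ofReal (F := fun θ x => Real.exp (boolSign b *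
      (3 * τ / √(samplingVar δ x h s a)) * samplingDev θ x h s a s' - 18 * τ)) hg hξs
      (fun x => by simp only [samplingDev]; fun_prop) (fun θ x => (Real.exp_pos _).le)
      fun θ hθ => sum_sampleProb_mul_exp_samplingDev_le δ hξs hθ.transition_mem h s a s' hτ.le
        (boolSign_sq b)
  have b₂ := measure_iUnion_le_ofReal (μ := experimentLaw K δ g ξs ρ) (E := E₂) (q := q)
    fun ⟨h, s, a, s', b⟩ => by
      have hmem : ∀ᵐ y ∂g h, y.2 s a s' ∈ Set.Icc (0 : ℝ) 1 := by
        filter_upwards [hg.transition_mem h] with y hy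
        exact mem_Icc_of_mem_stdSimplex (hy s a) s'
      exact experimentLaw_sourceDev_le hg hξs h s a hτ.le (boolSign_sq b) (by fun_prop)
        (ae_abs_sub_le_one hmem (mem_Icc_of_mem_stdSimplex (M.P_mem h s a) s'))
        (integral_sub_const_eq_zero (by fun_prop) hmem (hg.transition_mean h s a s'))
  have b₃ := measure_iUnion_le_ofReal (μ := experimentLaw K δ g ξs ρ) (E := E₃) (q := q)
    fun ⟨h, s, a, b⟩ => by
      have hmem : ∀ᵐ y ∂g h, y.1 s a ∈ Set.Icc (0 : ℝ) 1 := by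
        filter_upwards [hg.reward_mem h] with y hy using hy s a
      exact experimentLaw_sourceDev_le hg hξs h s a hτ.le (boolSign_sq b) (by fun_prop)
        (ae_abs_sub_le_one hmem (M.r_mem h s a))
        (integral_sub_const_eq_zero (by fun_prop) hmem (hg.reward_mean h s a))
  have b₄ := measure_iUnion_le_ofReal (μ := experimentLaw K δ g ξs ρ) (E := E₄) (q := r)
    fun ⟨l, h, s⟩ => experimentLaw_le_ofReal (F := fun θ x => Real.exp (5 / 8 *
        (Finset.univ.filter fun k : Fin K => (k : ℕ) < K / 2).card *
        stateDist (ξs l) (ρ l) (θ.transition l) h s -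
        ((visits (fun k : Fin K => (k : ℕ) < K / 2) (stepStates x.1 h) l s).card : ℝ)
        - 32 * ℓ / 8)) hg hξs (fun x => by fun_prop) (fun θ x => (Real.exp_pos _).le)
      fun θ hθ => sum_sampleProb_mul_exp_visits_le δ hξs hθ.transition_mem _ l h s _
  have b₅ := measure_iUnion_le_ofReal (μ := experimentLaw K δ g ξs ρ) (E := E₅) (q := r)
    fun ⟨l, h, s⟩ => experimentLaw_le_ofReal (F := fun θ x => Real.exp (5 / 8 *
        (Finset.univ.filter fun k : Fin K => ¬ (k : ℕ) < K / 2).card *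
        stateDist (ξs l) (ρ l) (θ.transition l) h s -
        ((visits (fun k : Fin K => ¬ (k : ℕ) < K / 2) (stepStates x.1 h) l s).card : ℝ)
        - 32 * ℓ / 8)) hg hξs (fun x => by fun_prop) (fun θ x => (Real.exp_pos _).le)
      fun θ hθ => sum_sampleProb_mul_exp_visits_le δ hξs hθ.transition_mem _ l h s _
  have b₆ := measure_iUnion_le_ofReal (μ := experimentLaw K δ g ξs ρ) (E := E₆) (q := r)
    fun ⟨l, h, s, a⟩ => experimentLaw_le_ofReal (F := fun θ x => Real.exp (5 / 8 *
        (x.2 l h s).card * (ρ l).prob h s a - (count x l h s a : ℝ) - 32 * ℓ / 8)) hg hξs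
      (fun x => by fun_prop) (fun θ x => (Real.exp_pos _).le)
      fun θ hθ => sum_sampleProb_mul_exp_count_le δ hξs hθ.transition_mem l h s a _
  have hsub : {ω : Sources L H S A × Sample L K H S A | ¬ IsTypical M δ ξs ρ ω.1 ω.2} ⊆
      {ω | ¬ (ω.1.IsRegular M ∧ 0 < sampleProb δ ξs ρ ω.1 ω.2)} ∪ ((⋃ i, E₁ i) ∪ ((⋃ i, E₂ i) ∪
        ((⋃ i, E₃ i) ∪ ((⋃ i, E₄ i) ∪ ((⋃ i, E₅ i) ∪ ⋃ i, E₆ i))))) := by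
    intro ω hω
    by_contra hcon
    simp only [Set.mem_union, not_or, Set.mem_iUnion, not_exists, Set.mem_ofPred_eq,
      not_not] at hcon
    obtain ⟨⟨h0, h0'⟩, h1, h2, h3, h4, h5, h6⟩ := hcon
    exact hω (isTypical_of_exp_lt_one hτ hξs h0 h0' (fun h s a s' b => h1 (h, s, a, s', b))
      (fun h s a s' b => h2 (h, s, a, s', b)) (fun h s a b => h3 (h, s, a, b))
      (fun l h s => h4 (l, h, s)) (fun l h s => h5 (l, h, s)) fun l h s a => h6 (l, h, s, a))
  -- Monotonicity and subadditivity hold for arbitrary sets, so the atypical set need not be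
  -- measurable.
  refine (measure_mono hsub).trans ((measure_union_le _ _).trans ?_)
  rw [ae_experimentLaw hg, zero_add]
  refine (measure_union_le _ _).trans ((add_le_add b₁ ((measure_union_le _ _).trans
    (add_le_add b₂ ((measure_union_le _ _).trans (add_le_add b₃ ((measure_union_le _ _).trans
    (add_le_add b₄ ((measure_union_le _ _).trans (add_le_add b₅ b₆))))))))).trans ?_)
  have hq0 : 0 ≤ q := (Real.exp_pos _).le
  have hr0 : 0 ≤ r := (Real.exp_pos _).le
  rw [← ENNReal.ofReal_add (by positivity) (by positivity),
    ← ENNReal.ofReal_add (by positivity) (by positivity),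
    ← ENNReal.ofReal_add (by positivity) (by positivity),
    ← ENNReal.ofReal_add (by positivity) (by positivity),
    ← ENNReal.ofReal_add (by positivity) (by positivity)]
  refine ENNReal.ofReal_le_ofReal ?_
  simp only [Fintype.card_prod, Fintype.card_fin, Fintype.card_bool, Nat.cast_mul,
    Nat.cast_ofNat]
  -- Two actions give `n ≥ 2`; surplus powers of `δ / n` then become numerical factors.
  have hδn : δ / n ≤ 1 / 2 := by
    rw [div_le_div_iff₀ (by linarith) two_pos]
    linarith
  have hδN : δ / N ≤ 1 / 2 := by
    rw [div_le_div_iff₀ (by linarith) two_pos]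
    linarith
  have hnq : n ^ 2 * q ≤ δ / 128 := by
    have h1 : n ^ 2 * (δ / n) ^ 9 = δ * δ * (δ / n) ^ 7 := by field_simp
    have h2 : (δ / n) ^ 7 ≤ (1 / 2) ^ 7 := pow_le_pow_left₀ (by positivity) hδn 7
    rw [hq, h1]
    calc δ * δ * (δ / n) ^ 7 ≤ δ * 1 * (1 / 2) ^ 7 := by gcongr
      _ = δ / 128 := by ring
  have hNr : N * r ≤ δ / 8 := by
    have h1 : N * (δ / N) ^ 4 = δ * (δ / N) ^ 3 := by field_simp
    have h2 : (δ / N) ^ 3 ≤ (1 / 2) ^ 3 := pow_le_pow_left₀ (by positivity) hδN 3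
    rw [hr, h1]
    calc δ * (δ / N) ^ 3 ≤ δ * (1 / 2) ^ 3 := by gcongr
      _ = δ / 8 := by ring
  -- The number of states enters twice, through `s` and `s'`, whence `n ^ 2`.
  have c₁ : (H : ℝ) * (Fintype.card S * (Fintype.card A * (Fintype.card S * 2))) * q ≤
      2 * (n ^ 2 * q) := by
    have h1 : n * Fintype.card S * (1 * 1) ≤
        n * Fintype.card S * ((Fintype.card A : ℝ) * H) := by
      gcongr
      linarith
    calc _ = 2 * (n * Fintype.card S * (1 * 1) * q) := by rw [hn]; ring
      _ ≤ 2 * (n * Fintype.card S * ((Fintype.card A : ℝ) * H) * q) := by gcongr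
      _ = _ := by rw [hn]; ring
  have c₃ : (H : ℝ) * (Fintype.card S * (Fintype.card A * 2)) * q ≤ 2 * (n ^ 2 * q) := by
    calc _ = 2 * (n * 1 * q) := by rw [hn]; ring
      _ ≤ 2 * (n * n * q) := by gcongr; linarith
      _ = _ := by ring
  have c₆ : (L : ℝ) * (H * (Fintype.card S * Fintype.card A)) * r ≤ N * r := by
    gcongr
    calc (L : ℝ) * (H * (Fintype.card S * Fintype.card A))
        = 1 * H * Fintype.card S * Fintype.card A * L := by ring
      _ ≤ N := by rw [hN]; gcongr
  have c₄ : (L : ℝ) * (H * Fintype.card S) * r ≤ N * r := by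
    refine le_trans ?_ c₆
    gcongr
    exact le_mul_of_one_le_right (by positivity) (by linarith)
  -- The total is at most `3 * δ / 64 + 3 * δ / 8`.
  linarith

end TypicalOutcomes

end RobustRL

/-- The event that the bound fails has probability at most `δ`: it consists of the outcomes at
which the burn-in conditions hold and the optimal policy is covered, but some output `πhat` of the
algorithm has a robust gap above the bound. -/
theorem theorem4 :
    ∃ c₀ > (0 : ℝ), ∃ c₁ > (0 : ℝ), ∀ c ≥ c₀, ∃ C > (0 : ℝ), ∃ p : ℕ,
      ∀ (S A : Type*) [Fintype S] [DecidableEq S] [Nonempty S]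
        [Fintype A] [DecidableEq A] [Nonempty A]
        (H L K : ℕ) (_ : 1 ≤ H) (_ : 1 ≤ L) (_ : 1 ≤ K)
        (σ δ Tl Tu : ℝ) (_ : 0 < σ) (_ : 0 < δ) (_ : δ < 1)
        (_ : 0 < Tl) (_ : Tl < 1) (_ : 1 < Tu)
        (M : RobustRL.EpisodicMDP H S A) (ξ : S → ℝ) (_ : ξ ∈ stdSimplex ℝ S)
        (ξs : Fin L → S → ℝ) (_ : ∀ l, ξs l ∈ stdSimplex ℝ S)
        (ρ : Fin L → RobustRL.Policy H S A)
        (g : Fin H → Measure (RobustRL.StepModel S A))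
        (_ : RobustRL.IsTaskSourceLaw M g Tl Tu)
        (πstar : RobustRL.DetPolicy H S A) (_ : RobustRL.IsRobustOptimal M σ πstar),
        RobustRL.experimentLaw K δ g ξs ρ
          {ω | RobustRL.BurnIn c₁ δ K M ξs ρ ω.1 ∧
            0 < RobustRL.Ldagger M σ ξ πstar ξs ρ ω.1 ∧
            ∃ πhat : RobustRL.DetPolicy H S A, RobustRL.IsOutput c σ δ ω.1 ω.2 πhat ∧
              C * RobustRL.logFactor S A H L K δ ^ p *
                  RobustRL.rate K M σ ξ πstar ξs ρ ω.1 <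
                RobustRL.robustGap M σ ξ πstar πhat} ≤
          ENNReal.ofReal δ := by
  -- `9` is what `abs_sub_le_bonus` needs and `1000000` what `isAccurate` needs. The logarithm has
  -- exponent one because `√ℓ ≤ 2 * ℓ`.
  refine ⟨9, by norm_num, 1000000, by norm_num, fun c hc => ⟨100 * c, by linarith, 1, ?_⟩⟩
  intro S A _ _ _ _ _ _ H L K hH hL hK σ δ Tl Tu hσ hδ0 hδ1 _ _ _ M ξ hξ ξs hξs ρ g hg πstar _
  -- With one action all deterministic policies coincide and the gap is `0`. The case is separate
  -- because the logarithm can then be arbitrarily close to `0`, when all other sizes are one and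
  -- `δ` is near `1`.
  rcases lt_or_ge (Fintype.card A) 2 with hA | hA
  · have hsub : Subsingleton A := Fintype.card_le_one_iff_subsingleton.1 (by omega)
    have hN : (1 : ℝ) ≤ (K : ℝ) * H * Fintype.card S * Fintype.card A * L / δ := by
      rw [le_div_iff₀ hδ0]
      have h1 : 1 ≤ K * H * Fintype.card S * Fintype.card A * L := by
        have := Fintype.card_pos (α := S)
        have := Fintype.card_pos (α := A)
        exact Nat.succ_le_of_lt (by positivity)
      have h2 : (1 : ℝ) ≤ (K : ℝ) * H * Fintype.card S * Fintype.card A * L := by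
        exact_mod_cast h1
      linarith
    have hℓ : 0 ≤ RobustRL.logFactor S A H L K δ := Real.log_nonneg hN
    refine le_trans (le_of_eq (measure_mono_null (t := ∅) ?_ measure_empty)) zero_le
    rintro ω ⟨-, -, πhat, -, hlt⟩
    rw [Subsingleton.elim πhat πstar, RobustRL.robustGap, sub_self] at hlt
    have h0 := RobustRL.rate_nonneg (K := K) (M := M) (ξ := ξ) (π := πstar) (ξs := ξs) (ρ := ρ)
      (θ := ω.1) hσ.le
    have hc0 : 0 ≤ c := by linarith
    exact absurd hlt (not_lt.2 (by positivity))
  · refine (measure_mono ?_).trans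
      (RobustRL.experimentLaw_not_isTypical_le (ρ := ρ) hg hξs hH hL hK hδ0 hδ1 hA)
    rintro ω ⟨hB, hLd, πhat, hout, hlt⟩ htyp
    rw [pow_one] at hlt
    exact absurd (htyp.robustGap_le hH hL hK hσ hδ0 hδ1 hA hξ hξs hc hB hLd hout) (not_le.2 hlt)
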